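/- Let $\mathbb F\in\{\mathbb R,\mathbb C\}$, let $M$ be a smooth finite-dimensional Hausdorff manifold (not necessarily second countable), and write $R=C_c^\infty(M)$ for the commutative $\mathbb F$-algebra of smooth $\mathbb F$-valued functions on $M$ with compact support. For $f\in R$ and $x\in M$, $f_x$ denotes the germ of $f$ at $x$, and for open $W\subset M$ we write $C_c^\infty(W)=\{f\in R : \operatorname{supp} f\subset W\}$. **Functions and push-forward.** For a manifold $X$ which need not be Hausdorff, $C_c^\infty(X)$ is the linear span, in the space of not necessarily continuous sections of the sheaf of germs of functions on $X$, of the extensions by zero of smooth functions with compact support on Hausdorff open subsets of $X$; for $X=M$ this is $R$. A local diffeomorphism $\phi:X\to Y$ induces $\phi_+:C_c^\infty(X)\to C_c^\infty(Y)$, $\phi_+(u)_z=\sum_{\phi(y)=z}\phi_{*y}(u_y)$, where $\phi_{*y}$ is the induced isomorphism of germs. A local diffeomorphism $\pi:X\to M$ makes $C_c^\infty(X)$ an $R$-module by $(pu)_x=(p\circ\pi)_x\,u_x$. For local diffeomorphisms $\pi:X\to M$, $\xi:Y\to M$ let $\Omega_{\pi,\xi}:C_c^\infty(X)\otimes_R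 C_c^\infty(Y)\to C_c^\infty(X\times_M Y)$ be the linear isomorphism $\Omega(u\otimes v)_{(x,y)}=\mathrm{pr}_1^*(u_x)\,\mathrm{pr}_2^*(v_y)$. **The Hopf algebroid $C_c^\infty(G)$.** Let $G$ be an étale Lie groupoid over $M$: a groupoid with object manifold $M$ and a manifold $G$ of arrows, not necessarily Hausdorff, all of whose structure maps $s$, $t$, $\mathrm{uni}$, $\mathrm{inv}$, $\mathrm{mlt}$ are local diffeomorphisms. On $A=C_c^\infty(G)$ put: the (left) $R$-action along $t$; the comultiplication $\Delta=\Omega_{t,t}^{-1}\circ\mathrm{diag}_+:A\to A\otimes_R A$; the counit $\epsilon=t_+:A\to R$; the product $uv=\mathrm{mlt}_+(\Omega_{s,t}(u\otimes v))$; the inclusion $\mathrm{uni}_+:R\to A$; and the antipode $S=\mathrm{inv}_+$. **Spectral sheaf and spectral groupoid.** For $x\in M$ let $N_x(A)=\{a : fa=0\text{ for some } f\in R\text{ with }f_x=1\}$, $A_x=A/N_x(A)$, and let $a_x\in A_x$ be the class of $a$. An element $a\in A$ is *normalized* at $x$ if $\epsilon(a)_x=1$, and on $W$ if it is so at all points of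 $W$; it is *weakly grouplike* if $\Delta(a)=a\otimes a'$ for some $a'\in A$, and *$S$-invariant weakly grouplike* if some $a'\in A$ satisfies both $\Delta(a)=a\otimes a'$ and $\Delta(S(a))=S(a')\otimes S(a)$. The *spectral sheaf* $\mathcal E_{sp}(A)\to M$ has the stalk $\{\zeta\in A_x : \Delta_x(\zeta)=\zeta\otimes\zeta,\ \epsilon_x(\zeta)=1\}$ at $x$, where $\Delta_x$, $\epsilon_x$ are induced by $\Delta$, $\epsilon$, and the topology with basis the sets $c_W=\{c_x : x\in W\}$, for $W\subset M$ open and $c$ weakly grouplike and normalized on $W$. Let $\mathcal G_{sp}(A)\subset\mathcal E_{sp}(A)$ be the open subsheaf of those elements over $y$ that are of the form $a_y$ with $a$ an $S$-invariant weakly grouplike element normalized at $y$; its smooth structure is the one for which the sheaf projection to $M$ is a local diffeomorphism. It is a groupoid over $M$: if $a$ is $S$-invariant weakly grouplike and normalized on an open set $W$, there is a unique diffeomorphism $\tau_{W,a}:V\to W$ between open subsets of $M$ such that $f\mapsto\epsilon(S(fa))$ maps $C_c^\infty(W)$ onto $C_c^\infty(V)$ and equals $f\mapsto f\circ\tau_{W,a}$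 there; one puts $t(a_y)=y$, $s(a_y)=\tau_{W,a}^{-1}(y)$, $1_y=f_y$ for any $f\in R$ equal to $1$ near $y$, $(a_y)^{-1}=(S(a))_{s(a_y)}$, and $b_z a_y=(ba)_z$ if $s(b_z)=y$. **Theorem.** For every étale Lie groupoid $G$ over $M$ the above formulas determine a unique, well-defined groupoid structure on $\mathcal G_{sp}(C_c^\infty(G))$, which is then an étale Lie groupoid over $M$, and there is an isomorphism of étale Lie groupoids over $M$ (a diffeomorphism which is a functor and the identity on $M$) $$\Phi_G:G\longrightarrow\mathcal G_{sp}(C_c^\infty(G)),\qquad \Phi_G(g)=(f\circ t|_U)_{t(g)},$$ where $U$ is any open subset of $G$ with $g\in U$ on which $t$ is injective (in particular any bisection through $g$), $f\in C_c^\infty(t(U))$ is any function with $f_{t(g)}=1$, and $f\circ t|_U$ is extended by zero. It is natural in $G$: for every morphism $\phi:G\to H$ of étale Lie groupoids over $M$ (a smooth functor which is the identity on $M$), $\Phi_H\circ\phi=\mathcal G_{sp}(\phi_+)\circ\Phi_G$, where $\mathcal G_{sp}(\phi_+)$ maps $a_y$ to $(\phi_+(a))_y$. Moreover $\mathcal G_{sp}(C_c^\infty(G))=\mathcal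 E_{sp}(C_c^\infty(G))$. -/

import Mathlib

open scoped Manifold ContDiff Topology TensorProduct
open Filter Set

universe u v w x

namespace SpectralGroupoid

section Manifolds

variable {B : Type*} [NormedAddCommGroup B] [NormedSpace ℝ B]
variable {X : Type*} [TopologicalSpace X]
variable {Y : Type*} [TopologicalSpace Y] [ChartedSpace B Y]

/-- The smooth structure on `X` pulled back along a local homeomorphism `f : X → Y` into a
manifold: the charts of `X` are the composites of local restrictions of `f` with charts of `Y`. -/
@[reducible] noncomputable def pullbackCharts {f : X → Y} (hf : IsLocalHomeomorph f) :
    ChartedSpace B X where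
  atlas := {e | ∃ x : X, e = (hf.localInverseAt x).symm.trans (chartAt B (f x))}
  chartAt x := (hf.localInverseAt x).symm.trans (chartAt B (f x))
  mem_chart_source x := by
    simp
  chart_mem_atlas x := ⟨x, rfl⟩

theorem pullbackCharts_isManifold [IsManifold 𝓘(ℝ, B) ∞ Y] {f : X → Y}
    (hf : IsLocalHomeomorph f) :
    @IsManifold ℝ _ B _ _ B _ 𝓘(ℝ, B) ∞ X _ (pullbackCharts hf) := by
  let _ := pullbackCharts (B := B) hf
  have : HasGroupoid X (contDiffGroupoid ∞ 𝓘(ℝ, B)) := by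
    constructor
    rintro _ _ ⟨x, rfl⟩ ⟨x', rfl⟩
    have h := (contDiffGroupoid ∞ 𝓘(ℝ, B)).compatible (chart_mem_atlas B (f x))
      (chart_mem_atlas B (f x'))
    set c := chartAt B (f x)
    set c' := chartAt B (f x')
    set φ := (hf.localInverseAt x) with hφ
    set φ' := (hf.localInverseAt x') with hφ'
    have key : ∀ y ∈ φ.source, φ'.symm (φ y) = y := by
      intro y hy
      rw [show (φ'.symm : X → Y) = f from hf.localInverseAt_symm x']
      exact hf.apply_localInverseAt_of_mem hy
    refine (contDiffGroupoid ∞ 𝓘(ℝ, B)).mem_of_eqOnSource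
      (closedUnderRestriction' h ((φ.symm.trans c).symm.trans (φ'.symm.trans c')).open_source) ?_
    have hopen : IsOpen ((φ.symm.trans c).symm.trans (φ'.symm.trans c')).source :=
      OpenPartialHomeomorph.open_source _
    constructor
    · rw [OpenPartialHomeomorph.restr_source' _ _ hopen]
      ext y
      simp only [OpenPartialHomeomorph.trans_source,
        OpenPartialHomeomorph.symm_source, mem_inter_iff, mem_preimage,
        OpenPartialHomeomorph.trans_target, OpenPartialHomeomorph.coe_trans_symm,
        Function.comp_apply,
        OpenPartialHomeomorph.symm_symm, OpenPartialHomeomorph.symm_target]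
      constructor
      · rintro ⟨⟨h1, h2⟩, h3, h4⟩
        refine ⟨⟨h1, ?_⟩, ⟨h1, h2⟩, h3, h4⟩
        rwa [key _ h2] at h4
      · rintro ⟨-, h⟩
        exact h
    · rintro y ⟨⟨h1, h2⟩, -⟩
      simp only [OpenPartialHomeomorph.coe_trans, OpenPartialHomeomorph.coe_trans_symm,
        Function.comp_apply, OpenPartialHomeomorph.restr_apply, OpenPartialHomeomorph.symm_symm]
      rw [key _ h2]
  exact ⟨⟩

theorem pullbackCharts_isLocalDiffeomorph {f : X → Y} (hf : IsLocalHomeomorph f) :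
    @IsLocalDiffeomorph ℝ _ B _ _ B _ _ B _ B _ 𝓘(ℝ, B) 𝓘(ℝ, B) X _ (pullbackCharts hf) Y _ _ ∞
      f := by
  let _ := pullbackCharts (B := B) hf
  have h1 : ContMDiff 𝓘(ℝ, B) 𝓘(ℝ, B) ∞ f := by
    intro x
    rw [contMDiffAt_iff]
    refine ⟨hf.continuous.continuousAt, ?_⟩
    refine ContDiffWithinAt.congr_of_eventuallyEq_of_mem (f := id) contDiffWithinAt_id ?_
      (by simp)
    apply Filter.Eventually.filter_mono nhdsWithin_le_nhds
    have hx : chartAt B x = (hf.localInverseAt x).symm.trans (chartAt B (f x)) := rfl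
    have h2 : ∀ᶠ y in 𝓝 (chartAt B x x), y ∈ (chartAt B x).target :=
      (chartAt B x).open_target.mem_nhds (mem_chart_target B x)
    simp only [extChartAt, mfld_simps]
    filter_upwards [h2] with y hy
    have := (chartAt B x).right_inv hy
    nth_rw 1 [hx] at this
    simpa using this
  have h2 : ∀ x, ContMDiffOn 𝓘(ℝ, B) 𝓘(ℝ, B) ∞ (hf.localInverseAt x)
      (hf.localInverseAt x).source := by
    intro x y hy
    apply ContMDiffAt.contMDiffWithinAt
    rw [contMDiffAt_iff]
    refine ⟨(hf.localInverseAt x).continuousAt hy, ?_⟩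
    have hfy : f (hf.localInverseAt x y) = y := hf.apply_localInverseAt_of_mem hy
    refine ContDiffWithinAt.congr_of_eventuallyEq_of_mem (f := id) contDiffWithinAt_id ?_
      (by simp)
    apply Filter.Eventually.filter_mono nhdsWithin_le_nhds
    have hx : ∀ z, chartAt B (hf.localInverseAt x y) z = chartAt B y (f z) := by
      intro z
      change ((hf.localInverseAt _).symm.trans (chartAt B (f (hf.localInverseAt x y)))) z = _
      rw [hfy]
      simp
    have h3 : ∀ᶠ z in 𝓝 (chartAt B y y), z ∈ (chartAt B y).target :=
      (chartAt B y).open_target.mem_nhds (mem_chart_target B y)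
    have h4 : ∀ᶠ z in 𝓝 (chartAt B y y), (chartAt B y).symm z ∈ (hf.localInverseAt x).source :=
      ((chartAt B y).continuousAt_symm (mem_chart_target B y)).preimage_mem_nhds
        (by simpa using (hf.localInverseAt x).open_source.mem_nhds hy)
    simp only [extChartAt, mfld_simps]
    filter_upwards [h3, h4] with z hz hz'
    rw [hx, hf.apply_localInverseAt_of_mem hz',
      (chartAt B y).right_inv hz]
  intro x
  exact ⟨{ toPartialEquiv := (hf.localInverseAt x).symm.toPartialEquiv
           open_source := (hf.localInverseAt x).open_target
           open_target := (hf.localInverseAt x).open_source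
           contMDiffOn_toFun := by
             refine h1.contMDiffOn.congr fun y _ => ?_
             change (hf.localInverseAt x).symm y = f y
             rw [hf.localInverseAt_symm x]
           contMDiffOn_invFun := h2 x }, hf.self_mem_localInverseAt_target,
    fun y _ => by
      change f y = (hf.localInverseAt x).symm y
      rw [hf.localInverseAt_symm x]⟩

/-- If `g` and `g ∘ φ` are local diffeomorphisms and `φ` is continuous, then `φ` is a local
diffeomorphism. -/
theorem isLocalDiffeomorph_of_comp [ChartedSpace B X] {Z : Type*} [TopologicalSpace Z]
    [ChartedSpace B Z] {φ : X → Y} {g : Y → Z}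
    (hg : IsLocalDiffeomorph 𝓘(ℝ, B) 𝓘(ℝ, B) ∞ g)
    (hgφ : IsLocalDiffeomorph 𝓘(ℝ, B) 𝓘(ℝ, B) ∞ (g ∘ φ)) (hφ : Continuous φ) :
    IsLocalDiffeomorph 𝓘(ℝ, B) 𝓘(ℝ, B) ∞ φ := by
  intro x
  obtain ⟨P, hP, hPe⟩ := hgφ x
  obtain ⟨Q, hQ, hQe⟩ := hg (φ x)
  let e := (P.trans Q.symm).toOpenPartialHomeomorph.restrOpen (φ ⁻¹' Q.source)
    (Q.open_source.preimage hφ)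
  have hesub : e.source ⊆ (P.trans Q.symm).source := fun y hy => hy.1
  have hetsub : e.target ⊆ (P.trans Q.symm).target := fun y hy => hy.1
  have key : EqOn φ e e.source := by
    intro y hy
    have h1 : y ∈ P.source := hy.1.1
    have h2 : φ y ∈ Q.source := hy.2
    change φ y = Q.invFun (P.toFun y)
    have h3 : P.toFun y = Q.toFun (φ y) := by
      rw [← hQe h2]; exact (hPe h1).symm
    rw [h3]
    exact (Q.left_inv' h2).symm
  refine ⟨{ toPartialEquiv := e.toPartialEquiv
            open_source := e.open_source
            open_target := e.open_target
            contMDiffOn_toFun := (P.trans Q.symm).contMDiffOn_toFun.mono hesub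
            contMDiffOn_invFun := (P.trans Q.symm).contMDiffOn_invFun.mono hetsub }, ?_, key⟩
  refine ⟨⟨hP, ?_⟩, hQ⟩
  change P.toFun x ∈ Q.target
  have h3 : P.toFun x = Q.toFun (φ x) := by
    rw [← hQe hQ]; exact (hPe hP).symm
  rw [h3]
  exact Q.map_source' hQ

end Manifolds

section Functions

variable (𝕜 : Type*) [RCLike 𝕜]
variable (B : Type*) [NormedAddCommGroup B] [NormedSpace ℝ B]

instance : ContMDiffMul 𝓘(ℝ, 𝕜) ∞ 𝕜 :=
  { instNormedSpaceLieAddGroup with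
    contMDiff_mul := by
      rw [contMDiff_iff]
      refine ⟨continuous_mul, fun x y => ?_⟩
      simp only [mfld_simps, chartAt_self_eq]
      rw [contDiffOn_univ]
      exact contDiff_mul }

/-- The algebra `C_c^∞(M)` of smooth functions with compact support on a Hausdorff manifold `M`. -/
noncomputable def BaseAlg (M : Type*) [TopologicalSpace M] [ChartedSpace B M] :
    NonUnitalSubalgebra 𝕜 (M → 𝕜) where
  carrier := {f | ContMDiff 𝓘(ℝ, B) 𝓘(ℝ, 𝕜) ∞ f ∧ HasCompactSupport f}
  add_mem' hf hg := ⟨hf.1.add hg.1, hf.2.add hg.2⟩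
  zero_mem' := ⟨contMDiff_const, HasCompactSupport.zero⟩
  mul_mem' hf hg := ⟨hf.1.mul hg.1, hf.2.mul_right⟩
  smul_mem' c _ hf := ⟨contMDiff_const.mul hf.1, hf.2.smul_left (f := fun _ => c)⟩

variable {X : Type*} [TopologicalSpace X] [ChartedSpace B X]

/-- `f` restricts to a smooth function with compact support on `U` (for `U` open and Hausdorff).
The values of `f` outside `U` are irrelevant. -/
def IsCcOn (U : Set X) (f : X → 𝕜) : Prop :=
  ContMDiffOn 𝓘(ℝ, B) 𝓘(ℝ, 𝕜) ∞ f U ∧ ∃ K ⊆ U, IsCompact K ∧ ∀ x ∈ U, x ∉ K → f x = 0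

variable {𝕜} in
open Classical in
/-- The extension by zero of `f|_U` to a (not necessarily continuous) section of the sheaf of
germs of functions on `X`. -/
noncomputable def extZero (U : Set X) (f : X → 𝕜) : ∀ y : X, Germ (𝓝 y) 𝕜 :=
  fun y => if y ∈ U then (f : Germ (𝓝 y) 𝕜) else 0

variable (X) in
/-- The space `C_c^∞(X)` of smooth functions with compact support on a manifold `X` which need not
be Hausdorff: the linear span, among the not necessarily continuous sections of the sheaf of
germs, of the extensions by zero of smooth functions with compact support on Hausdorff open
subsets. -/
noncomputable def Cc : Submodule 𝕜 (∀ y : X, Germ (𝓝 y) 𝕜) :=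
  Submodule.span 𝕜 {s | ∃ (U : Set X) (f : X → 𝕜), IsOpen U ∧ T2Space U ∧ IsCcOn 𝕜 B U f ∧
    s = extZero U f}

variable {𝕜 B}

theorem extZero_mem {U : Set X} {f : X → 𝕜} (hU : IsOpen U) (hT : T2Space U)
    (hf : IsCcOn 𝕜 B U f) : extZero U f ∈ Cc 𝕜 B X :=
  Submodule.subset_span ⟨U, f, hU, hT, hf, rfl⟩

theorem extZero_congr {U : Set X} {f g : X → 𝕜} (hU : IsOpen U) (h : EqOn f g U) :
    extZero U f = extZero U g := by
  funext y
  by_cases hy : y ∈ U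
  · simp only [extZero, hy, if_true]
    exact Germ.coe_eq.2 (h.eventuallyEq_of_mem (hU.mem_nhds hy))
  · simp only [extZero, hy, if_false]

theorem extZero_add (U : Set X) (f g : X → 𝕜) :
    extZero U (f + g) = extZero U f + extZero U g := by
  funext y
  by_cases hy : y ∈ U <;> simp [extZero, hy]

/-- Shrinking the Hausdorff open subset on which a function with compact support is considered. -/
theorem extZero_shrink {U V : Set X} {f : X → 𝕜} (hU : IsOpen U) (hT : T2Space U) (hVU : V ⊆ U)
    {K : Set X} (hK : IsCompact K) (hKV : K ⊆ V) (hf : ∀ x ∈ U, x ∉ K → f x = 0) :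
    extZero U f = extZero V f := by
  funext y
  by_cases hyV : y ∈ V
  · simp [extZero, hyV, hVU hyV]
  by_cases hyU : y ∈ U
  · simp only [extZero, hyV, hyU, if_true, if_false]
    have hcl : IsClosed (((↑) : U → X) ⁻¹' K) := by
      refine IsCompact.isClosed ?_
      exact (Topology.IsEmbedding.subtypeVal.isCompact_preimage_iff
        (by rw [Subtype.range_coe]; exact hKV.trans hVU)).2 hK
    have hop : IsOpen (U \ K) := by
      have := hU.isOpenMap_subtype_val _ hcl.isOpen_compl
      rwa [← preimage_compl, Subtype.image_preimage_coe] at this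
    refine Germ.coe_eq.2 ?_
    filter_upwards [hop.mem_nhds ⟨hyU, fun h => hyV (hKV h)⟩] with x hx
    exact hf x hx.1 hx.2
  · simp [extZero, hyV, hyU]

theorem exists_bump [FiniteDimensional ℝ B] [IsManifold 𝓘(ℝ, B) ∞ X] {U : Set X} (hU : IsOpen U)
    (hT : T2Space U) {x : X} (hx : x ∈ U) {N : Set X} (hN : N ∈ 𝓝 x) :
    ∃ θ : X → 𝕜, ContMDiffOn 𝓘(ℝ, B) 𝓘(ℝ, 𝕜) ∞ θ U ∧ (∀ᶠ y in 𝓝 x, θ y = 1) ∧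
      ∃ K ⊆ N ∩ U, IsCompact K ∧ ∀ y ∈ U, y ∉ K → θ y = 0 := by
  let V : TopologicalSpace.Opens X := ⟨U, hU⟩
  have : T2Space V := hT
  let x' : V := ⟨x, hx⟩
  have hN' : ((↑) : V → X) ⁻¹' N ∈ 𝓝 x' := continuous_subtype_val.continuousAt.preimage_mem_nhds hN
  obtain ⟨b, -, hb⟩ := (SmoothBumpFunction.nhds_basis_tsupport (I := 𝓘(ℝ, B)) x').mem_iff.1 hN'
  classical
  let θ : X → 𝕜 := fun y => if h : y ∈ U then ((b ⟨y, h⟩ : ℝ) : 𝕜) else 0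
  have hθ : ∀ y : V, θ y = ((b y : ℝ) : 𝕜) := fun y => by
    have : (y : X) ∈ U := y.2
    simp [θ, this]
  refine ⟨θ, ?_, ?_, ((↑) : V → X) '' tsupport b, ?_, ?_, ?_⟩
  · intro y hy
    apply ContMDiffAt.contMDiffWithinAt
    have : ContMDiffAt 𝓘(ℝ, B) 𝓘(ℝ, 𝕜) ∞ (fun z : V => θ z) (⟨y, hy⟩ : V) := by
      simp_rw [hθ]
      exact (RCLike.ofRealCLM (K := 𝕜)).contDiff.contMDiff.contMDiffAt.comp _ b.contMDiffAt
    exact contMDiffAt_subtype_iff.1 this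
  · have h1 : ∀ᶠ y in 𝓝 x', b y = 1 := b.eventuallyEq_one
    have h2 : map ((↑) : V → X) (𝓝 x') = 𝓝 x := hU.isOpenEmbedding_subtypeVal.map_nhds_eq x'
    rw [← h2, eventually_map]
    filter_upwards [h1] with y hy
    simp [hθ, hy]
  · rintro _ ⟨y, hy, rfl⟩
    exact ⟨hb hy, y.2⟩
  · exact IsCompact.image b.hasCompactSupport continuous_subtype_val
  · intro y hy hyK
    have : θ y = ((b ⟨y, hy⟩ : ℝ) : 𝕜) := hθ ⟨y, hy⟩
    have h0 : b ⟨y, hy⟩ = 0 := image_eq_zero_of_notMem_tsupport fun h => hyK ⟨_, h, rfl⟩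
    rw [this, h0, RCLike.ofReal_zero]

/-- A partition of unity argument: `C_c^∞(X)` is spanned by functions with compact support in
arbitrarily small open subsets. -/
theorem Cc_le [FiniteDimensional ℝ B] [IsManifold 𝓘(ℝ, B) ∞ X] (P : Set X → Prop)
    (hP : ∀ x : X, ∃ V, IsOpen V ∧ x ∈ V ∧ ∀ V' ⊆ V, P V')
    (S : Submodule 𝕜 (∀ y : X, Germ (𝓝 y) 𝕜))
    (hS : ∀ (V : Set X) (f : X → 𝕜), IsOpen V → T2Space V → P V → IsCcOn 𝕜 B V f →
      extZero V f ∈ S) : Cc 𝕜 B X ≤ S := by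
  refine Submodule.span_le.2 ?_
  rintro _ ⟨U, f, hU, hT, ⟨hf, K, hKU, hK, hfK⟩, rfl⟩
  have key : ∃ θ : X → 𝕜, ContMDiffOn 𝓘(ℝ, B) 𝓘(ℝ, 𝕜) ∞ θ U ∧ (∀ y ∈ K, θ y = 1) ∧
      ∀ g : X → 𝕜, IsCcOn 𝕜 B U g → extZero U (θ * g) ∈ S := by
    refine hK.induction_on
      (p := fun T => ∃ θ : X → 𝕜, ContMDiffOn 𝓘(ℝ, B) 𝓘(ℝ, 𝕜) ∞ θ U ∧ (∀ y ∈ T, θ y = 1) ∧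
        ∀ g : X → 𝕜, IsCcOn 𝕜 B U g → extZero U (θ * g) ∈ S) ?_ ?_ ?_ ?_
    · refine ⟨0, contMDiffOn_const, by simp, fun g _ => ?_⟩
      have : extZero U ((0 : X → 𝕜) * g) = 0 := by
        funext y; by_cases hy : y ∈ U <;> simp [extZero, hy]
      rw [this]; exact S.zero_mem
    · rintro s t hst ⟨θ, h1, h2, h3⟩
      exact ⟨θ, h1, fun y hy => h2 y (hst hy), h3⟩
    · rintro s t ⟨θ, h1, h2, h3⟩ ⟨η, k1, k2, k3⟩
      refine ⟨θ + (η - η * θ), h1.add (k1.sub (k1.mul h1)), ?_, ?_⟩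
      · rintro y (hy | hy)
        · simp [h2 y hy]
        · simp [k2 y hy]
      · intro g hg
        have : (θ + (η - η * θ)) * g = θ * g + η * (g - θ * g) := by ring
        rw [this, extZero_add]
        refine S.add_mem (h3 g hg) (k3 _ ?_)
        obtain ⟨hg1, L, hL, hL', hgL⟩ := hg
        refine ⟨hg1.sub (h1.mul hg1), L, hL, hL', fun x hx hxL => ?_⟩
        simp [hgL x hx hxL]
    · intro x hx
      obtain ⟨V, hV, hxV, hPV⟩ := hP x
      obtain ⟨θ, h1, h2, L, hL, hL', hθL⟩ :=
        exists_bump (𝕜 := 𝕜) (B := B) hU hT (hKU hx) (hV.mem_nhds hxV)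
      refine ⟨{y | θ y = 1}, mem_nhdsWithin_of_mem_nhds h2, θ, h1, fun y hy => hy, ?_⟩
      intro g hg
      have hz : ∀ y ∈ U, y ∉ L → (θ * g) y = 0 := fun y hy hyL => by simp [hθL y hy hyL]
      rw [extZero_shrink (V := V ∩ U) hU hT inter_subset_right hL' hL hz]
      refine hS _ _ (hV.inter hU) ?_ (hPV _ inter_subset_left) ⟨?_, L, hL, hL', ?_⟩
      · exact (Topology.IsEmbedding.inclusion (inter_subset_right : V ∩ U ⊆ U)).t2Space
      · exact (h1.mul hg.1).mono inter_subset_right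
      · exact fun y hy => hz y hy.2
  obtain ⟨θ, h1, h2, h3⟩ := key
  have : extZero U f = extZero U (θ * f) := by
    refine extZero_congr hU fun y hy => ?_
    by_cases hyK : y ∈ K
    · simp [h2 y hyK]
    · simp [hfK y hy hyK]
  rw [this]
  exact h3 f ⟨hf, K, hKU, hK, hfK⟩

end Functions

section Push

variable {𝕜 : Type*} [RCLike 𝕜]
variable {B : Type*} [NormedAddCommGroup B] [NormedSpace ℝ B]
variable {X : Type*} [TopologicalSpace X] {Y : Type*} [TopologicalSpace Y]

theorem tendsto_localInverseAt {φ : X → Y} (hφ : IsLocalHomeomorph φ) {y : X} {z : Y}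
    (h : φ y = z) : Tendsto (hφ.localInverseAt y) (𝓝 z) (𝓝 y) := by
  subst h
  have := (hφ.localInverseAt y).continuousAt hφ.apply_self_mem_localInverseAt_source
  rwa [ContinuousAt, hφ.localInverseAt_apply_self] at this

/-- The pull-back `φ_y^*` of germs along a map continuous at `y`. -/
def germPull (φ : X → Y) {y : X} (hφ : ContinuousAt φ y) (γ : Germ (𝓝 (φ y)) 𝕜) :
    Germ (𝓝 y) 𝕜 :=
  γ.compTendsto φ hφ

/-- The push-forward `φ_{*y}` of germs along a local homeomorphism `φ` with `φ y = z`, that is,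
composition with a local inverse of `φ`; it is the inverse of `φ_y^*`. -/
noncomputable def germPush {φ : X → Y} (hφ : IsLocalHomeomorph φ) {y : X} {z : Y} (h : φ y = z)
    (γ : Germ (𝓝 y) 𝕜) : Germ (𝓝 z) 𝕜 :=
  γ.compTendsto (hφ.localInverseAt y) (tendsto_localInverseAt hφ h)

section
variable {φ : X → Y} (hφ : IsLocalHomeomorph φ) {y : X} {z : Y} (h : φ y = z)

theorem germPush_coe (f : X → 𝕜) :
    germPush hφ h (f : Germ (𝓝 y) 𝕜) = ((f ∘ hφ.localInverseAt y : Y → 𝕜) : Germ (𝓝 z) 𝕜) := rfl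

theorem germPush_zero : germPush hφ h (0 : Germ (𝓝 y) 𝕜) = 0 := rfl

theorem germPush_add (γ δ : Germ (𝓝 y) 𝕜) :
    germPush hφ h (γ + δ) = germPush hφ h γ + germPush hφ h δ := by
  induction γ using Germ.inductionOn with | _ f
  induction δ using Germ.inductionOn with | _ g
  rfl

theorem germPush_mul (γ δ : Germ (𝓝 y) 𝕜) :
    germPush hφ h (γ * δ) = germPush hφ h γ * germPush hφ h δ := by
  induction γ using Germ.inductionOn with | _ f
  induction δ using Germ.inductionOn with | _ g
  rfl

theorem germPush_smul (c : 𝕜) (γ : Germ (𝓝 y) 𝕜) :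
    germPush hφ h (c • γ) = c • germPush hφ h γ := by
  induction γ using Germ.inductionOn with | _ f
  rfl

theorem germPush_comp (g : Y → 𝕜) :
    germPush hφ h ((g ∘ φ : X → 𝕜) : Germ (𝓝 y) 𝕜) = (g : Germ (𝓝 z) 𝕜) := by
  subst h
  rw [germPush_coe]
  refine Germ.coe_eq.2 ?_
  filter_upwards [(hφ.localInverseAt y).open_source.mem_nhds
    hφ.apply_self_mem_localInverseAt_source] with w hw
  simp [hφ.apply_localInverseAt_of_mem hw]

theorem germPush_germPull (γ : Germ (𝓝 (φ y)) 𝕜) :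
    germPush hφ rfl (germPull φ hφ.continuous.continuousAt γ) = γ := by
  induction γ using Germ.inductionOn with | _ f
  exact germPush_comp hφ rfl f

end

theorem germPull_add {φ : X → Y} {y : X} (hφ : ContinuousAt φ y) (γ δ : Germ (𝓝 (φ y)) 𝕜) :
    germPull φ hφ (γ + δ) = germPull φ hφ γ + germPull φ hφ δ := by
  induction γ using Germ.inductionOn with | _ f
  induction δ using Germ.inductionOn with | _ g
  rfl

theorem germPull_smul {φ : X → Y} {y : X} (hφ : ContinuousAt φ y) (c : 𝕜)
    (γ : Germ (𝓝 (φ y)) 𝕜) : germPull φ hφ (c • γ) = c • germPull φ hφ γ := by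
  induction γ using Germ.inductionOn with | _ f
  rfl

theorem germPull_mul {φ : X → Y} {y : X} (hφ : ContinuousAt φ y) (γ δ : Germ (𝓝 (φ y)) 𝕜) :
    germPull φ hφ (γ * δ) = germPull φ hφ γ * germPull φ hφ δ := by
  induction γ using Germ.inductionOn with | _ f
  induction δ using Germ.inductionOn with | _ g
  rfl

/-- The section `φ_+(u)` of germs, `φ_+(u)_z = ∑_{y ∈ φ⁻¹(z)} φ_{*y}(u_y)`. -/
noncomputable def pushSection {φ : X → Y} (hφ : IsLocalHomeomorph φ)
    (u : ∀ y : X, Germ (𝓝 y) 𝕜) : ∀ z : Y, Germ (𝓝 z) 𝕜 :=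
  fun z => ∑ᶠ y : {y : X // φ y = z}, germPush hφ y.2 (u y)

variable [ChartedSpace B X] [ChartedSpace B Y]

theorem exists_injOn {φ : X → Y} (hφ : IsLocalHomeomorph φ) (x : X) :
    ∃ V, IsOpen V ∧ x ∈ V ∧ ∀ V' ⊆ V, InjOn φ V' :=
  ⟨_, (hφ.localInverseAt x).open_target, hφ.self_mem_localInverseAt_target,
    fun _ h => hφ.injOn_localInverseAt_target.mono h⟩

theorem finite_support [FiniteDimensional ℝ B] [IsManifold 𝓘(ℝ, B) ∞ X] {φ : X → Y}
    (hφ : IsLocalHomeomorph φ) {u : ∀ y : X, Germ (𝓝 y) 𝕜} (hu : u ∈ Cc 𝕜 B X) (z : Y) :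
    {y : X | φ y = z ∧ u y ≠ 0}.Finite := by
  let S : Submodule 𝕜 (∀ y : X, Germ (𝓝 y) 𝕜) :=
    { carrier := {u | {y : X | φ y = z ∧ u y ≠ 0}.Finite}
      add_mem' := by
        intro a b ha hb
        refine (ha.union hb).subset ?_
        rintro y ⟨h1, h2⟩
        by_contra h
        simp only [mem_union, mem_ofPred_eq, not_or, not_and, not_not] at h
        exact h2 (by rw [Pi.add_apply, h.1 h1, h.2 h1, add_zero])
      zero_mem' := by simp
      smul_mem' := by
        intro c a ha
        refine ha.subset ?_
        rintro y ⟨h1, h2⟩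
        exact ⟨h1, fun h => h2 (by rw [Pi.smul_apply, h, smul_zero])⟩ }
  refine Cc_le (fun V => InjOn φ V) (exists_injOn hφ) S ?_ hu
  intro V f _ _ hV _
  refine Set.Subsingleton.finite ?_
  rintro a ⟨ha, ha'⟩ b ⟨hb, hb'⟩
  have hh : ∀ y, extZero V f y ≠ 0 → y ∈ V := fun y hy => by
    by_contra h
    exact hy (by simp [extZero, h])
  exact hV (hh a ha') (hh b hb') (ha.trans hb.symm)

theorem hasFiniteSupport [FiniteDimensional ℝ B] [IsManifold 𝓘(ℝ, B) ∞ X] {φ : X → Y}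
    (hφ : IsLocalHomeomorph φ) {u : ∀ y : X, Germ (𝓝 y) 𝕜} (hu : u ∈ Cc 𝕜 B X) (z : Y) :
    Function.HasFiniteSupport
      (fun y : {y : X // φ y = z} => germPush hφ y.2 (u y)) := by
  have h : ((↑) ⁻¹' {y : X | φ y = z ∧ u y ≠ 0} : Set {y : X // φ y = z}).Finite :=
    (finite_support hφ hu z).preimage Subtype.val_injective.injOn
  refine h.subset ?_
  intro y hy
  refine ⟨y.2, fun h0 => hy ?_⟩
  simp only [h0, germPush_zero]

theorem pushSection_extZero {φ : X → Y} (hφ : IsLocalHomeomorph φ) {V : Set X} (hV : IsOpen V)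
    (hinj : InjOn φ V) (f : X → 𝕜) (σ : Y → X) (hσ : ∀ y ∈ V, σ (φ y) = y) :
    pushSection hφ (extZero V f) = extZero (φ '' V) (f ∘ σ) := by
  funext z
  by_cases hz : z ∈ φ '' V
  · obtain ⟨y, hy, rfl⟩ := hz
    rw [pushSection, finsum_eq_single _ (⟨y, rfl⟩ : {y' : X // φ y' = φ y})]
    · have : φ y ∈ φ '' V := ⟨y, hy, rfl⟩
      simp only [extZero, hy, this, if_true]
      rw [germPush_coe]
      refine Germ.coe_eq.2 ?_
      have h1 : ∀ᶠ w in 𝓝 (φ y), hφ.localInverseAt y w ∈ V :=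
        (tendsto_localInverseAt hφ rfl).eventually (hV.mem_nhds hy)
      filter_upwards [h1, (hφ.localInverseAt y).open_source.mem_nhds
        hφ.apply_self_mem_localInverseAt_source] with w hw hw'
      have h2 := hσ _ hw
      rw [hφ.apply_localInverseAt_of_mem hw'] at h2
      simp [h2]
    · rintro ⟨y', hy'⟩ hne
      have : y' ∉ V := fun h => hne (Subtype.ext (hinj h hy hy'))
      simp only [extZero, this, if_false, germPush_zero]
  · have : ∀ y : {y : X // φ y = z}, germPush hφ y.2 (extZero V f y) = 0 := by
      rintro ⟨y, hy⟩
      have : y ∉ V := fun h => hz ⟨y, h, hy⟩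
      simp only [extZero, this, if_false, germPush_zero]
    simp only [pushSection, this, finsum_zero]
    simp only [extZero, hz, if_false]

theorem contMDiffAt_leftInv {φ : X → Y} (hφ : IsLocalDiffeomorph 𝓘(ℝ, B) 𝓘(ℝ, B) ∞ φ)
    {V : Set X} (hV : IsOpen V) {σ : Y → X} (hσ : ∀ y ∈ V, σ (φ y) = y) {y : X} (hy : y ∈ V) :
    ContMDiffAt 𝓘(ℝ, B) 𝓘(ℝ, B) ∞ σ (φ y) := by
  obtain ⟨P, hP, hPe⟩ := hφ y
  have hyt : φ y ∈ P.target := by rw [hPe hP]; exact P.map_source' hP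
  have h1 : ContMDiffAt 𝓘(ℝ, B) 𝓘(ℝ, B) ∞ P.invFun (φ y) :=
    P.contMDiffOn_invFun.contMDiffAt (P.open_target.mem_nhds hyt)
  refine h1.congr_of_eventuallyEq ?_
  have hy' : P.invFun (φ y) = y := by rw [hPe hP]; exact P.left_inv' hP
  have h2 : ∀ᶠ w in 𝓝 (φ y), P.invFun w ∈ V :=
    h1.continuousAt.preimage_mem_nhds (by rw [hy']; exact hV.mem_nhds hy)
  filter_upwards [h2, P.open_target.mem_nhds hyt] with w hw hw'
  have h3 := hσ _ hw
  rw [hPe (P.map_target' hw')] at h3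
  have h4 : P.toFun (P.invFun w) = w := P.right_inv' hw'
  rw [← h3]
  change σ w = σ (P.toFun (P.invFun w))
  rw [h4]

theorem pushSection_mem [FiniteDimensional ℝ B] [IsManifold 𝓘(ℝ, B) ∞ X] {φ : X → Y}
    (hφ : IsLocalDiffeomorph 𝓘(ℝ, B) 𝓘(ℝ, B) ∞ φ) {u : ∀ y : X, Germ (𝓝 y) 𝕜}
    (hu : u ∈ Cc 𝕜 B X) : pushSection hφ.isLocalHomeomorph u ∈ Cc 𝕜 B Y := by
  have hl := hφ.isLocalHomeomorph
  let S : Submodule 𝕜 (∀ y : X, Germ (𝓝 y) 𝕜) :=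
    { carrier := {u | u ∈ Cc 𝕜 B X ∧ pushSection hl u ∈ Cc 𝕜 B Y}
      add_mem' := by
        rintro a b ⟨ha, ha'⟩ ⟨hb, hb'⟩
        refine ⟨add_mem ha hb, ?_⟩
        convert add_mem ha' hb' using 1
        funext z
        simp only [pushSection, Pi.add_apply, germPush_add]
        exact finsum_add_distrib (hasFiniteSupport hl ha z) (hasFiniteSupport hl hb z)
      zero_mem' := by
        refine ⟨zero_mem _, ?_⟩
        convert zero_mem (Cc 𝕜 B Y) using 1
        funext z
        simp [pushSection, germPush_zero]
      smul_mem' := by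
        rintro c a ⟨ha, ha'⟩
        refine ⟨Submodule.smul_mem _ c ha, ?_⟩
        convert Submodule.smul_mem _ c ha' using 1
        funext z
        simp only [pushSection, Pi.smul_apply, germPush_smul]
        exact (smul_finsum' c (hasFiniteSupport hl ha z)).symm }
  refine (Cc_le (fun V => InjOn φ V) (exists_injOn hl) S ?_ hu).2
  intro V f hV hT hinj hf
  refine ⟨extZero_mem hV hT hf, ?_⟩
  change pushSection hl (extZero V f) ∈ Cc 𝕜 B Y
  obtain hE | ⟨⟨x0⟩⟩ := isEmpty_or_nonempty X
  · convert zero_mem (Cc 𝕜 B Y) using 1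
    funext z
    have : IsEmpty {y : X // φ y = z} := ⟨fun y => hE.elim y.1⟩
    rw [pushSection, finsum_of_isEmpty]
    rfl
  have : Nonempty X := ⟨x0⟩
  have hσ : ∀ y ∈ V, Function.invFunOn φ V (φ y) = y := fun y hy => hinj.leftInvOn_invFunOn hy
  rw [pushSection_extZero hl hV hinj f _ hσ]
  obtain ⟨hf1, K, hK, hK', hfK⟩ := hf
  have hc : ∀ y ∈ V, ContMDiffAt 𝓘(ℝ, B) 𝓘(ℝ, B) ∞ (Function.invFunOn φ V) (φ y) :=
    fun y hy => contMDiffAt_leftInv hφ hV hσ hy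
  refine extZero_mem (hl.isOpenMap _ hV) ?_ ⟨?_, φ '' K, image_mono hK,
    hK'.image hl.continuous, ?_⟩
  · have hm : MapsTo (Function.invFunOn φ V) (φ '' V) V := by
      rintro _ ⟨y, hy, rfl⟩; rw [hσ y hy]; exact hy
    refine T2Space.of_injective_continuous (f := hm.restrict) ?_ ?_
    · rintro ⟨_, y, hy, rfl⟩ ⟨_, y', hy', rfl⟩ h
      have : Function.invFunOn φ V (φ y) = Function.invFunOn φ V (φ y') := congrArg Subtype.val h
      rw [hσ y hy, hσ y' hy'] at this
      subst this; rfl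
    · refine ContinuousOn.mapsToRestrict ?_ hm
      rintro _ ⟨y, hy, rfl⟩
      exact (hc y hy).continuousAt.continuousWithinAt
  · rintro _ ⟨y, hy, rfl⟩
    apply ContMDiffAt.contMDiffWithinAt
    refine ContMDiffAt.comp (φ y) ?_ (hc y hy)
    rw [hσ y hy]
    exact hf1.contMDiffAt (hV.mem_nhds hy)
  · rintro _ ⟨y, hy, rfl⟩ hyK
    rw [Function.comp_apply, hσ y hy]
    exact hfK y hy fun h => hyK ⟨y, h, rfl⟩

/-- The linear map `φ_+ : C_c^∞(X) → C_c^∞(Y)` induced by a local diffeomorphism `φ : X → Y`. -/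
noncomputable def pushforward [FiniteDimensional ℝ B] [IsManifold 𝓘(ℝ, B) ∞ X] {φ : X → Y}
    (hφ : IsLocalDiffeomorph 𝓘(ℝ, B) 𝓘(ℝ, B) ∞ φ) : Cc 𝕜 B X →ₗ[𝕜] Cc 𝕜 B Y where
  toFun u := ⟨pushSection hφ.isLocalHomeomorph u.1, pushSection_mem hφ u.2⟩
  map_add' u v := by
    refine Subtype.ext (funext fun z => ?_)
    simp only [pushSection, Submodule.coe_add, Pi.add_apply, germPush_add]
    exact finsum_add_distrib (hasFiniteSupport _ u.2 z) (hasFiniteSupport _ v.2 z)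
  map_smul' c u := by
    refine Subtype.ext (funext fun z => ?_)
    simp only [pushSection, Submodule.coe_smul, Pi.smul_apply, germPush_smul, RingHom.id_apply]
    exact (smul_finsum' c (hasFiniteSupport _ u.2 z)).symm

end Push

section Fibre

variable {𝕜 : Type*} [RCLike 𝕜]
variable {B : Type*} [NormedAddCommGroup B] [NormedSpace ℝ B]
variable {X Y M : Type*} [TopologicalSpace X] [TopologicalSpace Y] [TopologicalSpace M]
  [ChartedSpace B X] [ChartedSpace B Y] [ChartedSpace B M]

/-- The fibred product `X ×_M Y` of two local diffeomorphisms `f : X → M` and `g : Y → M`. -/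
@[ext] structure FibreProd {f : X → M} {g : Y → M}
    (hf : IsLocalDiffeomorph 𝓘(ℝ, B) 𝓘(ℝ, B) ∞ f)
    (hg : IsLocalDiffeomorph 𝓘(ℝ, B) 𝓘(ℝ, B) ∞ g) where
  /-- The first projection. -/
  fst : X
  /-- The second projection. -/
  snd : Y
  comm : f fst = g snd

theorem germ_smul_mul {α : Type*} {l : Filter α} (c : 𝕜) (γ δ : Germ l 𝕜) :
    (c • γ) * δ = c • (γ * δ) := by
  induction γ using Germ.inductionOn with | _ a
  induction δ using Germ.inductionOn with | _ b
  change (((c • a) * b : α → 𝕜) : Germ l 𝕜) = ((c • (a * b) : α → 𝕜) : Germ l 𝕜)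
  rw [smul_mul_assoc]

theorem germ_mul_smul {α : Type*} {l : Filter α} (c : 𝕜) (γ δ : Germ l 𝕜) :
    γ * (c • δ) = c • (γ * δ) := by
  rw [mul_comm, germ_smul_mul, mul_comm]

namespace FibreProd

variable {f : X → M} {g : Y → M} {hf : IsLocalDiffeomorph 𝓘(ℝ, B) 𝓘(ℝ, B) ∞ f}
  {hg : IsLocalDiffeomorph 𝓘(ℝ, B) 𝓘(ℝ, B) ∞ g}

/-- The underlying pair. -/
def toProd (p : FibreProd hf hg) : X × Y := (p.fst, p.snd)

/-- The topology of a subspace of `X × Y`. -/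
instance : TopologicalSpace (FibreProd hf hg) := TopologicalSpace.induced toProd inferInstance

theorem isInducing_toProd : Topology.IsInducing (toProd : FibreProd hf hg → X × Y) := ⟨rfl⟩

theorem injective_toProd : Function.Injective (toProd : FibreProd hf hg → X × Y) :=
  fun _ _ h => FibreProd.ext (congrArg Prod.fst h) (congrArg Prod.snd h)

theorem continuous_fst : Continuous (fst : FibreProd hf hg → X) :=
  _root_.continuous_fst.comp isInducing_toProd.continuous

theorem continuous_snd : Continuous (snd : FibreProd hf hg → Y) :=
  _root_.continuous_snd.comp isInducing_toProd.continuous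

theorem range_toProd :
    range (toProd : FibreProd hf hg → X × Y) = {q : X × Y | f q.1 = g q.2} := by
  ext q
  exact ⟨fun ⟨p, hp⟩ => hp ▸ p.comm, fun h => ⟨⟨q.1, q.2, h⟩, rfl⟩⟩

theorem isLocalHomeomorph_fst : IsLocalHomeomorph (fst : FibreProd hf hg → X) := by
  refine IsLocalHomeomorph.mk _ fun p => ?_
  have hl := hg.isLocalHomeomorph
  let e := hl.localInverseAt p.snd
  let W : Set X := f ⁻¹' e.source
  have hfc : Continuous f := hf.isLocalHomeomorph.continuous
  have hW : IsOpen W := e.open_source.preimage hfc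
  have hse : ∀ y, e.symm y = g y := fun y => congrFun (hl.localInverseAt_symm p.snd) y
  have hcomm : ∀ x ∈ W, f x = g (e (f x)) := fun x hx => (hl.apply_localInverseAt_of_mem hx).symm
  classical
  refine ⟨{ toFun := fst
            invFun := fun x => if hx : x ∈ W then ⟨x, e (f x), hcomm x hx⟩ else p
            source := snd ⁻¹' e.target
            target := W
            map_source' := ?_
            map_target' := ?_
            left_inv' := ?_
            right_inv' := ?_
            open_source := e.open_target.preimage continuous_snd
            open_target := hW
            continuousOn_toFun := continuous_fst.continuousOn
            continuousOn_invFun := ?_ }, ?_, fun _ _ => rfl⟩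
  · intro q hq
    change f q.fst ∈ e.source
    rw [q.comm, ← hse]
    exact e.map_target hq
  · intro x hx
    simp only [hx, dif_pos]
    exact e.map_source hx
  · intro q hq
    have hq' : fst q ∈ W := by
      change f q.fst ∈ e.source
      rw [q.comm, ← hse]
      exact e.map_target hq
    simp only [hq', dif_pos]
    refine FibreProd.ext rfl ?_
    change e (f q.fst) = q.snd
    rw [q.comm, ← hse]
    exact e.right_inv hq
  · intro x hx
    simp only [hx, dif_pos]
  · rw [isInducing_toProd.continuousOn_iff]
    have : ContinuousOn (fun x => (x, e (f x))) W :=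
      continuousOn_id.prodMk (e.continuousOn.comp hfc.continuousOn fun x hx => hx)
    refine this.congr fun x hx => ?_
    simp only [Function.comp_apply, hx, dif_pos]
    rfl
  · exact hl.self_mem_localInverseAt_target

/-- The smooth structure of the fibred product, for which the projections are local
diffeomorphisms. -/
noncomputable instance : ChartedSpace B (FibreProd hf hg) := pullbackCharts isLocalHomeomorph_fst

instance [IsManifold 𝓘(ℝ, B) ∞ X] : IsManifold 𝓘(ℝ, B) ∞ (FibreProd hf hg) :=
  pullbackCharts_isManifold _

theorem isLocalDiffeomorph_fst :
    IsLocalDiffeomorph 𝓘(ℝ, B) 𝓘(ℝ, B) ∞ (fst : FibreProd hf hg → X) :=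
  pullbackCharts_isLocalDiffeomorph _

theorem isLocalDiffeomorph_snd :
    IsLocalDiffeomorph 𝓘(ℝ, B) 𝓘(ℝ, B) ∞ (snd : FibreProd hf hg → Y) := by
  refine isLocalDiffeomorph_of_comp hg ?_ continuous_snd
  have : g ∘ (snd : FibreProd hf hg → Y) = f ∘ fst := funext fun p => p.comm.symm
  rw [this]
  exact fun p => (isLocalDiffeomorph_fst p).comp 𝓘(ℝ, B) M (hf _)

/-- The diagonal map `X → X ×_M X`. -/
def diag (hf : IsLocalDiffeomorph 𝓘(ℝ, B) 𝓘(ℝ, B) ∞ f) (x : X) : FibreProd hf hf := ⟨x, x, rfl⟩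

theorem isLocalDiffeomorph_diag (hf : IsLocalDiffeomorph 𝓘(ℝ, B) 𝓘(ℝ, B) ∞ f) :
    IsLocalDiffeomorph 𝓘(ℝ, B) 𝓘(ℝ, B) ∞ (diag hf) := by
  refine isLocalDiffeomorph_of_comp (isLocalDiffeomorph_fst (hf := hf) (hg := hf)) ?_ ?_
  · exact (Diffeomorph.refl 𝓘(ℝ, B) X ∞).isLocalDiffeomorph
  · exact isInducing_toProd.continuous_iff.2 (continuous_id.prodMk continuous_id)

end FibreProd

variable {f : X → M} {g : Y → M} (hf : IsLocalDiffeomorph 𝓘(ℝ, B) 𝓘(ℝ, B) ∞ f)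
  (hg : IsLocalDiffeomorph 𝓘(ℝ, B) 𝓘(ℝ, B) ∞ g)

/-- The section `Ω(u ⊗ v)_{(x,y)} = (pr₁)^*(u_x) (pr₂)^*(v_y)` over `X ×_M Y`. -/
noncomputable def omegaSection (u : ∀ x : X, Germ (𝓝 x) 𝕜) (v : ∀ y : Y, Germ (𝓝 y) 𝕜) :
    ∀ p : FibreProd hf hg, Germ (𝓝 p) 𝕜 :=
  fun p => germPull FibreProd.fst FibreProd.continuous_fst.continuousAt (u p.fst) *
    germPull FibreProd.snd FibreProd.continuous_snd.continuousAt (v p.snd)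

theorem omegaSection_mem [T2Space M] {u : ∀ x : X, Germ (𝓝 x) 𝕜} (hu : u ∈ Cc 𝕜 B X)
    {v : ∀ y : Y, Germ (𝓝 y) 𝕜} (hv : v ∈ Cc 𝕜 B Y) :
    omegaSection hf hg u v ∈ Cc 𝕜 B (FibreProd hf hg) := by
  induction hu, hv using Submodule.span_induction₂ with
  | mem_mem u v hu hv =>
    obtain ⟨U, a, hU, hTU, ⟨ha, K, hK, hK', haK⟩, rfl⟩ := hu
    obtain ⟨V, b, hV, hTV, ⟨hb, L, hL, hL', hbL⟩, rfl⟩ := hv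
    have hW : IsOpen (FibreProd.fst ⁻¹' U ∩ FibreProd.snd ⁻¹' V : Set (FibreProd hf hg)) :=
      (hU.preimage FibreProd.continuous_fst).inter (hV.preimage FibreProd.continuous_snd)
    have : omegaSection hf hg (extZero U a) (extZero V b) =
        extZero (FibreProd.fst ⁻¹' U ∩ FibreProd.snd ⁻¹' V)
          ((a ∘ FibreProd.fst) * (b ∘ FibreProd.snd)) := by
      funext p
      by_cases h1 : p.fst ∈ U
      · by_cases h2 : p.snd ∈ V
        · simp only [omegaSection, extZero, mem_inter_iff, mem_preimage, h1, h2, and_self, if_true]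
          rfl
        · simp only [omegaSection, extZero, mem_inter_iff, mem_preimage, h1, h2, and_false,
            if_true, if_false]
          exact mul_zero _
      · simp only [omegaSection, extZero, mem_inter_iff, mem_preimage, h1, false_and, if_false]
        exact zero_mul _
    rw [this]
    refine extZero_mem hW ?_ ⟨?_, FibreProd.fst ⁻¹' K ∩ FibreProd.snd ⁻¹' L, ?_, ?_, ?_⟩
    · refine T2Space.of_injective_continuous (Y := U × V)
        (f := fun p => (⟨p.1.fst, p.2.1⟩, ⟨p.1.snd, p.2.2⟩)) ?_ ?_
      · intro p q h
        simp only [Prod.mk.injEq, Subtype.mk.injEq] at h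
        exact Subtype.ext (FibreProd.ext h.1 h.2)
      · exact ((FibreProd.continuous_fst.comp continuous_subtype_val).subtype_mk _).prodMk
          ((FibreProd.continuous_snd.comp continuous_subtype_val).subtype_mk _)
    · refine ContMDiffOn.mul ?_ ?_
      · exact ha.comp FibreProd.isLocalDiffeomorph_fst.contMDiff.contMDiffOn fun p hp => hp.1
      · exact hb.comp FibreProd.isLocalDiffeomorph_snd.contMDiff.contMDiffOn fun p hp => hp.2
    · exact fun p hp => ⟨hK hp.1, hL hp.2⟩
    · have hi : Topology.IsClosedEmbedding (FibreProd.toProd : FibreProd hf hg → X × Y) :=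
        ⟨⟨FibreProd.isInducing_toProd, FibreProd.injective_toProd⟩, by
          rw [FibreProd.range_toProd]
          exact isClosed_eq (hf.isLocalHomeomorph.continuous.comp _root_.continuous_fst)
            (hg.isLocalHomeomorph.continuous.comp _root_.continuous_snd)⟩
      exact hi.isCompact_preimage (hK'.prod hL')
    · rintro p ⟨h1, h2⟩ hp
      by_cases hpK : p.fst ∈ K
      · have : p.snd ∉ L := fun h => hp ⟨hpK, h⟩
        simp [hbL _ h2 this]
      · simp [haK _ h1 hpK]
  | zero_left v hv =>
    convert zero_mem (Cc 𝕜 B (FibreProd hf hg)) using 1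
    funext p
    exact zero_mul _
  | zero_right u hu =>
    convert zero_mem (Cc 𝕜 B (FibreProd hf hg)) using 1
    funext p
    exact mul_zero _
  | add_left a b c _ _ _ h1 h2 =>
    convert add_mem h1 h2 using 1
    funext p
    simp only [omegaSection, Pi.add_apply, germPull_add, add_mul]
  | add_right a b c _ _ _ h1 h2 =>
    convert add_mem h1 h2 using 1
    funext p
    simp only [omegaSection, Pi.add_apply, germPull_add, mul_add]
  | smul_left r a b _ _ h =>
    convert Submodule.smul_mem _ r h using 1
    funext p
    simp only [omegaSection, Pi.smul_apply, germPull_smul, germ_smul_mul]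
  | smul_right r a b _ _ h =>
    convert Submodule.smul_mem _ r h using 1
    funext p
    simp only [omegaSection, Pi.smul_apply, germPull_smul, germ_mul_smul]

/-- The bilinear map `(u, v) ↦ Ω(u ⊗ v)` from `C_c^∞(X) × C_c^∞(Y)` to `C_c^∞(X ×_M Y)`. -/
noncomputable def omega [T2Space M] : Cc 𝕜 B X →ₗ[𝕜] Cc 𝕜 B Y →ₗ[𝕜] Cc 𝕜 B (FibreProd hf hg) :=
  LinearMap.mk₂ 𝕜 (fun u v => ⟨omegaSection hf hg u.1 v.1, omegaSection_mem hf hg u.2 v.2⟩)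
    (fun a b c => Subtype.ext <| funext fun p => by
      simp only [omegaSection, Submodule.coe_add, Pi.add_apply, germPull_add, add_mul])
    (fun r a b => Subtype.ext <| funext fun p => by
      simp only [omegaSection, Submodule.coe_smul, Pi.smul_apply, germPull_smul, germ_smul_mul])
    (fun a b c => Subtype.ext <| funext fun p => by
      simp only [omegaSection, Submodule.coe_add, Pi.add_apply, germPull_add, mul_add])
    (fun r a b => Subtype.ext <| funext fun p => by
      simp only [omegaSection, Submodule.coe_smul, Pi.smul_apply, germPull_smul, germ_mul_smul])

/-- `C_c^∞(X)` is closed under multiplication by functions pulled back from `M`. -/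
theorem smul_section_mem (hf : IsLocalDiffeomorph 𝓘(ℝ, B) 𝓘(ℝ, B) ∞ f) {p : M → 𝕜} (hp : p ∈ BaseAlg 𝕜 B M) {u : ∀ x : X, Germ (𝓝 x) 𝕜}
    (hu : u ∈ Cc 𝕜 B X) :
    (fun x => ((p ∘ f : X → 𝕜) : Germ (𝓝 x) 𝕜) * u x) ∈ Cc 𝕜 B X := by
  induction hu using Submodule.span_induction with
  | mem u hu =>
    obtain ⟨U, a, hU, hTU, ⟨ha, K, hK, hK', haK⟩, rfl⟩ := hu
    have : (fun x => ((p ∘ f : X → 𝕜) : Germ (𝓝 x) 𝕜) * extZero U a x) =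
        extZero U ((p ∘ f) * a) := by
      funext x
      by_cases h : x ∈ U
      · simp [extZero, h]
      · simp [extZero, h]
    rw [this]
    exact extZero_mem hU hTU ⟨(hp.1.comp hf.contMDiff).contMDiffOn.mul ha, K, hK, hK',
      fun x hx hxK => by simp [haK x hx hxK]⟩
  | zero =>
    convert zero_mem (Cc 𝕜 B X) using 1
    funext x
    exact mul_zero _
  | add a b _ _ h1 h2 =>
    convert add_mem h1 h2 using 1
    funext x
    exact mul_add _ _ _
  | smul r a _ h =>
    convert Submodule.smul_mem _ r h using 1
    funext x
    exact germ_mul_smul _ _ _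

/-- The action of `C_c^∞(M)` on `C_c^∞(X)` for a sheaf `f : X → M`, `(pu)_x = f_x^*(p_{f x}) u_x`,
as a homomorphism of algebras from `C_c^∞(M)` to the linear endomorphisms of `C_c^∞(X)`. -/
noncomputable def sheafAct : BaseAlg 𝕜 B M →ₙₐ[𝕜] Module.End 𝕜 (Cc 𝕜 B X) where
  toFun p :=
    { toFun := fun u => ⟨fun x => ((p.1 ∘ f : X → 𝕜) : Germ (𝓝 x) 𝕜) * u.1 x,
        smul_section_mem hf p.2 u.2⟩
      map_add' := fun u v => Subtype.ext <| funext fun x => mul_add _ _ _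
      map_smul' := fun r u => Subtype.ext <| funext fun x => germ_mul_smul _ _ _ }
  map_smul' r p := LinearMap.ext fun u => Subtype.ext <| funext fun x => by
    change (((r • p.1) ∘ f : X → 𝕜) : Germ (𝓝 x) 𝕜) * u.1 x = r • (_ * u.1 x)
    rw [← germ_smul_mul]
    rfl
  map_zero' := LinearMap.ext fun u => Subtype.ext <| funext fun x => by
    change (0 : Germ (𝓝 x) 𝕜) * u.1 x = 0
    rw [zero_mul]
  map_add' p q := LinearMap.ext fun u => Subtype.ext <| funext fun x => by
    change (((p.1 ∘ f : X → 𝕜) : Germ (𝓝 x) 𝕜) + ((q.1 ∘ f : X → 𝕜) : Germ (𝓝 x) 𝕜)) * u.1 x = _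
    rw [add_mul]
    rfl
  map_mul' p q := LinearMap.ext fun u => Subtype.ext <| funext fun x => by
    change (((p.1 ∘ f : X → 𝕜) : Germ (𝓝 x) 𝕜) * ((q.1 ∘ f : X → 𝕜) : Germ (𝓝 x) 𝕜)) * u.1 x = _
    rw [mul_assoc]
    rfl

/-- On a Hausdorff manifold an element of `C_c^∞(M)` is the same thing as a smooth function with
compact support: the function is recovered from the values of the germs. -/
theorem value_mem [T2Space M] {u : ∀ x : M, Germ (𝓝 x) 𝕜} (hu : u ∈ Cc 𝕜 B M) :
    (fun x => (u x).value) ∈ BaseAlg 𝕜 B M := by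
  induction hu using Submodule.span_induction with
  | mem u hu =>
    obtain ⟨U, a, hU, hTU, ⟨ha, K, hK, hK', haK⟩, rfl⟩ := hu
    have h0 : ∀ x, x ∉ K → (extZero U a x).value = 0 := by
      intro x hx
      by_cases h : x ∈ U
      · simp only [extZero, h, if_true]; exact haK x h hx
      · simp only [extZero, h, if_false]; rfl
    refine ⟨fun x => ?_, HasCompactSupport.intro hK' h0⟩
    by_cases h : x ∈ U
    · refine (ha.contMDiffAt (hU.mem_nhds h)).congr_of_eventuallyEq ?_
      filter_upwards [hU.mem_nhds h] with y hy
      simp only [extZero, hy, if_true]; rfl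
    · refine (contMDiffAt_const (c := (0 : 𝕜))).congr_of_eventuallyEq ?_
      filter_upwards [hK'.isClosed.isOpen_compl.mem_nhds (fun hx => h (hK hx))] with y hy
      exact h0 y hy
  | zero => exact zero_mem (BaseAlg 𝕜 B M)
  | add a b _ _ h1 h2 =>
    convert add_mem h1 h2 using 1
    funext x
    exact Germ.valueAddHom.map_add _ _
  | smul r a _ h =>
    convert SMulMemClass.smul_mem r h using 1
    funext x
    exact (Germ.valueₗ (𝕜 := 𝕜)).map_smul r (a x)

/-- The identification of `C_c^∞(M)`, as a space of sections of germs, with the algebra of smooth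
functions with compact support on the Hausdorff manifold `M`. -/
noncomputable def toBase [T2Space M] : Cc 𝕜 B M →ₗ[𝕜] BaseAlg 𝕜 B M where
  toFun u := ⟨fun x => (u.1 x).value, value_mem u.2⟩
  map_add' u v := Subtype.ext <| funext fun x => Germ.valueAddHom.map_add _ _
  map_smul' r u := Subtype.ext <| funext fun x => (Germ.valueₗ (𝕜 := 𝕜)).map_smul r (u.1 x)

/-- The inverse identification: a function is sent to the section of its germs. -/
noncomputable def ofBase [T2Space M] : BaseAlg 𝕜 B M →ₗ[𝕜] Cc 𝕜 B M where
  toFun p := ⟨extZero univ p.1, extZero_mem isOpen_univ inferInstance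
    ⟨p.2.1.contMDiffOn, tsupport p.1, subset_univ _, p.2.2, fun _ _ h =>
      image_eq_zero_of_notMem_tsupport h⟩⟩
  map_add' p q := Subtype.ext (extZero_add univ p.1 q.1)
  map_smul' r p := Subtype.ext <| funext fun x => by simp [extZero]

theorem toBase_ofBase [T2Space M] (p : BaseAlg 𝕜 B M) : toBase (ofBase p) = p := by
  refine Subtype.ext (funext fun x => ?_)
  simp [toBase, ofBase, extZero]

/-- The element `p ∘ f|_U` of `C_c^∞(X)`, for an `f`-elementary open subset `U` of `X` and
`p ∈ C_c^∞(f(U))`. -/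
theorem lift_mem [T2Space M] (hf : IsLocalDiffeomorph 𝓘(ℝ, B) 𝓘(ℝ, B) ∞ f) {U : Set X} (hU : IsOpen U) (hinj : InjOn f U) (p : BaseAlg 𝕜 B M)
    (hp : tsupport p.1 ⊆ f '' U) : extZero U (p.1 ∘ f) ∈ Cc 𝕜 B X := by
  have hl := hf.isLocalHomeomorph
  refine extZero_mem hU ?_ ⟨(p.2.1.comp hf.contMDiff).contMDiffOn, U ∩ f ⁻¹' tsupport p.1,
    inter_subset_left, ?_, ?_⟩
  · exact T2Space.of_injective_continuous (f := fun x : U => f x) (injOn_iff_injective.1 hinj)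
      (hl.continuous.comp continuous_subtype_val)
  · have hoe : Topology.IsOpenEmbedding (fun x : U => f x) :=
      Topology.IsOpenEmbedding.of_continuous_injective_isOpenMap
        (hl.continuous.comp continuous_subtype_val) (injOn_iff_injective.1 hinj)
        (hl.isOpenMap.comp hU.isOpenMap_subtype_val)
    have hr : range (fun x : U => f x) = f '' U := by
      rw [image_eq_range]
    have h1 : IsCompact ((fun x : U => f x) ⁻¹' tsupport p.1) :=
      (hoe.isInducing.isCompact_preimage_iff (by rwa [hr])).2 p.2.2
    have h2 := h1.image continuous_subtype_val
    convert h2 using 1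
    ext x
    simp [and_comm]
  · intro x hx hxK
    have : f x ∉ tsupport p.1 := fun h => hxK ⟨hx, h⟩
    have h0 : p.1 (f x) = 0 := image_eq_zero_of_notMem_tsupport this
    exact h0

end Fibre

section Tensor

variable {𝕜 : Type*} [RCLike 𝕜] {R : Type*}
variable {C D : Type*} [AddCommGroup C] [Module 𝕜 C] [AddCommGroup D] [Module 𝕜 D]

/-- The subspace spanned by `r c ⊗ d - c ⊗ r d`, for actions `a`, `b` of `R` on `C`, `D`. -/
def tensorRel (a : R → Module.End 𝕜 C) (b : R → Module.End 𝕜 D) : Submodule 𝕜 (C ⊗[𝕜] D) :=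
  Submodule.span 𝕜 {w | ∃ r c d, w = a r c ⊗ₜ[𝕜] d - c ⊗ₜ[𝕜] b r d}

/-- The tensor product `C ⊗_R D` with respect to actions `a`, `b` of `R` on `C`, `D`, as a quotient
of `C ⊗ D`. -/
abbrev TensorOver (a : R → Module.End 𝕜 C) (b : R → Module.End 𝕜 D) :=
  (C ⊗[𝕜] D) ⧸ tensorRel a b

/-- The element `c ⊗ d` of `C ⊗_R D`. -/
def TensorOver.tmul (a : R → Module.End 𝕜 C) (b : R → Module.End 𝕜 D) (c : C) (d : D) :
    TensorOver a b :=
  (tensorRel a b).mkQ (c ⊗ₜ[𝕜] d)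

/-- The linear map on `C ⊗_R D` induced by a balanced bilinear map. -/
def TensorOver.lift {E : Type*} [AddCommGroup E] [Module 𝕜 E] (a : R → Module.End 𝕜 C)
    (b : R → Module.End 𝕜 D) (β : C →ₗ[𝕜] D →ₗ[𝕜] E)
    (hβ : ∀ r c d, β (a r c) d = β c (b r d)) : TensorOver a b →ₗ[𝕜] E :=
  (tensorRel a b).liftQ (TensorProduct.lift β) <| by
    refine Submodule.span_le.2 ?_
    rintro _ ⟨r, c, d, rfl⟩
    simp [hβ]

end Tensor

section Omega

variable {𝕜 : Type*} [RCLike 𝕜]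
variable {B : Type*} [NormedAddCommGroup B] [NormedSpace ℝ B]
variable {X Y M : Type*} [TopologicalSpace X] [TopologicalSpace Y] [TopologicalSpace M]
  [ChartedSpace B X] [ChartedSpace B Y] [ChartedSpace B M] [T2Space M]
variable {f : X → M} {g : Y → M} (hf : IsLocalDiffeomorph 𝓘(ℝ, B) 𝓘(ℝ, B) ∞ f)
  (hg : IsLocalDiffeomorph 𝓘(ℝ, B) 𝓘(ℝ, B) ∞ g)

theorem omega_balanced (p : BaseAlg 𝕜 B M) (u : Cc 𝕜 B X) (v : Cc 𝕜 B Y) :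
    omega hf hg (sheafAct hf p u) v = omega hf hg u (sheafAct hg p v) := by
  refine Subtype.ext (funext fun q => ?_)
  change germPull _ _ (((p.1 ∘ f : X → 𝕜) : Germ (𝓝 q.fst) 𝕜) * u.1 q.fst) *
    germPull _ _ (v.1 q.snd) = germPull _ _ (u.1 q.fst) *
      germPull _ _ (((p.1 ∘ g : Y → 𝕜) : Germ (𝓝 q.snd) 𝕜) * v.1 q.snd)
  rw [germPull_mul, germPull_mul]
  have h : germPull FibreProd.fst FibreProd.continuous_fst.continuousAt
      ((p.1 ∘ f : X → 𝕜) : Germ (𝓝 q.fst) 𝕜) =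
      germPull FibreProd.snd FibreProd.continuous_snd.continuousAt
        ((p.1 ∘ g : Y → 𝕜) : Germ (𝓝 q.snd) 𝕜) := by
    have h0 : (p.1 ∘ f) ∘ (FibreProd.fst : FibreProd hf hg → X) = (p.1 ∘ g) ∘ FibreProd.snd :=
      funext fun q => congrArg p.1 q.comm
    exact congrArg (fun k : FibreProd hf hg → 𝕜 => (k : Germ (𝓝 q) 𝕜)) h0
  rw [h]
  ring

/-- The linear map `Ω : C_c^∞(X) ⊗_{C_c^∞(M)} C_c^∞(Y) → C_c^∞(X ×_M Y)`; it is a bijection. -/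
noncomputable def omegaBar :
    TensorOver (sheafAct (𝕜 := 𝕜) hf) (sheafAct (𝕜 := 𝕜) hg) →ₗ[𝕜] Cc 𝕜 B (FibreProd hf hg) :=
  TensorOver.lift _ _ (omega hf hg) (omega_balanced hf hg)

/-- `φ_+` is a homomorphism of `C_c^∞(M)`-modules, for a map `φ` over `M`. -/
theorem pushforward_sheafAct [FiniteDimensional ℝ B] [IsManifold 𝓘(ℝ, B) ∞ X] {φ : X → Y}
    (hφ : IsLocalDiffeomorph 𝓘(ℝ, B) 𝓘(ℝ, B) ∞ φ) (h : ∀ x, g (φ x) = f x) (p : BaseAlg 𝕜 B M)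
    (u : Cc 𝕜 B X) :
    pushforward hφ (sheafAct hf p u) = sheafAct hg p (pushforward hφ u) := by
  refine Subtype.ext (funext fun z => ?_)
  change ∑ᶠ y : {y : X // φ y = z}, germPush hφ.isLocalHomeomorph y.2
      (((p.1 ∘ f : X → 𝕜) : Germ (𝓝 y.1) 𝕜) * u.1 y.1) =
    ((p.1 ∘ g : Y → 𝕜) : Germ (𝓝 z) 𝕜) *
      ∑ᶠ y : {y : X // φ y = z}, germPush hφ.isLocalHomeomorph y.2 (u.1 y.1)
  refine Eq.trans (finsum_congr fun y => ?_) (mul_finsum' _ _ (hasFiniteSupport _ u.2 z)).symm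
  have h0 : p.1 ∘ f = (p.1 ∘ g) ∘ φ := funext fun x => (congrArg p.1 (h x)).symm
  rw [germPush_mul, h0, germPush_comp]

end Omega

section Spectral

variable (𝕜 : Type*) [RCLike 𝕜]
variable (B : Type*) [NormedAddCommGroup B] [NormedSpace ℝ B]
variable (M : Type*) [TopologicalSpace M] [ChartedSpace B M]

/-- The operations of a coalgebra `C` over `R = C_c^∞(M)`: the action of `R`, the comultiplication
and the counit. -/
structure CoalgebraOps (C : Type*) [AddCommGroup C] [Module 𝕜 C] where
  act : BaseAlg 𝕜 B M →ₙₐ[𝕜] Module.End 𝕜 C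
  comul : C → TensorOver act act
  counit : C → BaseAlg 𝕜 B M

/-- The operations of a Hopf algebroid `A` over `R = C_c^∞(M)`: the coalgebra operations, with
respect to the left action of `R`, the inclusion of `R` into `A`, the product and the antipode. -/
structure HopfAlgebroidOps (A : Type*) [AddCommGroup A] [Module 𝕜 A] extends
    CoalgebraOps 𝕜 B M A where
  incl : BaseAlg 𝕜 B M → A
  mul : A → A → A
  antipode : A → A

variable {𝕜 B M}
variable [FiniteDimensional ℝ B] [IsManifold 𝓘(ℝ, B) ∞ M] [T2Space M]

theorem exists_baseAlg_eq_one (x : M) : ∃ f : BaseAlg 𝕜 B M, ∀ᶠ y in 𝓝 x, f.1 y = 1 := by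
  obtain ⟨θ, h1, h2, K, -, hK, hθ⟩ := exists_bump (𝕜 := 𝕜) (B := B) (isOpen_univ (X := M))
    inferInstance (mem_univ x) univ_mem
  exact ⟨⟨θ, contMDiffOn_univ.1 h1, HasCompactSupport.intro hK fun y hy => hθ y (mem_univ y) hy⟩,
    h2⟩

section Stalk

variable {C D : Type*} [AddCommGroup C] [Module 𝕜 C] [AddCommGroup D] [Module 𝕜 D]
variable (act : BaseAlg 𝕜 B M →ₙₐ[𝕜] Module.End 𝕜 C)
variable (act' : BaseAlg 𝕜 B M →ₙₐ[𝕜] Module.End 𝕜 D)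

theorem act_comm (p q : BaseAlg 𝕜 B M) (c : C) : act p (act q c) = act q (act p c) := by
  rw [← Module.End.mul_apply, ← Module.End.mul_apply, ← map_mul, ← map_mul,
    show p * q = q * p from Subtype.ext (mul_comm _ _)]

/-- `N_x(C)`: the elements `c` with `f c = 0` for some `f` with germ `1` at `x`. -/
noncomputable def stalkKer (x : M) : Submodule 𝕜 C where
  carrier := {c | ∃ f : BaseAlg 𝕜 B M, (∀ᶠ y in 𝓝 x, f.1 y = 1) ∧ act f c = 0}
  add_mem' := by
    rintro c d ⟨f, hf, hc⟩ ⟨g, hg, hd⟩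
    refine ⟨f * g, ?_, ?_⟩
    · filter_upwards [hf, hg] with y h1 h2
      change f.1 y * g.1 y = 1
      rw [h1, h2, one_mul]
    · rw [map_mul, Module.End.mul_apply, map_add, map_add, hd, map_zero, add_zero, act_comm, hc,
        map_zero]
  zero_mem' := by
    obtain ⟨f, hf⟩ := exists_baseAlg_eq_one (𝕜 := 𝕜) (B := B) x
    exact ⟨f, hf, map_zero _⟩
  smul_mem' := by
    rintro r c ⟨f, hf, hc⟩
    exact ⟨f, hf, by rw [map_smul, hc, smul_zero]⟩

/-- The localization `C_x = C / N_x(C)` of the module `C` at `x`. -/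
abbrev Stalk (x : M) := C ⧸ stalkKer act x

/-- The class `c_x` of `c` in `C_x`. -/
noncomputable def toStalk (x : M) : C →ₗ[𝕜] Stalk act x := (stalkKer act x).mkQ

variable {act act'} in
/-- The linear map `α_x : C_x → D_x` induced by a homomorphism `α : C → D` of modules. -/
noncomputable def stalkMap (α : C →ₗ[𝕜] D) (hα : ∀ p c, α (act p c) = act' p (α c)) (x : M) :
    Stalk act x →ₗ[𝕜] Stalk act' x :=
  (stalkKer act x).mapQ (stalkKer act' x) α <| by
    rintro c ⟨f, hf, hc⟩
    exact ⟨f, hf, by rw [← hα, hc, map_zero]⟩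

/-- The action of `R` on `C_x`. -/
noncomputable def stalkAct (x : M) (p : BaseAlg 𝕜 B M) : Module.End 𝕜 (Stalk act x) :=
  stalkMap (act p) (fun q c => act_comm act p q c) x

/-- The projection `C ⊗_R C → C_x ⊗_R C_x`. The latter is `C_x ⊗_{R_x} C_x`, because the action of
`R` on `C_x` factors through the quotient `R_x` of `R`. -/
noncomputable def tensorToStalk (x : M) :
    TensorOver act act →ₗ[𝕜] TensorOver (stalkAct act x) (stalkAct act x) :=
  (tensorRel act act).mapQ (tensorRel (stalkAct act x) (stalkAct act x))
    (TensorProduct.map (toStalk act x) (toStalk act x)) <| by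
      refine Submodule.span_le.2 ?_
      rintro _ ⟨p, c, d, rfl⟩
      exact Submodule.subset_span ⟨p, toStalk act x c, toStalk act x d, by simp; rfl⟩

end Stalk

section Coalgebra

variable {C : Type*} [AddCommGroup C] [Module 𝕜 C] (𝒞 : CoalgebraOps 𝕜 B M C)

/-- `c` is normalized at `x`: the germ of `ε(c)` at `x` is `1`. -/
def NormalizedAt (c : C) (x : M) : Prop := ∀ᶠ y in 𝓝 x, (𝒞.counit c).1 y = 1

/-- The weakly grouplike elements: `Δ(c) = c ⊗ c'` for some `c'`. -/
def weaklyGrouplike : Set C :=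
  {c | ∃ c' : C, 𝒞.comul c = TensorOver.tmul 𝒞.act 𝒞.act c c'}

/-- The set `G(C_x)` of the grouplike elements `ζ` of `C_x`, `Δ_x(ζ) = ζ ⊗ ζ` and `ε_x(ζ) = 1`.
The values of the induced maps `Δ_x` and `ε_x` are computed on a representative of `ζ`. -/
def grouplike (x : M) : Set (Stalk 𝒞.act x) :=
  {ζ | ∃ c : C, toStalk 𝒞.act x c = ζ ∧
    tensorToStalk 𝒞.act x (𝒞.comul c) = TensorOver.tmul _ _ ζ ζ ∧ NormalizedAt 𝒞 c x}

/-- The class `c_x` as a point of the disjoint union of all `C_x`. -/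
noncomputable def classAt (c : C) (x : M) : Σ x : M, Stalk 𝒞.act x := ⟨x, toStalk 𝒞.act x c⟩

/-- The spectral sheaf `E_sp(C)`, with stalks `G(C_x)`. -/
def Esp := {p : Σ x : M, Stalk 𝒞.act x // p.2 ∈ grouplike 𝒞 p.1}

/-- The set `c_W` of all `c_x` with `x ∈ W`. -/
def basicSet (c : C) (W : Set M) : Set (Esp 𝒞) := {p | ∃ x ∈ W, p.1 = classAt 𝒞 c x}

/-- The topology of the spectral sheaf, with basis the sets `c_W` where `W` is open and `c` is
weakly grouplike and normalized on `W`. -/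
instance : TopologicalSpace (Esp 𝒞) :=
  TopologicalSpace.generateFrom {s | ∃ (c : C) (W : Set M), c ∈ weaklyGrouplike 𝒞 ∧ IsOpen W ∧
    (∀ x ∈ W, NormalizedAt 𝒞 c x) ∧ s = basicSet 𝒞 c W}

/-- The projection `π_sp(C) : E_sp(C) → M`. -/
def Esp.proj (p : Esp 𝒞) : M := p.1.1

end Coalgebra

/-- The structure maps of a groupoid over `M`, with set of arrows `X`. The product `g h` of arrows
is defined if the source of `g` is the target of `h`. -/
structure GroupoidOps (M X : Type*) where
  src : X → M
  tgt : X → M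
  unit : M → X
  inv : X → X
  mul : ∀ g h : X, src g = tgt h → X

section Hopf

variable {A : Type*} [AddCommGroup A] [Module 𝕜 A] (𝒜 : HopfAlgebroidOps 𝕜 B M A)

/-- The `S`-invariant weakly grouplike elements: there is `a'` with `Δ(a) = a ⊗ a'` and
`Δ(S(a)) = S(a') ⊗ S(a)`. -/
def invariantWeaklyGrouplike : Set A :=
  {a | ∃ a' : A, 𝒜.comul a = TensorOver.tmul 𝒜.act 𝒜.act a a' ∧
    𝒜.comul (𝒜.antipode a) = TensorOver.tmul 𝒜.act 𝒜.act (𝒜.antipode a') (𝒜.antipode a)}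

/-- The set of arrows of `A`, as a subset of the spectral sheaf `E_sp(A)`. -/
def arrows : Set (Esp 𝒜.toCoalgebraOps) :=
  {p | ∃ a ∈ invariantWeaklyGrouplike 𝒜, NormalizedAt 𝒜.toCoalgebraOps a p.1.1 ∧
    p.1 = classAt 𝒜.toCoalgebraOps a p.1.1}

/-- The spectral étale groupoid `G_sp(A)` with the topology of a subspace of `E_sp(A)`. -/
abbrev Gsp : Type _ := ↥(arrows 𝒜)

/-- The projection `G_sp(A) → M`. -/
def Gsp.proj (ζ : Gsp 𝒜) : M := ζ.1.proj

/-- The map `T_a : R → R`, `T_a(f) = ε(S(f a))`. -/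
noncomputable def opT (a : A) (f : BaseAlg 𝕜 B M) : BaseAlg 𝕜 B M := 𝒜.counit (𝒜.antipode (𝒜.act f a))

/-- `τ` is the diffeomorphism `τ_{W,a} : V → W` between open subsets of `M` determined by
`T_a(C_c^∞(W)) = C_c^∞(V)` and `T_a(f) = f ∘ τ` for `f ∈ C_c^∞(W)`. -/
structure IsTau (a : A) (W : Set M) (τ : OpenPartialHomeomorph M M) : Prop where
  target_eq : τ.target = W
  smooth : ContMDiffOn 𝓘(ℝ, B) 𝓘(ℝ, B) ∞ τ τ.source
  smooth_symm : ContMDiffOn 𝓘(ℝ, B) 𝓘(ℝ, B) ∞ τ.symm τ.target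
  image_eq : opT 𝒜 a '' {f | tsupport f.1 ⊆ W} = {f | tsupport f.1 ⊆ τ.source}
  apply_eq : ∀ f : BaseAlg 𝕜 B M, tsupport f.1 ⊆ W → ∀ x ∈ τ.source, (opT 𝒜 a f).1 x = f.1 (τ x)

/-- `Γ` is the groupoid structure of the spectral étale groupoid `G_sp(A)` of `A`. The formulas
hold for all representatives of the arrows involved. -/
structure IsSpectralGroupoid (Γ : GroupoidOps M (Gsp 𝒜)) : Prop where
  /-- `t(a_y) = y` -/
  tgt_eq : ∀ ζ, Γ.tgt ζ = ζ.proj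
  /-- `s(a_y) = τ_{W,a}⁻¹(y)` for `a` normalized on the open subset `W` and `y ∈ W` -/
  src_eq : ∀ a ∈ invariantWeaklyGrouplike 𝒜, ∀ W : Set M, IsOpen W →
    (∀ y ∈ W, NormalizedAt 𝒜.toCoalgebraOps a y) →
    (∃ τ, IsTau 𝒜 a W τ) ∧ ∀ τ, IsTau 𝒜 a W τ → ∀ (ζ : Gsp 𝒜), ∀ y ∈ W,
      ζ.1.1 = classAt 𝒜.toCoalgebraOps a y → Γ.src ζ = τ.symm y
  /-- `1_y = f_y` for `f` equal to `1` on a neighbourhood of `y` -/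
  unit_eq : ∀ (y : M) (f : BaseAlg 𝕜 B M), (∀ᶠ z in 𝓝 y, f.1 z = 1) →
    (Γ.unit y).1.1 = classAt 𝒜.toCoalgebraOps (𝒜.incl f) y
  /-- `(a_y)⁻¹ = (S(a))_x` where `x` is the source of `a_y` -/
  inv_eq : ∀ (ζ : Gsp 𝒜), ∀ a ∈ invariantWeaklyGrouplike 𝒜, ∀ y : M,
    NormalizedAt 𝒜.toCoalgebraOps a y → ζ.1.1 = classAt 𝒜.toCoalgebraOps a y →
    (Γ.inv ζ).1.1 = classAt 𝒜.toCoalgebraOps (𝒜.antipode a) (Γ.src ζ)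
  /-- `b_z a_y = (b a)_z` if `y` is the source of `b_z` -/
  mul_eq : ∀ (ζ ξ : Gsp 𝒜) (h : Γ.src ζ = Γ.tgt ξ), ∀ b ∈ invariantWeaklyGrouplike 𝒜, ∀ z : M,
    NormalizedAt 𝒜.toCoalgebraOps b z → ζ.1.1 = classAt 𝒜.toCoalgebraOps b z →
    ∀ a ∈ invariantWeaklyGrouplike 𝒜, ∀ y : M,
    NormalizedAt 𝒜.toCoalgebraOps a y → ξ.1.1 = classAt 𝒜.toCoalgebraOps a y →
    (Γ.mul ζ ξ h).1.1 = classAt 𝒜.toCoalgebraOps (𝒜.mul b a) z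

end Hopf

end Spectral

section Groupoids

variable (B : Type*) [NormedAddCommGroup B] [NormedSpace ℝ B]
variable {M : Type*} [TopologicalSpace M] [ChartedSpace B M]
variable {X : Type*} [TopologicalSpace X] [ChartedSpace B X]
variable {Y : Type*} [TopologicalSpace Y] [ChartedSpace B Y]

/-- `X`, a manifold which need not be Hausdorff, is an étale Lie groupoid over `M`: the groupoid
axioms hold and all structure maps are local diffeomorphisms. -/
structure IsEtaleLieGroupoid (Γ : GroupoidOps M X) : Prop where
  isManifold : IsManifold 𝓘(ℝ, B) ∞ X
  src_loc : IsLocalDiffeomorph 𝓘(ℝ, B) 𝓘(ℝ, B) ∞ Γ.src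
  tgt_loc : IsLocalDiffeomorph 𝓘(ℝ, B) 𝓘(ℝ, B) ∞ Γ.tgt
  unit_loc : IsLocalDiffeomorph 𝓘(ℝ, B) 𝓘(ℝ, B) ∞ Γ.unit
  inv_loc : IsLocalDiffeomorph 𝓘(ℝ, B) 𝓘(ℝ, B) ∞ Γ.inv
  mul_loc : IsLocalDiffeomorph 𝓘(ℝ, B) 𝓘(ℝ, B) ∞
    (fun p : FibreProd src_loc tgt_loc => Γ.mul p.fst p.snd p.comm)
  src_unit : ∀ x, Γ.src (Γ.unit x) = x
  tgt_unit : ∀ x, Γ.tgt (Γ.unit x) = x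
  src_inv : ∀ g, Γ.src (Γ.inv g) = Γ.tgt g
  tgt_inv : ∀ g, Γ.tgt (Γ.inv g) = Γ.src g
  src_mul : ∀ g h (e : Γ.src g = Γ.tgt h), Γ.src (Γ.mul g h e) = Γ.src h
  tgt_mul : ∀ g h (e : Γ.src g = Γ.tgt h), Γ.tgt (Γ.mul g h e) = Γ.tgt g
  mul_assoc : ∀ g h k (e : Γ.src g = Γ.tgt h) (e' : Γ.src h = Γ.tgt k),
    Γ.mul (Γ.mul g h e) k ((src_mul g h e).trans e') =
      Γ.mul g (Γ.mul h k e') (e.trans (tgt_mul h k e').symm)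
  unit_mul : ∀ g, Γ.mul (Γ.unit (Γ.tgt g)) g (src_unit _) = g
  mul_unit : ∀ g, Γ.mul g (Γ.unit (Γ.src g)) (tgt_unit _).symm = g
  inv_mul : ∀ g, Γ.mul (Γ.inv g) g (src_inv g) = Γ.unit (Γ.src g)
  mul_inv : ∀ g, Γ.mul g (Γ.inv g) (tgt_inv g).symm = Γ.unit (Γ.tgt g)

/-- Morphisms of étale Lie groupoids over `M`: smooth functors which are the identity on `M`. -/
structure IsGroupoidMorphism (Γ : GroupoidOps M X) (Γ' : GroupoidOps M Y) (φ : X → Y) :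
    Prop where
  smooth : ContMDiff 𝓘(ℝ, B) 𝓘(ℝ, B) ∞ φ
  src_eq : ∀ g, Γ'.src (φ g) = Γ.src g
  tgt_eq : ∀ g, Γ'.tgt (φ g) = Γ.tgt g
  unit_eq : ∀ x, φ (Γ.unit x) = Γ'.unit x
  mul_eq : ∀ g h (e : Γ.src g = Γ.tgt h),
    φ (Γ.mul g h e) = Γ'.mul (φ g) (φ h) ((src_eq g).trans (e.trans (tgt_eq h).symm))

/-- An étale Lie groupoid over `M`. -/
structure EtaleLieGroupoid (B : Type v) [NormedAddCommGroup B] [NormedSpace ℝ B] (M : Type w)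
    [TopologicalSpace M] [ChartedSpace B M] where
  Arr : Type x
  [top : TopologicalSpace Arr]
  [charted : ChartedSpace B Arr]
  ops : GroupoidOps M Arr
  isEtale : IsEtaleLieGroupoid B ops

attribute [instance] EtaleLieGroupoid.top EtaleLieGroupoid.charted

variable {B}

instance (G : EtaleLieGroupoid B M) : IsManifold 𝓘(ℝ, B) ∞ G.Arr := G.isEtale.isManifold

/-- Morphisms of étale Lie groupoids over `M` are local diffeomorphisms. -/
theorem IsGroupoidMorphism.isLocalDiffeomorph {G H : EtaleLieGroupoid B M} {φ : G.Arr → H.Arr}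
    (hφ : IsGroupoidMorphism B G.ops H.ops φ) : IsLocalDiffeomorph 𝓘(ℝ, B) 𝓘(ℝ, B) ∞ φ := by
  refine isLocalDiffeomorph_of_comp H.isEtale.tgt_loc ?_ hφ.smooth.continuous
  have : H.ops.tgt ∘ φ = G.ops.tgt := funext hφ.tgt_eq
  rw [this]
  exact G.isEtale.tgt_loc

variable (𝕜 : Type*) [RCLike 𝕜]
variable [FiniteDimensional ℝ B] [IsManifold 𝓘(ℝ, B) ∞ M] [T2Space M]

/-- The Hopf algebroid `C_c^∞(G)` over `C_c^∞(M)` of an étale Lie groupoid `G`: the coalgebra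
structure is that of the sheaf `t : G → M`, with `Δ = Ω⁻¹ ∘ diag_+` and `ε = t_+`, the product is
the convolution `u v = mlt_+(Ω_{s,t}(u ⊗ v))`, the algebra `C_c^∞(M)` is included by `uni_+` and
the antipode is `inv_+`. -/
noncomputable def hopf (G : EtaleLieGroupoid B M) : HopfAlgebroidOps 𝕜 B M (Cc 𝕜 B G.Arr) where
  act := sheafAct G.isEtale.tgt_loc
  comul u := Function.invFun (omegaBar G.isEtale.tgt_loc G.isEtale.tgt_loc)
    (pushforward (FibreProd.isLocalDiffeomorph_diag G.isEtale.tgt_loc) u)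
  counit u := toBase (pushforward G.isEtale.tgt_loc u)
  incl p := pushforward G.isEtale.unit_loc (ofBase p)
  mul u v := pushforward G.isEtale.mul_loc (omega G.isEtale.src_loc G.isEtale.tgt_loc u v)
  antipode := pushforward G.isEtale.inv_loc

variable {𝕜}

/-- The element `f ∘ t|_U` of `C_c^∞(G)`, extended by zero outside `U`, for a `t`-elementary open
subset `U` of `G` (that is, `t` is injective on `U`) and `f ∈ C_c^∞(t(U))`. -/
noncomputable def liftElt (G : EtaleLieGroupoid B M) {U : Set G.Arr} (hU : IsOpen U)
    (hinj : InjOn G.ops.tgt U) (f : BaseAlg 𝕜 B M) (hf : tsupport f.1 ⊆ G.ops.tgt '' U) :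
    Cc 𝕜 B G.Arr :=
  ⟨extZero U (f.1 ∘ G.ops.tgt), lift_mem G.isEtale.tgt_loc hU hinj f hf⟩

variable (𝕜) in
/-- The map `c_x ↦ (φ_+(c))_x` induced by a morphism `φ : G → H` on the disjoint unions of the
localizations. The maps `E_sp(φ_+)` and `G_sp(φ_+)` are its restrictions. -/
noncomputable def spectralMap {G H : EtaleLieGroupoid B M} {φ : G.Arr → H.Arr}
    (hφ : IsGroupoidMorphism B G.ops H.ops φ) (p : Σ x : M, Stalk (hopf 𝕜 G).act x) :
    Σ x : M, Stalk (hopf 𝕜 H).act x :=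
  ⟨p.1, stalkMap (act := (hopf 𝕜 G).act) (act' := (hopf 𝕜 H).act)
    (pushforward hφ.isLocalDiffeomorph)
    (pushforward_sheafAct G.isEtale.tgt_loc H.isEtale.tgt_loc hφ.isLocalDiffeomorph hφ.tgt_eq)
    p.1 p.2⟩

end Groupoids

end SpectralGroupoid

open SpectralGroupoid

/-
An element of `C_c^∞(G)` which is weakly grouplike and normalized at `y` has, on the fibre
`t⁻¹(y)`, germs which are idempotent, pairwise orthogonal and of sum `1`: it is the indicator of a
single arrow `g` over `y`. As elements of the stalk `A_y` are determined by their germs on `t⁻¹(y)`,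
sending `g` to the class of such an indicator is a homeomorphism from `G` onto the spectral sheaf.
For an `S`-invariant element the same argument applies to the fibres of `s`, so that the element is
the indicator of a bisection near `g`; then `ε(S(fa))` is computed from `f` by the transition
`t ∘ s⁻¹` along the bisection, and products and antipodes of indicators are the indicators of
products and inverses of arrows. The formulas on the spectral side thus transport the structure
of `G`. The comultiplication is brought to germs by the injectivity of `Ω`, which is checked on
stalks by expanding in the indicators of points.
-/

namespace SpectralGroupoid

section Germs

variable {α X Y : Type*} [TopologicalSpace X] [TopologicalSpace Y] {φ : X → Y} {x : X}

theorem germ_comp_congr {k l : Y → α} (hφ : ContinuousAt φ x)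
    (h : (k : Germ (𝓝 (φ x)) α) = (l : Germ (𝓝 (φ x)) α)) :
    ((k ∘ φ : X → α) : Germ (𝓝 x) α) = ((l ∘ φ : X → α) : Germ (𝓝 x) α) :=
  Germ.coe_eq.2 (hφ.eventually (Germ.coe_eq.1 h))

theorem germ_comp_eq_one [One α] {k : Y → α} (hφ : ContinuousAt φ x)
    (h : ∀ᶠ z in 𝓝 (φ x), k z = 1) : ((k ∘ φ : X → α) : Germ (𝓝 x) α) = 1 :=
  Germ.coe_eq.2 (hφ.eventually h)

theorem germ_comp_eq_zero [Zero α] {k : Y → α} (hφ : ContinuousAt φ x)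
    (h : ∀ᶠ z in 𝓝 (φ x), k z = 0) : ((k ∘ φ : X → α) : Germ (𝓝 x) α) = 0 :=
  Germ.coe_eq.2 (hφ.eventually h)

theorem exists_germ_eq_comp (hφ : IsLocalHomeomorph φ) (γ : Germ (𝓝 x) α) :
    ∃ k : Y → α, γ = ((k ∘ φ : X → α) : Germ (𝓝 x) α) := by
  induction γ using Germ.inductionOn with | _ a
  refine ⟨a ∘ hφ.localInverseAt x, Germ.coe_eq.2 ?_⟩
  filter_upwards [(hφ.localInverseAt x).open_target.mem_nhds hφ.self_mem_localInverseAt_target]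
    with z hz
  have hφz : hφ.localInverseAt x (φ z) = z := by
    simpa only [hφ.localInverseAt_symm] using (hφ.localInverseAt x).right_inv hz
  rw [Function.comp_apply, Function.comp_apply, hφz]

theorem germ_eq_zero_or_one_of_mul_self [TopologicalSpace α] [T1Space α] [MulZeroOneClass α]
    [IsLeftCancelMulZero α] [Nontrivial α] {k : X → α} (hk : ContinuousAt k x)
    (h : (k : Germ (𝓝 x) α) * k = k) :
    (k : Germ (𝓝 x) α) = 0 ∨ (k : Germ (𝓝 x) α) = 1 := by
  have h01 : ∀ᶠ z in 𝓝 x, k z = 0 ∨ k z = 1 := by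
    filter_upwards [Germ.coe_eq.1 h] with z hz
    exact or_iff_not_imp_left.2 fun h0 => mul_left_cancel₀ h0 (hz.trans (mul_one _).symm)
  rcases h01.self_of_nhds with h0 | h1
  · left
    refine Germ.coe_eq.2 ?_
    filter_upwards [h01, hk.eventually_ne (h0.trans_ne zero_ne_one)] with z hz hz1
    exact hz.resolve_right hz1
  · right
    refine Germ.coe_eq.2 ?_
    filter_upwards [h01, hk.eventually_ne (h1.trans_ne one_ne_zero)] with z hz hz0
    exact hz.resolve_left hz0

end Germs

section GermPush

variable {𝕜 : Type*} [RCLike 𝕜] {X Y : Type*} [TopologicalSpace X] [TopologicalSpace Y]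
variable {φ : X → Y} (hφ : IsLocalHomeomorph φ) {x : X} {y : Y} (h : φ x = y)

theorem germPush_injective :
    Function.Injective (germPush hφ h : Germ (𝓝 x) 𝕜 → Germ (𝓝 y) 𝕜) := by
  subst h
  intro γ δ hγδ
  obtain ⟨k, rfl⟩ := exists_germ_eq_comp hφ γ
  obtain ⟨l, rfl⟩ := exists_germ_eq_comp hφ δ
  rw [germPush_comp, germPush_comp] at hγδ
  exact germ_comp_congr hφ.continuous.continuousAt hγδ

theorem germPush_eq_zero_iff {γ : Germ (𝓝 x) 𝕜} : germPush hφ h γ = 0 ↔ γ = 0 :=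
  (germPush_injective hφ h).eq_iff' (germPush_zero hφ h)

theorem germPush_one : germPush hφ h (1 : Germ (𝓝 x) 𝕜) = 1 := rfl

theorem germPush_value (γ : Germ (𝓝 x) 𝕜) : (germPush hφ h γ).value = γ.value := by
  subst h
  obtain ⟨k, rfl⟩ := exists_germ_eq_comp hφ γ
  rw [germPush_comp]
  rfl

theorem germ_zero_ne_one (x : X) : (0 : Germ (𝓝 x) 𝕜) ≠ 1 :=
  fun h => zero_ne_one (α := 𝕜) (congrArg Germ.value h)

end GermPush

section ExtZero

variable {𝕜 : Type*} [RCLike 𝕜] {X : Type*} [TopologicalSpace X] {U : Set X} (a : X → 𝕜) {x : X}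

theorem extZero_of_mem (hx : x ∈ U) : extZero U a x = (a : Germ (𝓝 x) 𝕜) := if_pos hx

theorem extZero_of_notMem (hx : x ∉ U) : extZero U a x = 0 := if_neg hx

end ExtZero

section BaseAlgebra

variable {𝕜 : Type*} [RCLike 𝕜] {B : Type*} [NormedAddCommGroup B] [NormedSpace ℝ B]
  {M : Type*} [TopologicalSpace M] [ChartedSpace B M]

theorem exists_mem_eq_one_of_isCompact (I : Submodule 𝕜 (BaseAlg 𝕜 B M))
    (hI : ∀ p ∈ I, ∀ q : BaseAlg 𝕜 B M, q * p ∈ I) {K : Set M} (hK : IsCompact K)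
    (hloc : ∀ y ∈ K, ∃ p ∈ I, ∀ᶠ z in 𝓝 y, p.1 z = 1) :
    ∃ p ∈ I, ∀ y ∈ K, ∀ᶠ z in 𝓝 y, p.1 z = 1 := by
  refine hK.induction_on (p := fun K => ∃ p ∈ I, ∀ y ∈ K, ∀ᶠ z in 𝓝 y, p.1 z = 1)
    ⟨0, I.zero_mem, by simp⟩ (fun s t hst ⟨p, hp, hp1⟩ => ⟨p, hp, fun y hy => hp1 y (hst hy)⟩)
    ?_ ?_
  · rintro s t ⟨p, hp, hp1⟩ ⟨q, hq, hq1⟩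
    have apply_eq (z : M) : (p + (q - p * q)).1 z = p.1 z + (q.1 z - p.1 z * q.1 z) := rfl
    refine ⟨p + (q - p * q), I.add_mem hp (I.sub_mem hq (hI q hq p)), ?_⟩
    rintro y (hy | hy)
    · filter_upwards [hp1 y hy] with z hz
      rw [apply_eq, hz]
      ring
    · filter_upwards [hq1 y hy] with z hz
      rw [apply_eq, hz]
      ring
  · intro y hy
    obtain ⟨p, hp, hp1⟩ := hloc y hy
    exact ⟨_, mem_nhdsWithin_of_mem_nhds (eventually_eventually_nhds.2 hp1), p, hp, fun _ hz => hz⟩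

variable [FiniteDimensional ℝ B] [IsManifold 𝓘(ℝ, B) ∞ M] [T2Space M]

theorem toStalk_eq_iff_sub_mem {C : Type*} [AddCommGroup C] [Module 𝕜 C]
    (act : BaseAlg 𝕜 B M →ₙₐ[𝕜] Module.End 𝕜 C) (x : M) (c d : C) :
    toStalk act x c = toStalk act x d ↔ c - d ∈ stalkKer act x :=
  Submodule.Quotient.eq _

theorem exists_baseAlg_bump {y : M} {N : Set M} (hN : N ∈ 𝓝 y) :
    ∃ p : BaseAlg 𝕜 B M, (∀ᶠ z in 𝓝 y, p.1 z = 1) ∧ tsupport p.1 ⊆ N := by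
  obtain ⟨θ, hθ, hθ1, K, hKN, hK, hθ0⟩ :=
    exists_bump (𝕜 := 𝕜) (B := B) (isOpen_univ (X := M)) inferInstance (mem_univ y) hN
  have hθK (z : M) (hz : z ∉ K) : θ z = 0 := hθ0 z (mem_univ z) hz
  refine ⟨⟨θ, contMDiffOn_univ.1 hθ, HasCompactSupport.intro hK hθK⟩, hθ1, ?_⟩
  have hsupp : tsupport θ ⊆ K :=
    closure_minimal (Function.support_subset_iff'.2 hθK) hK.isClosed
  exact fun z hz => (hKN (hsupp hz)).1

theorem exists_baseAlg_eq_one_on_subset {K V : Set M} (hK : IsCompact K) (hV : IsOpen V)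
    (hKV : K ⊆ V) :
    ∃ p : BaseAlg 𝕜 B M, (∀ y ∈ K, ∀ᶠ z in 𝓝 y, p.1 z = 1) ∧ tsupport p.1 ⊆ V := by
  let I : Submodule 𝕜 (BaseAlg 𝕜 B M) :=
    { carrier := {p | tsupport p.1 ⊆ V}
      add_mem' := fun {p q} hp hq => (tsupport_add p.1 q.1).trans (union_subset hp hq)
      zero_mem' := by
        change tsupport (0 : M → 𝕜) ⊆ V
        rw [tsupport_eq_empty_iff.2 rfl]
        exact empty_subset V
      smul_mem' := fun c p hp => (tsupport_smul_subset_right (fun _ => c) p.1).trans hp }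
  have hI (p) (hp : p ∈ I) (q : BaseAlg 𝕜 B M) : q * p ∈ I :=
    (tsupport_mul_subset_right (f := q.1) (g := p.1)).trans hp
  have hloc (y) (hy : y ∈ K) : ∃ p ∈ I, ∀ᶠ z in 𝓝 y, p.1 z = 1 :=
    (exists_baseAlg_bump (hV.mem_nhds (hKV hy))).imp fun _ hp => ⟨hp.2, hp.1⟩
  obtain ⟨p, hp, hp1⟩ := exists_mem_eq_one_of_isCompact I hI hK hloc
  exact ⟨p, hp1, hp⟩

end BaseAlgebra

section VanishNear

variable {X M : Type*} [TopologicalSpace X] [TopologicalSpace M]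

/-- The sections of the sheaf of germs on `X` which vanish over a neighbourhood of `y`. On
`C_c^∞(X)` this is the kernel of the localization at `y`. -/
def vanishNear (𝕜 : Type*) [Semiring 𝕜] (f : X → M) (y : M) :
    Submodule 𝕜 (∀ x : X, Germ (𝓝 x) 𝕜) where
  carrier := {u | ∀ᶠ z in 𝓝 y, ∀ x, f x = z → u x = 0}
  add_mem' := by
    intro u v hu hv
    filter_upwards [hu, hv] with z huz hvz x hx
    rw [Pi.add_apply, huz x hx, hvz x hx, add_zero]
  zero_mem' := Eventually.of_forall fun _ _ _ => rfl
  smul_mem' := by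
    intro c u hu
    filter_upwards [hu] with z huz x hx
    rw [Pi.smul_apply, huz x hx, smul_zero]

variable {𝕜 : Type*} [RCLike 𝕜] {f : X → M} {V W : Set X} {k l : M → 𝕜}

theorem extZero_comp_mem_vanishNear (hf : Continuous f) {y : M} (hk : k =ᶠ[𝓝 y] 0) :
    extZero V (k ∘ f) ∈ vanishNear 𝕜 f y := by
  filter_upwards [eventually_eventually_nhds.2 hk] with z hz x hx
  by_cases hxV : x ∈ V
  · exact (extZero_of_mem _ hxV).trans (germ_comp_eq_zero hf.continuousAt (hx ▸ hz))
  · exact extZero_of_notMem _ hxV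

theorem extZero_comp_sub_mem_vanishNear (hf : Continuous f) (hfo : IsOpenMap f) (hV : IsOpen V)
    (hW : IsOpen W) (hVf : InjOn f V) (hWf : InjOn f W) {x : X} (hxV : x ∈ V) (hxW : x ∈ W)
    (hkl : k =ᶠ[𝓝 (f x)] l) :
    extZero V (k ∘ f) - extZero W (l ∘ f) ∈ vanishNear 𝕜 f (f x) := by
  have hVW : f '' (V ∩ W) ∈ 𝓝 (f x) :=
    (hfo _ (hV.inter hW)).mem_nhds (mem_image_of_mem f ⟨hxV, hxW⟩)
  filter_upwards [hVW, eventually_eventually_nhds.2 hkl]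
  rintro _ ⟨x', ⟨hV', hW'⟩, rfl⟩ hkl' z hz
  rw [Pi.sub_apply, sub_eq_zero]
  by_cases hzx : z = x'
  · subst hzx
    rw [extZero_of_mem _ hV', extZero_of_mem _ hW']
    exact germ_comp_congr hf.continuousAt (Germ.coe_eq.2 hkl')
  · rw [extZero_of_notMem _ fun h => hzx (hVf h hV' hz),
      extZero_of_notMem _ fun h => hzx (hWf h hW' hz)]

end VanishNear

section Sheaf

variable {𝕜 : Type*} [RCLike 𝕜] {B : Type*} [NormedAddCommGroup B] [NormedSpace ℝ B]
  {X M : Type*} [TopologicalSpace X] [TopologicalSpace M] [ChartedSpace B X] [ChartedSpace B M]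
  {f : X → M} (hf : IsLocalDiffeomorph 𝓘(ℝ, B) 𝓘(ℝ, B) ∞ f)

theorem sheafAct_apply (p : BaseAlg 𝕜 B M) (u : Cc 𝕜 B X) (x : X) :
    (sheafAct hf p u).1 x = ((p.1 ∘ f : X → 𝕜) : Germ (𝓝 x) 𝕜) * u.1 x := rfl

theorem sheafAct_mem_vanishNear {p : BaseAlg 𝕜 B M} {y : M} (hp : p.1 =ᶠ[𝓝 y] 0)
    (u : Cc 𝕜 B X) : (sheafAct hf p u).1 ∈ vanishNear 𝕜 f y := by
  filter_upwards [eventually_eventually_nhds.2 hp] with z hz x hx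
  rw [sheafAct_apply,
    germ_comp_eq_zero hf.isLocalHomeomorph.continuous.continuousAt (hx ▸ hz), zero_mul]

theorem coe_sheafAct_of_eq_extZero (p : BaseAlg 𝕜 B M) {u : Cc 𝕜 B X} {U : Set X} {k : M → 𝕜}
    (hu : u.1 = extZero U (k ∘ f)) : (sheafAct hf p u).1 = extZero U ((p.1 * k) ∘ f) := by
  funext x
  rw [sheafAct_apply, hu]
  by_cases hx : x ∈ U
  · rw [extZero_of_mem _ hx, extZero_of_mem _ hx]
    rfl
  · rw [extZero_of_notMem _ hx, extZero_of_notMem _ hx, mul_zero]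

section Lift

variable [T2Space M]

/-- The element `p ∘ f|_U` of `C_c^∞(X)`, extended by zero, for an open set `U` on which `f` is
injective and `p ∈ C_c^∞(f(U))`. -/
noncomputable def sheafLift {U : Set X} (hU : IsOpen U) (hinj : InjOn f U) (p : BaseAlg 𝕜 B M)
    (hp : tsupport p.1 ⊆ f '' U) : Cc 𝕜 B X :=
  ⟨extZero U (p.1 ∘ f), lift_mem hf hU hinj p hp⟩

variable [FiniteDimensional ℝ B] [IsManifold 𝓘(ℝ, B) ∞ X]

include hf in
theorem exists_baseAlg_comp_eqOn {V : Set X} {a : X → 𝕜} (hV : IsOpen V) (hT : T2Space V)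
    (hinj : InjOn f V) (ha : IsCcOn 𝕜 B V a) :
    ∃ p : BaseAlg 𝕜 B M, EqOn (p.1 ∘ f) a V ∧ tsupport p.1 ⊆ f '' V := by
  cases isEmpty_or_nonempty X
  · refine ⟨0, fun x => isEmptyElim x, ?_⟩
    change tsupport (0 : M → 𝕜) ⊆ f '' V
    rw [tsupport_eq_empty_iff.2 rfl]
    exact empty_subset _
  let σ : M → X := Function.invFunOn f V
  have hσ (x : X) (hx : x ∈ V) : σ (f x) = x := hinj.leftInvOn_invFunOn hx
  let p : BaseAlg 𝕜 B M := toBase (pushforward hf ⟨_, extZero_mem hV hT ha⟩)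
  have hp (z : M) : p.1 z = (extZero (f '' V) (a ∘ σ) z).value :=
    congrArg Germ.value (congrFun (pushSection_extZero hf.isLocalHomeomorph hV hinj a σ hσ) z)
  have hpf : EqOn (p.1 ∘ f) a V := by
    intro x hx
    rw [Function.comp_apply, hp, extZero_of_mem _ (mem_image_of_mem f hx)]
    exact congrArg a (hσ x hx)
  obtain ⟨_, K, hKV, hK, haK⟩ := ha
  have hsupp : Function.support p.1 ⊆ f '' K := by
    refine Function.support_subset_iff'.2 fun z hzK => ?_
    by_cases hz : z ∈ f '' V
    · obtain ⟨x, hx, rfl⟩ := hz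
      exact (hpf hx).trans (haK x hx fun h => hzK (mem_image_of_mem f h))
    · rw [hp, extZero_of_notMem _ hz]
      rfl
  have hK' : IsClosed (f '' K) := (hK.image hf.isLocalHomeomorph.continuous).isClosed
  exact ⟨p, hpf, (closure_minimal hsupp hK').trans (image_mono hKV)⟩

include hf in
theorem Cc_le_of_sheafLift_mem (S : Submodule 𝕜 (∀ x : X, Germ (𝓝 x) 𝕜))
    (hS : ∀ (V : Set X) (hV : IsOpen V) (hinj : InjOn f V) (p : BaseAlg 𝕜 B M)
      (hp : tsupport p.1 ⊆ f '' V), (sheafLift hf hV hinj p hp).1 ∈ S) : Cc 𝕜 B X ≤ S := by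
  refine Cc_le (B := B) (fun V => InjOn f V) (exists_injOn hf.isLocalHomeomorph) S ?_
  intro V a hV hT hinj ha
  obtain ⟨p, hpa, hp⟩ := exists_baseAlg_comp_eqOn hf hV hT hinj ha
  rw [← extZero_congr hV hpa]
  exact hS V hV hinj p hp

include hf in
theorem exists_baseAlg_germ (u : Cc 𝕜 B X) (x : X) :
    ∃ p : BaseAlg 𝕜 B M, u.1 x = ((p.1 ∘ f : X → 𝕜) : Germ (𝓝 x) 𝕜) := by
  let S : Submodule 𝕜 (∀ x : X, Germ (𝓝 x) 𝕜) :=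
    { carrier := {u | ∃ p : BaseAlg 𝕜 B M, u x = ((p.1 ∘ f : X → 𝕜) : Germ (𝓝 x) 𝕜)}
      add_mem' := by
        rintro u v ⟨p, hp⟩ ⟨q, hq⟩
        exact ⟨p + q, by rw [Pi.add_apply, hp, hq]; rfl⟩
      zero_mem' := ⟨0, rfl⟩
      smul_mem' := by
        rintro c u ⟨p, hp⟩
        exact ⟨c • p, by rw [Pi.smul_apply, hp]; rfl⟩ }
  refine Cc_le_of_sheafLift_mem hf S (fun V _ _ p _ => ?_) u.2
  by_cases hx : x ∈ V
  · exact ⟨p, extZero_of_mem _ hx⟩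
  · exact ⟨0, extZero_of_notMem _ hx⟩

include hf in
theorem Cc.germ_eq_zero_or_one_of_mul_self {u : Cc 𝕜 B X} {x : X} (h : u.1 x * u.1 x = u.1 x) :
    u.1 x = 0 ∨ u.1 x = 1 := by
  obtain ⟨p, hp⟩ := exists_baseAlg_germ hf u x
  rw [hp] at h ⊢
  exact SpectralGroupoid.germ_eq_zero_or_one_of_mul_self
    (p.2.1.continuous.comp hf.isLocalHomeomorph.continuous).continuousAt h

end Lift

section Indicator

/-- `u` has the germ of the constant function `1` at `x` and the germ zero at all other points of
the fibre of `f` through `x`. -/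
def IsIndicatorAt (f : X → M) (u : ∀ x : X, Germ (𝓝 x) 𝕜) (x : X) : Prop :=
  u x = 1 ∧ ∀ x', f x' = f x → x' ≠ x → u x' = 0

omit [NormedAddCommGroup B] [NormedSpace ℝ B] [ChartedSpace B X] [ChartedSpace B M] in
theorem isIndicatorAt_extZero (hf : Continuous f) {U : Set X} (hinj : InjOn f U) {k : M → 𝕜}
    {x : X} (hx : x ∈ U) (hk : ∀ᶠ z in 𝓝 (f x), k z = 1) :
    IsIndicatorAt f (extZero U (k ∘ f)) x :=
  ⟨(extZero_of_mem _ hx).trans (germ_comp_eq_one hf.continuousAt hk),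
    fun _ hx' hne => extZero_of_notMem _ fun h => hne (hinj h hx hx')⟩

end Indicator

section LocalUnit

variable [FiniteDimensional ℝ B] [IsManifold 𝓘(ℝ, B) ∞ M] [T2Space M]

variable (𝕜) in
theorem exists_localBump (x : X) :
    ∃ p : BaseAlg 𝕜 B M, (∀ᶠ z in 𝓝 (f x), p.1 z = 1) ∧
      tsupport p.1 ⊆ f '' (hf.isLocalHomeomorph.localInverseAt x).target :=
  exists_baseAlg_bump <| hf.isLocalHomeomorph.isOpenMap.image_mem_nhds <|
    (hf.isLocalHomeomorph.localInverseAt x).open_target.mem_nhds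
      hf.isLocalHomeomorph.self_mem_localInverseAt_target

variable (𝕜) in
/-- A chosen function with germ one at `f x` and with support in the image of the chosen
neighbourhood of `x` on which `f` is injective. -/
noncomputable def localBump (x : X) : BaseAlg 𝕜 B M := (exists_localBump 𝕜 hf x).choose

variable (𝕜) in
/-- A chosen element of `C_c^∞(X)` which on the fibre of `f` through `x` is the indicator of `x`.
The elements `localUnit 𝕜 hf x` with `f x = y` generate the localization of `C_c^∞(X)` at `y`. -/
noncomputable def localUnit (x : X) : Cc 𝕜 B X :=
  sheafLift hf (hf.isLocalHomeomorph.localInverseAt x).open_target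
    hf.isLocalHomeomorph.injOn_localInverseAt_target (localBump 𝕜 hf x)
    (exists_localBump 𝕜 hf x).choose_spec.2

theorem isIndicatorAt_localUnit (x : X) :
    IsIndicatorAt f (localUnit 𝕜 hf x).1 x :=
  isIndicatorAt_extZero hf.isLocalHomeomorph.continuous
    hf.isLocalHomeomorph.injOn_localInverseAt_target
    hf.isLocalHomeomorph.self_mem_localInverseAt_target (exists_localBump 𝕜 hf x).choose_spec.1

variable (𝕜) in
/-- The linear combinations of the elements `localUnit 𝕜 hf x`, for `x` in the fibre over `y`, with
coefficients in `C_c^∞(M)`. -/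
noncomputable def localUnitComb (y : M) :
    ({x : X // f x = y} →₀ BaseAlg 𝕜 B M) →ₗ[𝕜] Cc 𝕜 B X :=
  Finsupp.lsum 𝕜 fun x =>
    (LinearMapClass.linearMap (sheafAct (𝕜 := 𝕜) hf)).flip (localUnit 𝕜 hf x.1)

theorem localUnitComb_single {y : M} (x : {x : X // f x = y}) (p : BaseAlg 𝕜 B M) :
    localUnitComb 𝕜 hf y (Finsupp.single x p) = sheafAct hf p (localUnit 𝕜 hf x.1) :=
  Finsupp.lsum_single _ _ _ _

theorem localUnitComb_apply {y : M} (q : {x : X // f x = y} →₀ BaseAlg 𝕜 B M)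
    (x : {x : X // f x = y}) :
    (localUnitComb 𝕜 hf y q).1 x.1 = (((q x).1 ∘ f : X → 𝕜) : Germ (𝓝 x.1) 𝕜) := by
  induction q using Finsupp.induction_linear with
  | zero => rfl
  | add q r hq hr =>
    rw [map_add, Submodule.coe_add, Pi.add_apply, hq, hr, Finsupp.add_apply]
    rfl
  | single x' p =>
    rw [localUnitComb_single, sheafAct_apply]
    rcases eq_or_ne x' x with rfl | hne
    · rw [(isIndicatorAt_localUnit hf x'.1).1, mul_one, Finsupp.single_eq_same]
    · rw [(isIndicatorAt_localUnit hf x'.1).2 x.1 (x.2.trans x'.2.symm)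
        fun h => hne (Subtype.ext h.symm), mul_zero, Finsupp.single_eq_of_ne hne.symm]
      rfl

theorem localUnitComb_mem_vanishNear {y : M} {q : {x : X // f x = y} →₀ BaseAlg 𝕜 B M}
    (hq : ∀ x, (q x).1 =ᶠ[𝓝 y] 0) : (localUnitComb 𝕜 hf y q).1 ∈ vanishNear 𝕜 f y := by
  change localUnitComb 𝕜 hf y q ∈ (vanishNear 𝕜 f y).comap (Cc 𝕜 B X).subtype
  rw [localUnitComb, Finsupp.lsum_apply]
  exact Submodule.sum_mem _ fun x _ => sheafAct_mem_vanishNear hf (hq x) _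

variable [IsManifold 𝓘(ℝ, B) ∞ X]

theorem exists_sub_localUnitComb_mem_vanishNear (y : M) (u : Cc 𝕜 B X) :
    ∃ q, (u - localUnitComb 𝕜 hf y q).1 ∈ vanishNear 𝕜 f y := by
  let S : Submodule 𝕜 (∀ x : X, Germ (𝓝 x) 𝕜) :=
    ((localUnitComb 𝕜 hf y).range.map (Cc 𝕜 B X).subtype) ⊔ vanishNear 𝕜 f y
  have hS : u.1 ∈ S := by
    refine Cc_le_of_sheafLift_mem hf S (fun V hV hinj p hp => ?_) u.2
    by_cases hy : y ∈ f '' V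
    · obtain ⟨x, hx, rfl⟩ := hy
      rw [← add_sub_cancel (localUnitComb 𝕜 hf (f x) (Finsupp.single ⟨x, rfl⟩ p)).1
        (sheafLift hf hV hinj p hp).1]
      refine Submodule.add_mem_sup ⟨_, ⟨_, rfl⟩, rfl⟩ ?_
      rw [localUnitComb_single, coe_sheafAct_of_eq_extZero hf p rfl]
      refine extZero_comp_sub_mem_vanishNear hf.isLocalHomeomorph.continuous
        hf.isLocalHomeomorph.isOpenMap hV
        (hf.isLocalHomeomorph.localInverseAt x).open_target hinj
        hf.isLocalHomeomorph.injOn_localInverseAt_target hx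
        hf.isLocalHomeomorph.self_mem_localInverseAt_target ?_
      filter_upwards [(exists_localBump 𝕜 hf x).choose_spec.1] with z hz
      exact ((congrArg (p.1 z * ·) hz).trans (mul_one _)).symm
    · exact Submodule.mem_sup_right (extZero_comp_mem_vanishNear
        hf.isLocalHomeomorph.continuous
        (notMem_tsupport_iff_eventuallyEq.1 fun h => hy (hp h)))
  obtain ⟨_, ⟨_, ⟨q, rfl⟩, rfl⟩, v, hv, huv⟩ := Submodule.mem_sup.1 hS
  refine ⟨q, ?_⟩
  rwa [Submodule.coe_sub, ← huv, Submodule.subtype_apply, add_sub_cancel_left]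

include hf in
theorem mem_vanishNear_iff {u : Cc 𝕜 B X} {y : M} :
    u.1 ∈ vanishNear 𝕜 f y ↔ ∀ x, f x = y → u.1 x = 0 := by
  refine ⟨fun hu => hu.self_of_nhds, fun hu => ?_⟩
  obtain ⟨q, hq⟩ := exists_sub_localUnitComb_mem_vanishNear hf y u
  have hq0 (x) : (q x).1 =ᶠ[𝓝 y] 0 := by
    have hx : (localUnitComb 𝕜 hf y q).1 x.1 = 0 := by
      have := hq.self_of_nhds x.1 x.2
      rwa [Submodule.coe_sub, Pi.sub_apply, hu x.1 x.2, zero_sub, neg_eq_zero] at this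
    rw [localUnitComb_apply, ← germPush_eq_zero_iff hf.isLocalHomeomorph x.2, germPush_comp] at hx
    exact Germ.coe_eq.1 hx
  rw [← sub_add_cancel u (localUnitComb 𝕜 hf y q)]
  exact Submodule.add_mem _ hq (localUnitComb_mem_vanishNear hf hq0)

theorem mem_stalkKer_iff {u : Cc 𝕜 B X} {y : M} :
    u ∈ stalkKer (sheafAct hf) y ↔ ∀ x, f x = y → u.1 x = 0 := by
  have hc := hf.isLocalHomeomorph.continuous
  constructor
  · rintro ⟨p, hp, hpu⟩ x rfl
    rw [← one_mul (u.1 x), ← germ_comp_eq_one hc.continuousAt hp, ← sheafAct_apply hf, hpu]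
    rfl
  · intro hu
    obtain ⟨p, hp, hpu⟩ := exists_baseAlg_bump (𝕜 := 𝕜) (B := B) ((mem_vanishNear_iff hf).2 hu)
    refine ⟨p, hp, Subtype.ext (funext fun x => ?_)⟩
    rw [sheafAct_apply]
    by_cases hx : f x ∈ tsupport p.1
    · rw [hpu hx x rfl, mul_zero]
      rfl
    · rw [germ_comp_eq_zero hc.continuousAt (notMem_tsupport_iff_eventuallyEq.1 hx), zero_mul]
      rfl

theorem toStalk_sheafAct_eq_iff {u v : Cc 𝕜 B X} {y : M} :
    toStalk (C := Cc 𝕜 B X) (sheafAct hf) y u = toStalk (C := Cc 𝕜 B X) (sheafAct hf) y v ↔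
      ∀ x, f x = y → u.1 x = v.1 x := by
  rw [toStalk_eq_iff_sub_mem, mem_stalkKer_iff]
  refine forall₂_congr fun x _ => ?_
  rw [Submodule.coe_sub, Pi.sub_apply, sub_eq_zero]

end LocalUnit

end Sheaf

section FibreProduct

variable {𝕜 : Type*} [RCLike 𝕜] {B : Type*} [NormedAddCommGroup B] [NormedSpace ℝ B]
  {X Y M : Type*} [TopologicalSpace X] [TopologicalSpace Y] [TopologicalSpace M]
  [ChartedSpace B X] [ChartedSpace B Y] [ChartedSpace B M]
  {f : X → M} (hf : IsLocalDiffeomorph 𝓘(ℝ, B) 𝓘(ℝ, B) ∞ f)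
  {g : Y → M} (hg : IsLocalDiffeomorph 𝓘(ℝ, B) 𝓘(ℝ, B) ∞ g)

theorem FibreProd.isLocalDiffeomorph_comp_fst :
    IsLocalDiffeomorph 𝓘(ℝ, B) 𝓘(ℝ, B) ∞ (f ∘ FibreProd.fst : FibreProd hf hg → M) :=
  fun q => (FibreProd.isLocalDiffeomorph_fst q).comp 𝓘(ℝ, B) M (hf q.fst)

theorem FibreProd.isLocalHomeomorph_comp_fst :
    IsLocalHomeomorph (f ∘ FibreProd.fst : FibreProd hf hg → M) :=
  (FibreProd.isLocalDiffeomorph_comp_fst hf hg).isLocalHomeomorph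

theorem germPush_omegaSection {u : ∀ x : X, Germ (𝓝 x) 𝕜} {v : ∀ y : Y, Germ (𝓝 y) 𝕜}
    (q : FibreProd hf hg) {y : M} (h₁ : f q.fst = y) (h₂ : g q.snd = y) :
    germPush (FibreProd.isLocalHomeomorph_comp_fst hf hg) h₁ (omegaSection hf hg u v q) =
      germPush hf.isLocalHomeomorph h₁ (u q.fst) *
        germPush hg.isLocalHomeomorph h₂ (v q.snd) := by
  obtain ⟨k, hk⟩ := exists_germ_eq_comp hf.isLocalHomeomorph (u q.fst)
  obtain ⟨l, hl⟩ := exists_germ_eq_comp hg.isLocalHomeomorph (v q.snd)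
  have hcomm : (g ∘ FibreProd.snd : FibreProd hf hg → M) = f ∘ FibreProd.fst :=
    funext fun q => q.comm.symm
  have hΩ : omegaSection hf hg u v q =
      (((k * l) ∘ (f ∘ FibreProd.fst) : FibreProd hf hg → 𝕜) : Germ (𝓝 q) 𝕜) := by
    rw [omegaSection, hk, hl]
    change ((k ∘ (f ∘ FibreProd.fst) * l ∘ (g ∘ FibreProd.snd) : FibreProd hf hg → 𝕜) :
      Germ (𝓝 q) 𝕜) = _
    rw [hcomm]
    rfl
  rw [hΩ, hk, hl, germPush_comp, germPush_comp, germPush_comp]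
  rfl

variable [FiniteDimensional ℝ B] [IsManifold 𝓘(ℝ, B) ∞ X]

theorem germPush_pushforward_diag (w : Cc 𝕜 B X) (x : X) {y : M} (h : f x = y) :
    germPush (FibreProd.isLocalHomeomorph_comp_fst hf hf) (y := FibreProd.diag hf x) h
      ((pushforward (FibreProd.isLocalDiffeomorph_diag hf) w).1 (FibreProd.diag hf x)) =
      germPush hf.isLocalHomeomorph h (w.1 x) := by
  have hdiag : (pushforward (FibreProd.isLocalDiffeomorph_diag hf) w).1 (FibreProd.diag hf x) =
      germPush (FibreProd.isLocalDiffeomorph_diag hf).isLocalHomeomorph rfl (w.1 x) := by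
    refine finsum_eq_single _ (⟨x, rfl⟩ : {x' // FibreProd.diag hf x' = FibreProd.diag hf x}) ?_
    rintro ⟨x', hx'⟩ hne
    exact (hne (Subtype.ext (congrArg FibreProd.fst hx'))).elim
  obtain ⟨k, hk⟩ := exists_germ_eq_comp hf.isLocalHomeomorph (w.1 x)
  have hcomp : k ∘ f = (k ∘ (f ∘ FibreProd.fst)) ∘ FibreProd.diag hf := rfl
  rw [hdiag, hk, germPush_comp, hcomp, germPush_comp]
  exact germPush_comp (FibreProd.isLocalHomeomorph_comp_fst hf hf) (y := FibreProd.diag hf x) h k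

theorem pushforward_diag_of_fst_ne_snd (w : Cc 𝕜 B X) {q : FibreProd hf hf}
    (h : q.fst ≠ q.snd) : (pushforward (FibreProd.isLocalDiffeomorph_diag hf) w).1 q = 0 := by
  have : IsEmpty {x // FibreProd.diag hf x = q} :=
    ⟨fun x => h ((congrArg FibreProd.fst x.2).symm.trans (congrArg FibreProd.snd x.2))⟩
  exact finsum_of_isEmpty _

end FibreProduct

section DiagProd

variable {𝕜 : Type*} [RCLike 𝕜] {B : Type*} [NormedAddCommGroup B] [NormedSpace ℝ B]
  {X M : Type*} [TopologicalSpace X] [TopologicalSpace M] [ChartedSpace B X] [ChartedSpace B M]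
  {f : X → M} (hf : IsLocalDiffeomorph 𝓘(ℝ, B) 𝓘(ℝ, B) ∞ f)

/-- The equation `diag_+(w) = Ω(u ⊗ v)` at the points over `y`, written in terms of germs
at `y`. -/
structure IsDiagProdAt (y : M) (w u v : ∀ x : X, Germ (𝓝 x) 𝕜) : Prop where
  mul_self : ∀ x, f x = y → u x * v x = w x
  mul_of_ne : ∀ (x x' : X) (h : f x = y) (h' : f x' = y), x ≠ x' →
    germPush hf.isLocalHomeomorph h (u x) * germPush hf.isLocalHomeomorph h' (v x') = 0

theorem isDiagProdAt_extZero {U : Set X} (hinj : InjOn f U) (a b : X → 𝕜) (y : M) :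
    IsDiagProdAt hf y (extZero U (a * b)) (extZero U a) (extZero U b) := by
  refine ⟨fun x _ => ?_, fun x x' h h' hne => ?_⟩
  · by_cases hx : x ∈ U
    · rw [extZero_of_mem _ hx, extZero_of_mem _ hx, extZero_of_mem _ hx]
      rfl
    · rw [extZero_of_notMem a hx, extZero_of_notMem (a * b) hx, zero_mul]
  · by_cases hx : x ∈ U
    · rw [extZero_of_notMem b fun hx' => hne (hinj hx hx' (h.trans h'.symm)), germPush_zero,
        mul_zero]
    · rw [extZero_of_notMem _ hx, germPush_zero, zero_mul]

theorem mul_eq_left_of_forall_tsupport {p q : M → 𝕜} (hpq : ∀ z ∈ tsupport p, q z = 1) :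
    p * q = p := by
  funext z
  by_cases hz : z ∈ tsupport p
  · rw [Pi.mul_apply, hpq z hz, mul_one]
  · rw [Pi.mul_apply, image_eq_zero_of_notMem_tsupport hz, zero_mul]

theorem isDiagProdAt_sheafLift [T2Space M] {U : Set X} (hU : IsOpen U) (hinj : InjOn f U)
    {p q : BaseAlg 𝕜 B M} (hp : tsupport p.1 ⊆ f '' U) (hq : tsupport q.1 ⊆ f '' U)
    (hpq : ∀ z ∈ tsupport p.1, q.1 z = 1) (y : M) :
    IsDiagProdAt hf y (sheafLift hf hU hinj p hp).1 (sheafLift hf hU hinj p hp).1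
      (sheafLift hf hU hinj q hq).1 := by
  have hmul : (p.1 ∘ f) * (q.1 ∘ f) = p.1 ∘ f :=
    congrArg (· ∘ f) (mul_eq_left_of_forall_tsupport hpq)
  have h := isDiagProdAt_extZero hf hinj (p.1 ∘ f) (q.1 ∘ f) y
  rwa [hmul] at h

variable [FiniteDimensional ℝ B] [IsManifold 𝓘(ℝ, B) ∞ X]

theorem isDiagProdAt_iff_germPush {w : Cc 𝕜 B X} {u v : ∀ x : X, Germ (𝓝 x) 𝕜} {y : M} :
    IsDiagProdAt hf y w.1 u v ↔ ∀ (q : FibreProd hf hf) (h : f q.fst = y) (h' : f q.snd = y),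
      germPush (FibreProd.isLocalHomeomorph_comp_fst hf hf) h
          ((pushforward (FibreProd.isLocalDiffeomorph_diag hf) w).1 q) =
        germPush hf.isLocalHomeomorph h (u q.fst) * germPush hf.isLocalHomeomorph h' (v q.snd) := by
  constructor
  · intro hw q h h'
    by_cases hq : q.fst = q.snd
    · obtain ⟨x, x', hx⟩ := q
      obtain rfl : x = x' := hq
      rw [← germPush_mul, hw.mul_self x h]
      exact germPush_pushforward_diag hf w x h
    · rw [hw.mul_of_ne _ _ _ _ hq, pushforward_diag_of_fst_ne_snd hf w hq]
      exact germPush_zero _ _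
  · refine fun hw => ⟨fun x h => germPush_injective hf.isLocalHomeomorph h ?_, ?_⟩
    · rw [germPush_mul, ← germPush_pushforward_diag hf w x h]
      exact (hw (FibreProd.diag hf x) h h).symm
    · intro x x' h h' hne
      rw [← hw ⟨x, x', h.trans h'.symm⟩ h h', pushforward_diag_of_fst_ne_snd hf w hne]
      exact germPush_zero _ _

variable [T2Space M]

theorem omega_eq_pushforward_diag_iff (w u v : Cc 𝕜 B X) :
    omega hf hf u v = pushforward (FibreProd.isLocalDiffeomorph_diag hf) w ↔
      ∀ y, IsDiagProdAt hf y w.1 u.1 v.1 := by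
  simp only [isDiagProdAt_iff_germPush]
  constructor
  · intro hΩ y q h h'
    rw [← hΩ]
    exact germPush_omegaSection hf hf q h h'
  · refine fun hw => Subtype.ext (funext fun q => ?_)
    refine germPush_injective (FibreProd.isLocalHomeomorph_comp_fst hf hf) rfl ?_
    rw [hw _ q rfl q.comm.symm]
    exact germPush_omegaSection hf hf q rfl q.comm.symm

variable [IsManifold 𝓘(ℝ, B) ∞ M]

theorem pushforward_diag_mem_range_omegaBar (w : Cc 𝕜 B X) :
    pushforward (FibreProd.isLocalDiffeomorph_diag hf) w ∈
      LinearMap.range (omegaBar (𝕜 := 𝕜) hf hf) := by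
  let S : Submodule 𝕜 (Cc 𝕜 B X) := (LinearMap.range (omegaBar (𝕜 := 𝕜) hf hf)).comap
    (pushforward (FibreProd.isLocalDiffeomorph_diag hf))
  have hS : Cc 𝕜 B X ≤ S.map (Cc 𝕜 B X).subtype := by
    refine Cc_le_of_sheafLift_mem hf _ fun V hV hinj p hp =>
      ⟨sheafLift hf hV hinj p hp, ?_, rfl⟩
    obtain ⟨q, hq1, hq⟩ := exists_baseAlg_eq_one_on_subset (𝕜 := 𝕜) (B := B) p.2.2
      (hf.isLocalHomeomorph.isOpenMap _ hV) hp
    refine ⟨TensorOver.tmul (C := Cc 𝕜 B X) (D := Cc 𝕜 B X) (sheafAct (𝕜 := 𝕜) hf)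
      (sheafAct (𝕜 := 𝕜) hf) (sheafLift hf hV hinj p hp) (sheafLift hf hV hinj q hq), ?_⟩
    exact (omega_eq_pushforward_diag_iff hf _ _ _).2
      (isDiagProdAt_sheafLift hf hV hinj hp hq fun z hz => (hq1 z hz).self_of_nhds)
  obtain ⟨w', hw', hww'⟩ := hS w.2
  exact Subtype.ext hww' ▸ hw'

end DiagProd

section TensorOver

variable {𝕜 : Type*} [RCLike 𝕜] {R : Type*} [NonUnitalCommRing R] [Module 𝕜 R]
  {C D : Type*} [AddCommGroup C] [Module 𝕜 C] [AddCommGroup D] [Module 𝕜 D]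

/-- The bilinear map `(c, d) ↦ c ⊗ d`. -/
def TensorOver.mk (a : R → Module.End 𝕜 C) (b : R → Module.End 𝕜 D) :
    C →ₗ[𝕜] D →ₗ[𝕜] TensorOver a b :=
  (TensorProduct.mk 𝕜 C D).compr₂ (tensorRel a b).mkQ

variable (a : R →ₙₐ[𝕜] Module.End 𝕜 C) (b : R →ₙₐ[𝕜] Module.End 𝕜 D)

theorem TensorOver.mk_act_right (r : R) (c : C) (d : D) :
    TensorOver.mk a b c (b r d) = TensorOver.mk a b (a r c) d :=
  ((Submodule.Quotient.eq (tensorRel a b)).2 (Submodule.subset_span ⟨r, c, d, rfl⟩)).symm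

theorem TensorOver.induction {P : TensorOver a b → Prop} (zero : P 0)
    (add : ∀ w w', P w → P w' → P (w + w')) (mk : ∀ c d, P (TensorOver.mk a b c d))
    (w : TensorOver a b) : P w := by
  obtain ⟨w, rfl⟩ := (tensorRel a b).mkQ_surjective w
  induction w using TensorProduct.induction_on with
  | zero => exact (map_zero (tensorRel a b).mkQ).symm ▸ zero
  | tmul c d => exact mk c d
  | add x y hx hy => exact (map_add (tensorRel a b).mkQ x y).symm ▸ add _ _ hx hy

theorem TensorOver.hom_ext {E : Type*} [AddCommGroup E] [Module 𝕜 E]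
    {φ ψ : TensorOver a b →ₗ[𝕜] E}
    (h : ∀ c d, φ (TensorOver.mk a b c d) = ψ (TensorOver.mk a b c d)) : φ = ψ :=
  Submodule.linearMap_qext _ (TensorProduct.ext' h)

/-- The `R`-module `C ⊗_R D`. -/
def tensorAct : R →ₙₐ[𝕜] Module.End 𝕜 (TensorOver a b) where
  toFun r := TensorOver.lift a b ((TensorOver.mk a b).comp (a r)) fun s c d => by
    rw [LinearMap.comp_apply, LinearMap.comp_apply, TensorOver.mk_act_right,
      ← Module.End.mul_apply, ← Module.End.mul_apply, ← map_mul, ← map_mul, mul_comm]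
  map_smul' t r := TensorOver.hom_ext a b fun c d => by
    change TensorOver.mk a b (a (t • r) c) d = t • TensorOver.mk a b (a r c) d
    rw [map_smul, LinearMap.smul_apply, map_smul, LinearMap.smul_apply]
  map_zero' := TensorOver.hom_ext a b fun c d => by
    change TensorOver.mk a b (a 0 c) d = 0
    rw [map_zero, LinearMap.zero_apply, map_zero, LinearMap.zero_apply]
  map_add' r s := TensorOver.hom_ext a b fun c d => by
    change TensorOver.mk a b (a (r + s) c) d =
      TensorOver.mk a b (a r c) d + TensorOver.mk a b (a s c) d
    rw [map_add, LinearMap.add_apply, map_add, LinearMap.add_apply]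
  map_mul' r s := TensorOver.hom_ext a b fun c d => by
    change TensorOver.mk a b (a (r * s) c) d = TensorOver.mk a b (a r (a s c)) d
    rw [map_mul, Module.End.mul_apply]

theorem tensorAct_mk (r : R) (c : C) (d : D) :
    tensorAct a b r (TensorOver.mk a b c d) = TensorOver.mk a b (a r c) d := rfl

end TensorOver

section Stalk

variable {𝕜 : Type*} [RCLike 𝕜] {B : Type*} [NormedAddCommGroup B] [NormedSpace ℝ B]
  [FiniteDimensional ℝ B] {M : Type*} [TopologicalSpace M] [ChartedSpace B M]
  [IsManifold 𝓘(ℝ, B) ∞ M] [T2Space M]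
  {C D : Type*} [AddCommGroup C] [Module 𝕜 C] [AddCommGroup D] [Module 𝕜 D]
  {a : BaseAlg 𝕜 B M →ₙₐ[𝕜] Module.End 𝕜 C} {b : BaseAlg 𝕜 B M →ₙₐ[𝕜] Module.End 𝕜 D}
  {y : M}

theorem map_mem_stalkKer (φ : C →ₗ[𝕜] D) (hφ : ∀ p c, φ (a p c) = b p (φ c)) {c : C}
    (hc : c ∈ stalkKer a y) : φ c ∈ stalkKer b y := by
  obtain ⟨p, hp, hpc⟩ := hc
  exact ⟨p, hp, by rw [← hφ, hpc, map_zero]⟩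

theorem mk_mem_stalkKer_left {c : C} (hc : c ∈ stalkKer a y) (d : D) :
    TensorOver.mk a b c d ∈ stalkKer (tensorAct a b) y :=
  map_mem_stalkKer ((TensorOver.mk a b).flip d) (fun _ _ => rfl) hc

theorem mk_mem_stalkKer_right (c : C) {d : D} (hd : d ∈ stalkKer b y) :
    TensorOver.mk a b c d ∈ stalkKer (tensorAct a b) y :=
  map_mem_stalkKer (TensorOver.mk a b c) (fun p d => TensorOver.mk_act_right a b p c d) hd

end Stalk

section OmegaInjective

variable {𝕜 : Type*} [RCLike 𝕜] {B : Type*} [NormedAddCommGroup B] [NormedSpace ℝ B]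
  {X Y M : Type*} [TopologicalSpace X] [TopologicalSpace Y] [TopologicalSpace M]
  [ChartedSpace B X] [ChartedSpace B Y] [ChartedSpace B M] [T2Space M]
  {f : X → M} (hf : IsLocalDiffeomorph 𝓘(ℝ, B) 𝓘(ℝ, B) ∞ f)
  {g : Y → M} (hg : IsLocalDiffeomorph 𝓘(ℝ, B) 𝓘(ℝ, B) ∞ g)

variable (𝕜) in
/-- The `C_c^∞(M)`-module `C_c^∞(X) ⊗ C_c^∞(Y)`. -/
noncomputable abbrev ccTensorAct :
    BaseAlg 𝕜 B M →ₙₐ[𝕜] Module.End 𝕜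
      (TensorOver (C := Cc 𝕜 B X) (D := Cc 𝕜 B Y) (sheafAct (𝕜 := 𝕜) hf)
        (sheafAct (𝕜 := 𝕜) hg)) :=
  tensorAct (C := Cc 𝕜 B X) (D := Cc 𝕜 B Y) (sheafAct hf) (sheafAct hg)

variable (𝕜) in
/-- The bilinear map `(u, v) ↦ u ⊗ v` for `u ∈ C_c^∞(X)` and `v ∈ C_c^∞(Y)`. -/
noncomputable abbrev ccTensorMk :
    Cc 𝕜 B X →ₗ[𝕜] Cc 𝕜 B Y →ₗ[𝕜]
      TensorOver (C := Cc 𝕜 B X) (D := Cc 𝕜 B Y) (sheafAct (𝕜 := 𝕜) hf)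
        (sheafAct (𝕜 := 𝕜) hg) :=
  TensorOver.mk (C := Cc 𝕜 B X) (D := Cc 𝕜 B Y) (sheafAct hf) (sheafAct hg)

theorem omegaBar_mk (u : Cc 𝕜 B X) (v : Cc 𝕜 B Y) :
    omegaBar hf hg (ccTensorMk 𝕜 hf hg u v) = omega hf hg u v := rfl

theorem omegaBar_tensorAct (p : BaseAlg 𝕜 B M)
    (w : TensorOver (C := Cc 𝕜 B X) (D := Cc 𝕜 B Y) (sheafAct (𝕜 := 𝕜) hf)
      (sheafAct (𝕜 := 𝕜) hg)) :
    omegaBar hf hg (ccTensorAct 𝕜 hf hg p w) =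
      sheafAct (FibreProd.isLocalDiffeomorph_comp_fst hf hg) p (omegaBar hf hg w) := by
  have homega (u : Cc 𝕜 B X) (v : Cc 𝕜 B Y) : omega hf hg (sheafAct hf p u) v =
      sheafAct (FibreProd.isLocalDiffeomorph_comp_fst hf hg) p (omega hf hg u v) := by
    refine Subtype.ext (funext fun q => ?_)
    change germPull _ _ (_ * u.1 q.fst) * germPull _ _ (v.1 q.snd) = _
    rw [germPull_mul, mul_assoc]
    rfl
  exact LinearMap.congr_fun (TensorOver.hom_ext (C := Cc 𝕜 B X) (D := Cc 𝕜 B Y)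
    (φ := omegaBar hf hg ∘ₗ ccTensorAct 𝕜 hf hg p)
    (ψ := sheafAct (FibreProd.isLocalDiffeomorph_comp_fst hf hg) p ∘ₗ omegaBar hf hg) _ _ homega) w

variable [FiniteDimensional ℝ B]

theorem exists_isCompact_sheafAct_eq_self [IsManifold 𝓘(ℝ, B) ∞ X] (u : Cc 𝕜 B X) :
    ∃ K : Set M, IsCompact K ∧ ∀ p : BaseAlg 𝕜 B M, (∀ y ∈ K, p.1 y = 1) →
      sheafAct hf p u = u := by
  let S : Submodule 𝕜 (Cc 𝕜 B X) :=
    { carrier := {u | ∃ K : Set M, IsCompact K ∧ ∀ p : BaseAlg 𝕜 B M, (∀ y ∈ K, p.1 y = 1) →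
        sheafAct hf p u = u}
      add_mem' := by
        rintro u v ⟨K, hK, hu⟩ ⟨L, hL, hv⟩
        refine ⟨K ∪ L, hK.union hL, fun p hp => ?_⟩
        rw [map_add, hu p fun y hy => hp y (Or.inl hy), hv p fun y hy => hp y (Or.inr hy)]
      zero_mem' := ⟨∅, isCompact_empty, fun _ _ => map_zero _⟩
      smul_mem' := by
        rintro c u ⟨K, hK, hu⟩
        exact ⟨K, hK, fun p hp => by rw [map_smul, hu p hp]⟩ }
  have hS : Cc 𝕜 B X ≤ S.map (Cc 𝕜 B X).subtype := by
    refine Cc_le_of_sheafLift_mem hf _ fun V hV hinj q hq =>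
      ⟨sheafLift hf hV hinj q hq, ⟨tsupport q.1, q.2.2, fun p hp => Subtype.ext ?_⟩, rfl⟩
    have hpq : p.1 * q.1 = q.1 := by
      funext z
      by_cases hz : z ∈ tsupport q.1
      · rw [Pi.mul_apply, hp z hz, one_mul]
      · rw [Pi.mul_apply, image_eq_zero_of_notMem_tsupport hz, mul_zero]
    rw [coe_sheafAct_of_eq_extZero hf p rfl, hpq]
    rfl
  obtain ⟨u', hu', huu'⟩ := hS u.2
  exact Subtype.ext huu' ▸ hu'

theorem exists_isCompact_tensorAct_eq_self [IsManifold 𝓘(ℝ, B) ∞ X]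
    (w : TensorOver (C := Cc 𝕜 B X) (D := Cc 𝕜 B Y) (sheafAct (𝕜 := 𝕜) hf)
      (sheafAct (𝕜 := 𝕜) hg)) :
    ∃ K : Set M, IsCompact K ∧ ∀ p : BaseAlg 𝕜 B M, (∀ y ∈ K, p.1 y = 1) →
      ccTensorAct 𝕜 hf hg p w = w := by
  induction w using TensorOver.induction with
  | zero => exact ⟨∅, isCompact_empty, fun p _ => map_zero _⟩
  | add w w' hw hw' =>
    obtain ⟨K, hK, hKw⟩ := hw
    obtain ⟨L, hL, hLw⟩ := hw'
    refine ⟨K ∪ L, hK.union hL, fun p hp => ?_⟩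
    rw [map_add, hKw p fun y hy => hp y (Or.inl hy), hLw p fun y hy => hp y (Or.inr hy)]
  | mk u v =>
    obtain ⟨K, hK, hu⟩ := exists_isCompact_sheafAct_eq_self hf u
    exact ⟨K, hK, fun p hp => by rw [tensorAct_mk, hu p hp]⟩

variable [IsManifold 𝓘(ℝ, B) ∞ M]

variable (𝕜) in
/-- The sums of the elements `localUnit 𝕜 hf x ⊗ v x`, for `x` in the fibre of `f` over `y`. -/
noncomputable def localUnitTensor (y : M) :
    ({x : X // f x = y} →₀ Cc 𝕜 B Y) →ₗ[𝕜]
      TensorOver (C := Cc 𝕜 B X) (D := Cc 𝕜 B Y) (sheafAct (𝕜 := 𝕜) hf)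
        (sheafAct (𝕜 := 𝕜) hg) :=
  Finsupp.lsum 𝕜 fun x => ccTensorMk 𝕜 hf hg (localUnit 𝕜 hf x.1)

theorem localUnitTensor_single {y : M} (x : {x : X // f x = y}) (v : Cc 𝕜 B Y) :
    localUnitTensor 𝕜 hf hg y (Finsupp.single x v) =
      ccTensorMk 𝕜 hf hg (localUnit 𝕜 hf x.1) v :=
  Finsupp.lsum_single _ _ _ _

theorem germPush_omegaBar_localUnitTensor {y : M} (v : {x : X // f x = y} →₀ Cc 𝕜 B Y)
    (x : {x : X // f x = y}) {z : Y} (hz : g z = y) :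
    germPush (FibreProd.isLocalHomeomorph_comp_fst hf hg) (y := ⟨x.1, z, x.2.trans hz.symm⟩) x.2
      ((omegaBar hf hg (localUnitTensor 𝕜 hf hg y v)).1 ⟨x.1, z, x.2.trans hz.symm⟩) =
      germPush hg.isLocalHomeomorph hz ((v x).1 z) := by
  induction v using Finsupp.induction_linear with
  | zero => rw [map_zero, map_zero]; rfl
  | add v v' hv hv' =>
    rw [map_add, map_add, Submodule.coe_add, Pi.add_apply, germPush_add, hv, hv',
      Finsupp.add_apply, Submodule.coe_add, Pi.add_apply, germPush_add]
  | single x' v =>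
    rw [localUnitTensor_single, omegaBar_mk]
    refine (germPush_omegaSection hf hg _ x.2 hz).trans ?_
    rcases eq_or_ne x' x with rfl | hne
    · rw [(isIndicatorAt_localUnit hf x'.1).1, germPush_one, one_mul, Finsupp.single_eq_same]
    · rw [(isIndicatorAt_localUnit hf x'.1).2 x.1 (x.2.trans x'.2.symm)
        fun h => hne (Subtype.ext h.symm), germPush_zero, zero_mul,
        Finsupp.single_eq_of_ne hne.symm]
      rfl

theorem localUnitTensor_mem_stalkKer {y : M} {v : {x : X // f x = y} →₀ Cc 𝕜 B Y}
    (hv : ∀ x, v x ∈ stalkKer (C := Cc 𝕜 B Y) (sheafAct hg) y) :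
    localUnitTensor 𝕜 hf hg y v ∈ stalkKer (ccTensorAct 𝕜 hf hg) y := by
  rw [localUnitTensor, Finsupp.lsum_apply]
  exact Submodule.sum_mem _ fun x _ => mk_mem_stalkKer_right _ (hv x)

variable [IsManifold 𝓘(ℝ, B) ∞ X]

theorem mem_range_localUnitTensor_sup_stalkKer (y : M)
    (w : TensorOver (C := Cc 𝕜 B X) (D := Cc 𝕜 B Y) (sheafAct (𝕜 := 𝕜) hf)
      (sheafAct (𝕜 := 𝕜) hg)) :
    w ∈ LinearMap.range (localUnitTensor 𝕜 hf hg y) ⊔ stalkKer (ccTensorAct 𝕜 hf hg) y := by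
  induction w using TensorOver.induction with
  | zero => exact Submodule.zero_mem _
  | add w w' hw hw' => exact Submodule.add_mem _ hw hw'
  | mk u v =>
    obtain ⟨q, hq⟩ := exists_sub_localUnitComb_mem_vanishNear hf y u
    have hker : u - localUnitComb 𝕜 hf y q ∈ stalkKer (C := Cc 𝕜 B X) (sheafAct hf) y :=
      (mem_stalkKer_iff hf).2 ((mem_vanishNear_iff hf).1 hq)
    have hrange : ccTensorMk 𝕜 hf hg (localUnitComb 𝕜 hf y q) v ∈
        LinearMap.range (localUnitTensor 𝕜 hf hg y) := by
      clear hker hq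
      induction q using Finsupp.induction_linear with
      | zero => rw [map_zero, map_zero]; exact Submodule.zero_mem _
      | add q r hq hr =>
        rw [map_add, map_add]
        exact Submodule.add_mem _ hq hr
      | single x p =>
        refine ⟨Finsupp.single x (sheafAct hg p v), ?_⟩
        rw [localUnitTensor_single, localUnitComb_single]
        exact TensorOver.mk_act_right _ _ p _ v
    rw [← add_sub_cancel (localUnitComb 𝕜 hf y q) u, map_add, LinearMap.add_apply]
    exact Submodule.add_mem_sup hrange (mk_mem_stalkKer_left hker v)

variable [IsManifold 𝓘(ℝ, B) ∞ Y]

theorem mem_stalkKer_of_omegaBar_eq_zero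
    {w : TensorOver (C := Cc 𝕜 B X) (D := Cc 𝕜 B Y) (sheafAct (𝕜 := 𝕜) hf)
      (sheafAct (𝕜 := 𝕜) hg)} (hw : omegaBar hf hg w = 0) (y : M) :
    w ∈ stalkKer (ccTensorAct 𝕜 hf hg) y := by
  obtain ⟨_, ⟨v, rfl⟩, r, hr, rfl⟩ :=
    Submodule.mem_sup.1 (mem_range_localUnitTensor_sup_stalkKer hf hg y w)
  have hΩr : omegaBar hf hg r ∈ stalkKer (C := Cc 𝕜 B (FibreProd hf hg))
      (sheafAct (FibreProd.isLocalDiffeomorph_comp_fst hf hg)) y :=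
    map_mem_stalkKer (D := Cc 𝕜 B (FibreProd hf hg)) (omegaBar hf hg)
      (omegaBar_tensorAct hf hg) hr
  refine Submodule.add_mem _ (localUnitTensor_mem_stalkKer hf hg fun x => ?_) hr
  refine (mem_stalkKer_iff hg).2 fun z hz => ?_
  rw [← germPush_eq_zero_iff hg.isLocalHomeomorph hz,
    ← germPush_omegaBar_localUnitTensor hf hg v x hz, germPush_eq_zero_iff]
  let q : FibreProd hf hg := ⟨x.1, z, x.2.trans hz.symm⟩
  have hsum := congrFun (congrArg Subtype.val hw) q
  rwa [map_add, Submodule.coe_add, Pi.add_apply,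
    (mem_stalkKer_iff (FibreProd.isLocalDiffeomorph_comp_fst hf hg)).1 hΩr q x.2,
    add_zero] at hsum

theorem omegaBar_injective : Function.Injective (omegaBar (𝕜 := 𝕜) hf hg) := by
  rw [injective_iff_map_eq_zero]
  intro w hw
  let I : Submodule 𝕜 (BaseAlg 𝕜 B M) :=
    LinearMap.ker ((LinearMapClass.linearMap (ccTensorAct 𝕜 hf hg)).flip w)
  obtain ⟨K, hK, hKw⟩ := exists_isCompact_tensorAct_eq_self hf hg w
  have hI (p : BaseAlg 𝕜 B M) (hp : p ∈ I) (q : BaseAlg 𝕜 B M) : q * p ∈ I := by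
    change ccTensorAct 𝕜 hf hg (q * p) w = 0
    rw [map_mul, Module.End.mul_apply]
    exact (congrArg _ hp).trans (map_zero _)
  have hloc (y : M) (_ : y ∈ K) : ∃ p ∈ I, ∀ᶠ z in 𝓝 y, p.1 z = 1 :=
    let ⟨p, hp, hpw⟩ := mem_stalkKer_of_omegaBar_eq_zero hf hg hw y
    ⟨p, hpw, hp⟩
  obtain ⟨p, hpw, hp⟩ := exists_mem_eq_one_of_isCompact I hI hK hloc
  exact (hKw p fun y hy => (hp y hy).self_of_nhds).symm.trans hpw

end OmegaInjective

section Indicator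

variable {𝕜 X M : Type*} [RCLike 𝕜] [TopologicalSpace X] {f : X → M}

theorem IsIndicatorAt.eq_on_fibre {u v : ∀ x : X, Germ (𝓝 x) 𝕜} {x : X}
    (hu : IsIndicatorAt f u x) (hv : IsIndicatorAt f v x) {x' : X} (hx' : f x' = f x) :
    u x' = v x' := by
  rcases eq_or_ne x' x with rfl | h
  · rw [hu.1, hv.1]
  · rw [hu.2 x' hx' h, hv.2 x' hx' h]

theorem IsIndicatorAt.congr {u v : ∀ x : X, Germ (𝓝 x) 𝕜} {x : X}
    (hu : IsIndicatorAt f u x) (h : ∀ x', f x' = f x → u x' = v x') : IsIndicatorAt f v x :=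
  ⟨(h x rfl).symm.trans hu.1, fun x' hx' hne => (h x' hx').symm.trans (hu.2 x' hx' hne)⟩

theorem IsIndicatorAt.unique {u : ∀ x : X, Germ (𝓝 x) 𝕜} {x x' : X}
    (hu : IsIndicatorAt f u x) (hu' : IsIndicatorAt f u x') (h : f x = f x') : x = x' := by
  by_contra hne
  exact germ_zero_ne_one x ((hu'.2 x h hne).symm.trans hu.1)

end Indicator

section SheafSpectrum

variable {𝕜 : Type*} [RCLike 𝕜] {B : Type*} [NormedAddCommGroup B] [NormedSpace ℝ B]
  {X M : Type*} [TopologicalSpace X] [TopologicalSpace M] [ChartedSpace B X] [ChartedSpace B M]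
  {f : X → M} (hf : IsLocalDiffeomorph 𝓘(ℝ, B) 𝓘(ℝ, B) ∞ f)

variable [FiniteDimensional ℝ B] [IsManifold 𝓘(ℝ, B) ∞ X]

section PushforwardEqOne

theorem pushforward_apply_of_isIndicatorAt {c : Cc 𝕜 B X} {x : X} (h : IsIndicatorAt f c.1 x) :
    (pushforward hf c).1 (f x) = 1 := by
  change ∑ᶠ x' : {x' // f x' = f x}, germPush hf.isLocalHomeomorph x'.2 (c.1 x'.1) = 1
  rw [finsum_eq_single _ (⟨x, rfl⟩ : {x' // f x' = f x}), h.1, germPush_one]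
  intro x' hx'
  rw [h.2 x'.1 x'.2 fun e => hx' (Subtype.ext e), germPush_zero]

variable {hf}

theorem IsDiagProdAt.eq_of_pushforward_eq_one {c : Cc 𝕜 B X} {v : ∀ x : X, Germ (𝓝 x) 𝕜} {y : M}
    (h : IsDiagProdAt hf y c.1 c.1 v) (hc : (pushforward hf c).1 y = 1) {x : X} (hx : f x = y) :
    v x = c.1 x := by
  have hsum := finsum_mul' (fun x : {x // f x = y} => germPush hf.isLocalHomeomorph x.2 (c.1 x.1))
    (germPush hf.isLocalHomeomorph hx (v x)) (hasFiniteSupport _ c.2 y)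
  rw [show ∑ᶠ x : {x // f x = y}, germPush hf.isLocalHomeomorph x.2 (c.1 x.1) = 1 from hc, one_mul,
    finsum_eq_single _ (⟨x, hx⟩ : {x // f x = y}) fun x' hx' =>
      h.mul_of_ne x'.1 x x'.2 hx fun e => hx' (Subtype.ext e),
    ← germPush_mul, h.mul_self x hx] at hsum
  exact germPush_injective hf.isLocalHomeomorph hx hsum

theorem IsDiagProdAt.exists_isIndicatorAt [T2Space M] {c : Cc 𝕜 B X}
    {v : ∀ x : X, Germ (𝓝 x) 𝕜} {y : M} (h : IsDiagProdAt hf y c.1 c.1 v)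
    (hc : (pushforward hf c).1 y = 1) :
    ∃ x, f x = y ∧ IsIndicatorAt f c.1 x ∧ IsIndicatorAt f v x := by
  have hv {x : X} (hx : f x = y) : v x = c.1 x := h.eq_of_pushforward_eq_one hc hx
  obtain ⟨x, hx, hx0⟩ : ∃ x, f x = y ∧ c.1 x ≠ 0 := by
    by_contra! h0
    have hsum : ∑ᶠ x : {x // f x = y}, germPush hf.isLocalHomeomorph x.2 (c.1 x.1) = 0 :=
      finsum_eq_zero_of_forall_eq_zero fun x => by rw [h0 x.1 x.2, germPush_zero]
    exact germ_zero_ne_one y (hsum.symm.trans hc)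
  have hx1 : c.1 x = 1 := by
    refine (Cc.germ_eq_zero_or_one_of_mul_self hf ?_).resolve_left hx0
    exact (congrArg (c.1 x * ·) (hv hx).symm).trans (h.mul_self x hx)
  have hvx : IsIndicatorAt f v x := by
    refine ⟨(hv hx).trans hx1, fun x' hx' hne => ?_⟩
    have hmul := h.mul_of_ne x x' hx (hx'.trans hx) hne.symm
    rwa [hx1, germPush_one, one_mul, germPush_eq_zero_iff] at hmul
  exact ⟨x, hx, hvx.congr fun x' hx' => hv (hx'.trans hx), hvx⟩

end PushforwardEqOne

variable [IsManifold 𝓘(ℝ, B) ∞ M] [T2Space M]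

omit [FiniteDimensional ℝ B] [IsManifold 𝓘(ℝ, B) ∞ M] in
theorem ofBase_apply (p : BaseAlg 𝕜 B M) (y : M) : (ofBase p).1 y = (p.1 : Germ (𝓝 y) 𝕜) :=
  extZero_of_mem _ (mem_univ y)

theorem ofBase_toBase (u : Cc 𝕜 B M) : ofBase (toBase u) = u := by
  have hid : IsLocalDiffeomorph 𝓘(ℝ, B) 𝓘(ℝ, B) ∞ (id : M → M) :=
    (Diffeomorph.refl 𝓘(ℝ, B) M ∞).isLocalDiffeomorph
  refine Subtype.ext (funext fun y => ?_)
  obtain ⟨p, hp⟩ := exists_baseAlg_germ hid u y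
  have hnear : (u - ofBase p).1 ∈ vanishNear 𝕜 id y := (mem_vanishNear_iff hid).2 <| by
    rintro _ rfl
    exact sub_eq_zero.2 (hp.trans (ofBase_apply p _).symm)
  rw [hp, ofBase_apply]
  refine Germ.coe_eq.2 ?_
  filter_upwards [hnear] with z hz
  have huz : u.1 z = (p.1 : Germ (𝓝 z) 𝕜) := (sub_eq_zero.1 (hz z rfl)).trans (ofBase_apply p z)
  exact congrArg Germ.value huz

variable (𝕜) in
/-- The coalgebra `C_c^∞(X)` of a sheaf `f : X → M`. -/
noncomputable def sheafCoalgebra : CoalgebraOps 𝕜 B M (Cc 𝕜 B X) where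
  act := sheafAct hf
  comul u := Function.invFun (omegaBar hf hf)
    (pushforward (FibreProd.isLocalDiffeomorph_diag hf) u)
  counit u := toBase (pushforward hf u)

theorem omegaBar_comul (w : Cc 𝕜 B X) :
    omegaBar hf hf ((sheafCoalgebra 𝕜 hf).comul w) =
      pushforward (FibreProd.isLocalDiffeomorph_diag hf) w :=
  Function.invFun_eq (pushforward_diag_mem_range_omegaBar hf w)

theorem comul_eq_tmul_iff (w u v : Cc 𝕜 B X) :
    (sheafCoalgebra 𝕜 hf).comul w = TensorOver.tmul (C := Cc 𝕜 B X) (D := Cc 𝕜 B X)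
      (sheafCoalgebra 𝕜 hf).act (sheafCoalgebra 𝕜 hf).act u v ↔
      ∀ y, IsDiagProdAt hf y w.1 u.1 v.1 := by
  rw [← omega_eq_pushforward_diag_iff, ← omegaBar_comul]
  exact (omegaBar_injective hf hf).eq_iff.symm.trans eq_comm

theorem normalizedAt_sheafCoalgebra_iff (c : Cc 𝕜 B X) (y : M) :
    NormalizedAt (sheafCoalgebra 𝕜 hf) c y ↔ (pushforward hf c).1 y = 1 := by
  rw [← ofBase_toBase (pushforward hf c), ofBase_apply]
  exact Germ.coe_eq.symm

theorem IsIndicatorAt.normalizedAt {c : Cc 𝕜 B X} {x : X} (h : IsIndicatorAt f c.1 x) :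
    NormalizedAt (sheafCoalgebra 𝕜 hf) c (f x) :=
  (normalizedAt_sheafCoalgebra_iff hf c (f x)).2 (pushforward_apply_of_isIndicatorAt hf h)

end SheafSpectrum

section SheafSpectrum

variable {𝕜 : Type*} [RCLike 𝕜] {B : Type*} [NormedAddCommGroup B] [NormedSpace ℝ B]
  [FiniteDimensional ℝ B] {X M : Type*} [TopologicalSpace X] [TopologicalSpace M]
  [ChartedSpace B X] [ChartedSpace B M] [IsManifold 𝓘(ℝ, B) ∞ X] [IsManifold 𝓘(ℝ, B) ∞ M]
  [T2Space M] {f : X → M} (hf : IsLocalDiffeomorph 𝓘(ℝ, B) 𝓘(ℝ, B) ∞ f)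

section StalkEval

/-- The evaluation of the localization of `C_c^∞(X)` at `y` at a point of the fibre of `f`
over `y`. -/
noncomputable def stalkEval {x : X} {y : M} (h : f x = y) :
    Stalk (C := Cc 𝕜 B X) (sheafAct hf) y →ₗ[𝕜] Germ (𝓝 y) 𝕜 :=
  (stalkKer (C := Cc 𝕜 B X) (sheafAct hf) y).liftQ
    { toFun := fun u => germPush hf.isLocalHomeomorph h (u.1 x)
      map_add' := fun _ _ => germPush_add _ _ _ _
      map_smul' := fun _ _ => germPush_smul _ _ _ _ }
    fun _ hu => (germPush_eq_zero_iff hf.isLocalHomeomorph h).2 ((mem_stalkKer_iff hf).1 hu x h)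

theorem stalkEval_stalkAct {x : X} {y : M} (h : f x = y) (p : BaseAlg 𝕜 B M)
    (ζ : Stalk (C := Cc 𝕜 B X) (sheafAct hf) y) :
    stalkEval hf h (stalkAct (C := Cc 𝕜 B X) (sheafAct hf) y p ζ) =
      (p.1 : Germ (𝓝 y) 𝕜) * stalkEval hf h ζ := by
  obtain ⟨u, rfl⟩ := (stalkKer (C := Cc 𝕜 B X) (sheafAct hf) y).mkQ_surjective ζ
  change germPush hf.isLocalHomeomorph h (((p.1 ∘ f : X → 𝕜) : Germ (𝓝 x) 𝕜) * u.1 x) =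
    _ * germPush hf.isLocalHomeomorph h (u.1 x)
  rw [germPush_mul, germPush_comp]

/-- The evaluation of the tensor square of the localization of `C_c^∞(X)` at `y` at a pair of points
of the fibre of `f` over `y`. -/
noncomputable def stalkTensorEval {x x' : X} {y : M} (h : f x = y) (h' : f x' = y) :
    TensorOver (C := Stalk (C := Cc 𝕜 B X) (sheafAct hf) y)
      (D := Stalk (C := Cc 𝕜 B X) (sheafAct hf) y)
      (stalkAct (C := Cc 𝕜 B X) (sheafAct hf) y) (stalkAct (C := Cc 𝕜 B X) (sheafAct hf) y) →ₗ[𝕜]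
      Germ (𝓝 y) 𝕜 :=
  TensorOver.lift _ _
    (LinearMap.mk₂ 𝕜 (fun ζ ξ => stalkEval hf h ζ * stalkEval hf h' ξ)
      (fun _ _ _ => by rw [map_add, add_mul]) (fun _ _ _ => by rw [map_smul, germ_smul_mul])
      (fun _ _ _ => by rw [map_add, mul_add]) (fun _ _ _ => by rw [map_smul, germ_mul_smul]))
    fun p ζ ξ => by
      rw [LinearMap.mk₂_apply, LinearMap.mk₂_apply, stalkEval_stalkAct, stalkEval_stalkAct,
        mul_assoc, mul_left_comm]

theorem stalkTensorEval_tensorToStalk {y : M} (q : FibreProd hf hf) (h : f q.fst = y)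
    (h' : f q.snd = y)
    (w : TensorOver (C := Cc 𝕜 B X) (D := Cc 𝕜 B X) (sheafAct (𝕜 := 𝕜) hf)
      (sheafAct (𝕜 := 𝕜) hf)) :
    stalkTensorEval hf h h' (tensorToStalk (C := Cc 𝕜 B X) (sheafAct hf) y w) =
      germPush (FibreProd.isLocalHomeomorph_comp_fst hf hf) h ((omegaBar hf hf w).1 q) := by
  let evalAt : Cc 𝕜 B (FibreProd hf hf) →ₗ[𝕜] Germ (𝓝 y) 𝕜 :=
    { toFun := fun u => germPush (FibreProd.isLocalHomeomorph_comp_fst hf hf) h (u.1 q)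
      map_add' := fun _ _ => germPush_add _ _ _ _
      map_smul' := fun _ _ => germPush_smul _ _ _ _ }
  exact LinearMap.congr_fun (TensorOver.hom_ext (C := Cc 𝕜 B X) (D := Cc 𝕜 B X)
    (φ := stalkTensorEval hf h h' ∘ₗ tensorToStalk (C := Cc 𝕜 B X) (sheafAct hf) y)
    (ψ := evalAt ∘ₗ omegaBar hf hf) _ _
    fun _ _ => (germPush_omegaSection hf hf q h h').symm) w

theorem isDiagProdAt_of_tensorToStalk_comul {c : Cc 𝕜 B X} {y : M}
    (h : tensorToStalk (C := Cc 𝕜 B X) (sheafAct hf) y ((sheafCoalgebra 𝕜 hf).comul c) =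
      TensorOver.tmul _ _ (toStalk (C := Cc 𝕜 B X) (sheafAct hf) y c)
        (toStalk (C := Cc 𝕜 B X) (sheafAct hf) y c)) :
    IsDiagProdAt hf y c.1 c.1 c.1 := by
  refine (isDiagProdAt_iff_germPush hf).2 fun q hx hx' => ?_
  rw [← omegaBar_comul]
  exact (stalkTensorEval_tensorToStalk hf q hx hx' _).symm.trans
    (congrArg (stalkTensorEval hf hx hx') h)

end StalkEval

section Grouplike

theorem classAt_sheafCoalgebra_eq_iff {c d : Cc 𝕜 B X} {y z : M} :
    classAt (sheafCoalgebra 𝕜 hf) c y = classAt (sheafCoalgebra 𝕜 hf) d z ↔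
      y = z ∧ ∀ x, f x = y → c.1 x = d.1 x := by
  constructor
  · intro h
    obtain rfl : y = z := congrArg Sigma.fst h
    exact ⟨rfl, (toStalk_sheafAct_eq_iff hf).1 (eq_of_heq (Sigma.mk.inj h).2)⟩
  · rintro ⟨rfl, h⟩
    exact congrArg (Sigma.mk y) ((toStalk_sheafAct_eq_iff hf).2 h)

theorem sheafLift_mem_weaklyGrouplike {U : Set X} (hU : IsOpen U) (hinj : InjOn f U)
    {p : BaseAlg 𝕜 B M} (hp : tsupport p.1 ⊆ f '' U) :
    sheafLift hf hU hinj p hp ∈ weaklyGrouplike (sheafCoalgebra 𝕜 hf) := by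
  obtain ⟨q, hq1, hq⟩ := exists_baseAlg_eq_one_on_subset (𝕜 := 𝕜) (B := B) p.2.2
    (hf.isLocalHomeomorph.isOpenMap _ hU) hp
  exact ⟨sheafLift hf hU hinj q hq, (comul_eq_tmul_iff hf _ _ _).2
    (isDiagProdAt_sheafLift hf hU hinj hp hq fun z hz => (hq1 z hz).self_of_nhds)⟩

theorem toStalk_mem_grouplike {c : Cc 𝕜 B X} (hc : c ∈ weaklyGrouplike (sheafCoalgebra 𝕜 hf))
    {y : M} (hy : NormalizedAt (sheafCoalgebra 𝕜 hf) c y) :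
    toStalk (sheafCoalgebra 𝕜 hf).act y c ∈ grouplike (sheafCoalgebra 𝕜 hf) y := by
  obtain ⟨c', hc'⟩ := hc
  obtain ⟨x, rfl, hx, hx'⟩ := ((comul_eq_tmul_iff hf _ _ _).1 hc' y).exists_isIndicatorAt
    ((normalizedAt_sheafCoalgebra_iff hf c y).1 hy)
  have hclass : toStalk (sheafCoalgebra 𝕜 hf).act (f x) c' =
      toStalk (sheafCoalgebra 𝕜 hf).act (f x) c :=
    (toStalk_sheafAct_eq_iff hf).2 fun _ h => hx'.eq_on_fibre hx h
  refine ⟨c, rfl, ?_, hy⟩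
  rw [hc']
  change TensorOver.tmul _ _ (toStalk (sheafCoalgebra 𝕜 hf).act (f x) c)
    (toStalk (sheafCoalgebra 𝕜 hf).act (f x) c') = _
  rw [hclass]

include hf in
theorem isOpen_isIndicatorAt (c : Cc 𝕜 B X) : IsOpen {x | IsIndicatorAt f c.1 x} := by
  have hc := hf.isLocalHomeomorph.continuous
  rw [isOpen_iff_eventually]
  intro x hx
  have hnear : (localUnit 𝕜 hf x - c).1 ∈ vanishNear 𝕜 f (f x) :=
    (mem_vanishNear_iff hf).2 fun x' hx' =>
      sub_eq_zero.2 ((isIndicatorAt_localUnit hf x).eq_on_fibre hx hx')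
  filter_upwards [(hf.isLocalHomeomorph.localInverseAt x).open_target.mem_nhds
      hf.isLocalHomeomorph.self_mem_localInverseAt_target, hc.continuousAt.eventually hnear,
    hc.continuousAt.eventually
      (eventually_eventually_nhds.2 (exists_localBump 𝕜 hf x).choose_spec.1)] with x' hmem h0 h1
  exact (isIndicatorAt_extZero hc hf.isLocalHomeomorph.injOn_localInverseAt_target hmem h1).congr
    fun x'' hx'' => sub_eq_zero.1 (h0 x'' hx'')

end Grouplike

section EspHomeomorph

theorem localUnit_mem_weaklyGrouplike (x : X) :
    localUnit 𝕜 hf x ∈ weaklyGrouplike (sheafCoalgebra 𝕜 hf) :=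
  sheafLift_mem_weaklyGrouplike hf _ _ _

variable (𝕜) in
/-- The point of the spectral sheaf of `C_c^∞(X)` that corresponds to a point of `X`. -/
noncomputable def espPoint (x : X) : Esp (sheafCoalgebra 𝕜 hf) :=
  ⟨classAt (sheafCoalgebra 𝕜 hf) (localUnit 𝕜 hf x) (f x),
    toStalk_mem_grouplike hf (localUnit_mem_weaklyGrouplike hf x)
      ((isIndicatorAt_localUnit hf x).normalizedAt hf)⟩

theorem espPoint_eq_classAt_iff {c : Cc 𝕜 B X} {x : X} {y : M} :
    (espPoint 𝕜 hf x).1 = classAt (sheafCoalgebra 𝕜 hf) c y ↔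
      f x = y ∧ IsIndicatorAt f c.1 x :=
  (classAt_sheafCoalgebra_eq_iff hf).trans <| and_congr_right fun _ =>
    ⟨(isIndicatorAt_localUnit hf x).congr, fun h _ => (isIndicatorAt_localUnit hf x).eq_on_fibre h⟩

theorem espPoint_injective : Function.Injective (espPoint 𝕜 hf) := by
  intro x x' h
  obtain ⟨hxx', hx⟩ := (espPoint_eq_classAt_iff hf).1 (congrArg Subtype.val h)
  exact hx.unique (isIndicatorAt_localUnit hf x') hxx'

theorem espPoint_surjective : Function.Surjective (espPoint 𝕜 hf) := by
  rintro ⟨⟨y, ζ⟩, c, hζ, hc, hy⟩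
  obtain rfl : toStalk (sheafCoalgebra 𝕜 hf).act y c = ζ := hζ
  obtain ⟨x, hx, hcx, -⟩ := (isDiagProdAt_of_tensorToStalk_comul hf hc).exists_isIndicatorAt
    ((normalizedAt_sheafCoalgebra_iff hf c y).1 hy)
  exact ⟨x, Subtype.ext ((espPoint_eq_classAt_iff hf).2 ⟨hx, hcx⟩)⟩

theorem espPoint_mem_basicSet_iff {c : Cc 𝕜 B X} {W : Set M} {x : X} :
    espPoint 𝕜 hf x ∈ basicSet (sheafCoalgebra 𝕜 hf) c W ↔ f x ∈ W ∧ IsIndicatorAt f c.1 x := by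
  constructor
  · rintro ⟨y, hy, h⟩
    obtain ⟨rfl, hx⟩ := (espPoint_eq_classAt_iff hf).1 h
    exact ⟨hy, hx⟩
  · exact fun ⟨hy, hx⟩ => ⟨f x, hy, (espPoint_eq_classAt_iff hf).2 ⟨rfl, hx⟩⟩

theorem continuous_espPoint : Continuous (espPoint 𝕜 hf) := by
  refine continuous_generateFrom_iff.2 ?_
  rintro _ ⟨c, W, -, hW, -, rfl⟩
  have hpre : espPoint 𝕜 hf ⁻¹' basicSet (sheafCoalgebra 𝕜 hf) c W =
      f ⁻¹' W ∩ {x | IsIndicatorAt f c.1 x} :=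
    Set.ext fun x => espPoint_mem_basicSet_iff hf
  rw [hpre]
  exact (hW.preimage hf.isLocalHomeomorph.continuous).inter (isOpen_isIndicatorAt hf c)

theorem isOpenMap_espPoint : IsOpenMap (espPoint 𝕜 hf) := by
  intro V hV
  rw [isOpen_iff_mem_nhds]
  rintro _ ⟨x, hx, rfl⟩
  let c := localUnit 𝕜 hf x
  have hc : IsIndicatorAt f c.1 x := isIndicatorAt_localUnit hf x
  let N : Set X := V ∩ {x | IsIndicatorAt f c.1 x}
  have hfN : IsOpen (f '' N) :=
    hf.isLocalHomeomorph.isOpenMap _ (hV.inter (isOpen_isIndicatorAt hf c))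
  have hopen : IsOpen (basicSet (sheafCoalgebra 𝕜 hf) c (f '' N)) := by
    refine TopologicalSpace.isOpen_generateFrom_of_mem
      ⟨c, f '' N, localUnit_mem_weaklyGrouplike hf x, hfN, ?_, rfl⟩
    rintro _ ⟨x', hx', rfl⟩
    exact hx'.2.normalizedAt hf
  have hmem : espPoint 𝕜 hf x ∈ basicSet (sheafCoalgebra 𝕜 hf) c (f '' N) :=
    (espPoint_mem_basicSet_iff hf).2 ⟨mem_image_of_mem f ⟨hx, hc⟩, hc⟩
  refine Filter.mem_of_superset (hopen.mem_nhds hmem) ?_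
  rintro p ⟨_, ⟨x', hx', rfl⟩, hp⟩
  exact ⟨x', hx'.1, Subtype.ext (((espPoint_eq_classAt_iff hf).2 ⟨rfl, hx'.2⟩).trans hp.symm)⟩

variable (𝕜) in
/-- The canonical homeomorphism between a sheaf and the spectral sheaf of its coalgebra. -/
noncomputable def espHomeomorph : X ≃ₜ Esp (sheafCoalgebra 𝕜 hf) :=
  (Equiv.ofBijective _ ⟨espPoint_injective hf, espPoint_surjective hf⟩).toHomeomorphOfContinuousOpen
    (continuous_espPoint hf) (isOpenMap_espPoint hf)

end EspHomeomorph

end SheafSpectrum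

section PushIndicator

variable {𝕜 : Type*} [RCLike 𝕜] {X Y M : Type*} [TopologicalSpace X] [TopologicalSpace Y]

theorem IsIndicatorAt.pushSection {f : X → M} {g : Y → M} {φ : X → Y} (hφ : IsLocalHomeomorph φ)
    (hcomp : ∀ x, g (φ x) = f x) {u : ∀ x : X, Germ (𝓝 x) 𝕜} {x : X} (h : IsIndicatorAt f u x) :
    IsIndicatorAt g (pushSection hφ u) (φ x) := by
  have hu {y : Y} (hy : g y = g (φ x)) (x' : {x' // φ x' = y}) (hne : x'.1 ≠ x) :
      germPush hφ x'.2 (u x'.1) = 0 := by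
    have hfibre : f x'.1 = f x := by rw [← hcomp, ← hcomp, x'.2, hy]
    rw [h.2 x'.1 hfibre hne, germPush_zero]
  refine ⟨?_, fun y hy hne => ?_⟩
  · have hsum : SpectralGroupoid.pushSection hφ u (φ x) = germPush hφ rfl (u x) :=
      finsum_eq_single _ (⟨x, rfl⟩ : {x' // φ x' = φ x}) fun x' hx' =>
        hu rfl x' fun e => hx' (Subtype.ext e)
    rw [hsum, h.1, germPush_one]
  · refine finsum_eq_zero_of_forall_eq_zero fun x' => hu hy x' ?_
    rintro rfl
    exact hne x'.2.symm

theorem germPush_germPush [TopologicalSpace M] {φ : X → Y} {ψ : Y → M} {χ : X → M}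
    (hφ : IsLocalHomeomorph φ) (hψ : IsLocalHomeomorph ψ) (hχ : IsLocalHomeomorph χ)
    (hcomp : ψ ∘ φ = χ) {x : X} {y : Y} {z : M} (hxy : φ x = y) (hyz : ψ y = z) (hxz : χ x = z)
    (γ : Germ (𝓝 x) 𝕜) : germPush hψ hyz (germPush hφ hxy γ) = germPush hχ hxz γ := by
  obtain ⟨k, rfl⟩ := exists_germ_eq_comp hχ γ
  subst hcomp
  rw [germPush_comp hχ, ← Function.comp_assoc, germPush_comp, germPush_comp]

end PushIndicator

section OmegaIndicator

variable {𝕜 : Type*} [RCLike 𝕜] {B : Type*} [NormedAddCommGroup B] [NormedSpace ℝ B]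
  {X Y M N : Type*} [TopologicalSpace X] [TopologicalSpace Y] [TopologicalSpace M]
  [ChartedSpace B X] [ChartedSpace B Y] [ChartedSpace B M]
  {f : X → M} (hf : IsLocalDiffeomorph 𝓘(ℝ, B) 𝓘(ℝ, B) ∞ f)
  {g : Y → M} (hg : IsLocalDiffeomorph 𝓘(ℝ, B) 𝓘(ℝ, B) ∞ g)

theorem IsIndicatorAt.omegaSection {k : X → N} {u : ∀ x : X, Germ (𝓝 x) 𝕜}
    {v : ∀ y : Y, Germ (𝓝 y) 𝕜} {q : FibreProd hf hg} (hu : IsIndicatorAt k u q.fst)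
    (hv : IsIndicatorAt g v q.snd) :
    IsIndicatorAt (k ∘ FibreProd.fst) (omegaSection hf hg u v) q := by
  refine ⟨?_, fun q' hq' hne => ?_⟩
  · rw [SpectralGroupoid.omegaSection, hu.1, hv.1]
    exact mul_one _
  · rw [SpectralGroupoid.omegaSection]
    by_cases hfst : q'.fst = q.fst
    · have hg' : g q'.snd = g q.snd := by rw [← q'.comm, hfst, q.comm]
      rw [hv.2 _ hg' fun hsnd => hne (FibreProd.ext hfst hsnd)]
      exact mul_zero _
    · rw [hu.2 _ hq' hfst]
      exact zero_mul _

end OmegaIndicator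

section GroupoidLaws

theorem GroupoidOps.mul_congr {M X : Type*} {Γ : GroupoidOps M X} {g g' h h' : X}
    (e : Γ.src g = Γ.tgt h) (e' : Γ.src g' = Γ.tgt h') (hg : g = g') (hh : h = h') :
    Γ.mul g h e = Γ.mul g' h' e' := by
  subst hg hh
  rfl

variable {B : Type*} [NormedAddCommGroup B] [NormedSpace ℝ B] {M X : Type*}
  [TopologicalSpace M] [ChartedSpace B M] [TopologicalSpace X] [ChartedSpace B X]
  {Γ : GroupoidOps M X} (hΓ : IsEtaleLieGroupoid B Γ)

include hΓ

namespace IsEtaleLieGroupoid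

theorem inv_mul_cancel_left (g h : X) (e : Γ.src g = Γ.tgt h) :
    Γ.mul (Γ.inv g) (Γ.mul g h e) ((hΓ.src_inv g).trans (hΓ.tgt_mul g h e).symm) = h := by
  rw [← hΓ.mul_assoc (Γ.inv g) g h (hΓ.src_inv g) e]
  have hinv : Γ.mul (Γ.inv g) g (hΓ.src_inv g) = Γ.unit (Γ.tgt h) := by rw [hΓ.inv_mul, e]
  exact (GroupoidOps.mul_congr _ (hΓ.src_unit _) hinv rfl).trans (hΓ.unit_mul h)

theorem mul_left_cancel {g h h' : X} (e : Γ.src g = Γ.tgt h) (e' : Γ.src g = Γ.tgt h')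
    (hmul : Γ.mul g h e = Γ.mul g h' e') : h = h' := by
  rw [← hΓ.inv_mul_cancel_left g h e, ← hΓ.inv_mul_cancel_left g h' e']
  exact GroupoidOps.mul_congr _ _ rfl hmul

theorem inv_inv (g : X) : Γ.inv (Γ.inv g) = g := by
  refine hΓ.mul_left_cancel (g := Γ.inv g) (hΓ.tgt_inv _).symm (hΓ.src_inv g) ?_
  rw [hΓ.mul_inv, hΓ.inv_mul, hΓ.tgt_inv]

theorem inv_injective : Function.Injective Γ.inv :=
  Function.LeftInverse.injective hΓ.inv_inv

end IsEtaleLieGroupoid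

end GroupoidLaws

section GroupoidAlgebra

variable {𝕜 : Type*} [RCLike 𝕜] {B : Type*} [NormedAddCommGroup B] [NormedSpace ℝ B]
  [FiniteDimensional ℝ B] {M : Type*} [TopologicalSpace M] [ChartedSpace B M]
  [IsManifold 𝓘(ℝ, B) ∞ M] [T2Space M] {G : EtaleLieGroupoid B M}

theorem isIndicatorAt_hopf_incl {y : M} {p : BaseAlg 𝕜 B M} (hp : ∀ᶠ z in 𝓝 y, p.1 z = 1) :
    IsIndicatorAt G.ops.tgt ((hopf 𝕜 G).incl p).1 (G.ops.unit y) := by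
  have hid : IsIndicatorAt id (ofBase p).1 y :=
    ⟨(ofBase_apply p y).trans (Germ.coe_eq.2 hp), fun _ hz hne => (hne hz).elim⟩
  exact hid.pushSection G.isEtale.unit_loc.isLocalHomeomorph G.isEtale.tgt_unit

theorem isIndicatorAt_hopf_mul {b a : Cc 𝕜 B G.Arr} {g h : G.Arr}
    (e : G.ops.src g = G.ops.tgt h) (hb : IsIndicatorAt G.ops.tgt b.1 g)
    (ha : IsIndicatorAt G.ops.tgt a.1 h) :
    IsIndicatorAt G.ops.tgt ((hopf 𝕜 G).mul b a).1 (G.ops.mul g h e) :=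
  (IsIndicatorAt.omegaSection G.isEtale.src_loc G.isEtale.tgt_loc (q := ⟨g, h, e⟩)
    hb ha).pushSection G.isEtale.mul_loc.isLocalHomeomorph fun q => G.isEtale.tgt_mul _ _ q.comm

omit [IsManifold 𝓘(ℝ, B) ∞ M] [T2Space M] in
theorem isIndicatorAt_pushforward {H : EtaleLieGroupoid B M} {φ : G.Arr → H.Arr}
    (hφ : IsGroupoidMorphism B G.ops H.ops φ) {c : Cc 𝕜 B G.Arr} {g : G.Arr}
    (hc : IsIndicatorAt G.ops.tgt c.1 g) :
    IsIndicatorAt H.ops.tgt (pushforward hφ.isLocalDiffeomorph c).1 (φ g) :=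
  hc.pushSection hφ.isLocalDiffeomorph.isLocalHomeomorph hφ.tgt_eq

theorem antipode_apply (u : Cc 𝕜 B G.Arr) {g k : G.Arr} (h : G.ops.inv g = k) :
    ((hopf 𝕜 G).antipode u).1 k = germPush G.isEtale.inv_loc.isLocalHomeomorph h (u.1 g) := by
  refine finsum_eq_single _ (⟨g, h⟩ : {g' // G.ops.inv g' = k}) fun g' hg' => ?_
  exact (hg' (Subtype.ext (G.isEtale.inv_injective (g'.2.trans h.symm)))).elim

theorem germPush_antipode (u : Cc 𝕜 B G.Arr) {g : G.Arr} {y : M} (h : G.ops.src g = y)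
    (h' : G.ops.tgt (G.ops.inv g) = y) :
    germPush G.isEtale.tgt_loc.isLocalHomeomorph h' (((hopf 𝕜 G).antipode u).1 (G.ops.inv g)) =
      germPush G.isEtale.src_loc.isLocalHomeomorph h (u.1 g) := by
  rw [antipode_apply u rfl]
  exact germPush_germPush _ _ _ (funext G.isEtale.tgt_inv) _ _ _ _

theorem isDiagProdAt_antipode_iff {w u v : Cc 𝕜 B G.Arr} {y : M} :
    IsDiagProdAt G.isEtale.tgt_loc y ((hopf 𝕜 G).antipode w).1 ((hopf 𝕜 G).antipode u).1
      ((hopf 𝕜 G).antipode v).1 ↔ IsDiagProdAt G.isEtale.src_loc y w.1 u.1 v.1 := by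
  have htgt {g : G.Arr} (h : G.ops.src g = y) : G.ops.tgt (G.ops.inv g) = y :=
    (G.isEtale.tgt_inv g).trans h
  have hsrc {g : G.Arr} (h : G.ops.tgt (G.ops.inv g) = y) : G.ops.src g = y :=
    (G.isEtale.tgt_inv g).symm.trans h
  have hsurj : Function.Surjective G.ops.inv := Function.RightInverse.surjective G.isEtale.inv_inv
  constructor
  · refine fun h => ⟨fun g hg => germPush_injective G.isEtale.src_loc.isLocalHomeomorph hg ?_,
      fun g g' hg hg' hne => ?_⟩
    · rw [germPush_mul, ← germPush_antipode u hg (htgt hg), ← germPush_antipode v hg (htgt hg),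
        ← germPush_antipode w hg (htgt hg), ← germPush_mul, h.mul_self _ (htgt hg)]
    · rw [← germPush_antipode u hg (htgt hg), ← germPush_antipode v hg' (htgt hg')]
      exact h.mul_of_ne _ _ _ _ (G.isEtale.inv_injective.ne hne)
  · refine fun h => ⟨fun k hk => germPush_injective G.isEtale.tgt_loc.isLocalHomeomorph hk ?_,
      fun k k' hk hk' hne => ?_⟩
    · obtain ⟨g, rfl⟩ := hsurj k
      rw [germPush_mul, germPush_antipode u (hsrc hk), germPush_antipode v (hsrc hk),
        germPush_antipode w (hsrc hk), ← germPush_mul, h.mul_self _ (hsrc hk)]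
    · obtain ⟨g, rfl⟩ := hsurj k
      obtain ⟨g', rfl⟩ := hsurj k'
      rw [germPush_antipode u (hsrc hk), germPush_antipode v (hsrc hk')]
      exact h.mul_of_ne _ _ _ _ (ne_of_apply_ne _ hne)

theorem exists_isIndicatorAt_of_invariant {a : Cc 𝕜 B G.Arr}
    (ha : a ∈ invariantWeaklyGrouplike (hopf 𝕜 G)) {y : M}
    (hn : NormalizedAt (hopf 𝕜 G).toCoalgebraOps a y) :
    ∃ g, G.ops.tgt g = y ∧ IsIndicatorAt G.ops.tgt a.1 g ∧ IsIndicatorAt G.ops.src a.1 g := by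
  obtain ⟨a', ha', hSa⟩ := ha
  have htgt := (comul_eq_tmul_iff G.isEtale.tgt_loc a a a').1 ha' y
  have hsrc (z : M) : IsDiagProdAt G.isEtale.src_loc z a.1 a'.1 a.1 :=
    isDiagProdAt_antipode_iff.1 ((comul_eq_tmul_iff G.isEtale.tgt_loc _ _ _).1 hSa z)
  obtain ⟨g, hg, hag, ha'g⟩ :=
    htgt.exists_isIndicatorAt ((normalizedAt_sheafCoalgebra_iff G.isEtale.tgt_loc a y).1 hn)
  refine ⟨g, hg, hag, hag.1, fun k hk hne => ?_⟩
  have hmul := (hsrc _).mul_of_ne g k rfl hk hne.symm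
  rwa [ha'g.1, germPush_one, one_mul, germPush_eq_zero_iff] at hmul

theorem isIndicatorAt_src {a : Cc 𝕜 B G.Arr} (ha : a ∈ invariantWeaklyGrouplike (hopf 𝕜 G))
    {g : G.Arr} (hg : IsIndicatorAt G.ops.tgt a.1 g) : IsIndicatorAt G.ops.src a.1 g := by
  obtain ⟨g', hg', htgt, hsrc⟩ :=
    exists_isIndicatorAt_of_invariant ha (hg.normalizedAt G.isEtale.tgt_loc)
  exact htgt.unique hg hg' ▸ hsrc

theorem isIndicatorAt_antipode {a : Cc 𝕜 B G.Arr}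
    (ha : a ∈ invariantWeaklyGrouplike (hopf 𝕜 G)) {g : G.Arr}
    (hg : IsIndicatorAt G.ops.tgt a.1 g) :
    IsIndicatorAt G.ops.tgt ((hopf 𝕜 G).antipode a).1 (G.ops.inv g) :=
  (isIndicatorAt_src ha hg).pushSection G.isEtale.inv_loc.isLocalHomeomorph G.isEtale.tgt_inv

theorem liftElt_mem_invariantWeaklyGrouplike {U : Set G.Arr} (hU : IsOpen U)
    (htgt : InjOn G.ops.tgt U) (hsrc : InjOn G.ops.src U) {p : BaseAlg 𝕜 B M}
    (hp : tsupport p.1 ⊆ G.ops.tgt '' U) :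
    liftElt G hU htgt p hp ∈ invariantWeaklyGrouplike (hopf 𝕜 G) := by
  obtain ⟨q, hq1, hq⟩ := exists_baseAlg_eq_one_on_subset (𝕜 := 𝕜) (B := B) p.2.2
    (G.isEtale.tgt_loc.isLocalHomeomorph.isOpenMap _ hU) hp
  have hpq (z : M) (hz : z ∈ tsupport p.1) : q.1 z = 1 := (hq1 z hz).self_of_nhds
  have hmul : (q.1 ∘ G.ops.tgt) * (p.1 ∘ G.ops.tgt) = p.1 ∘ G.ops.tgt :=
    (mul_comm _ _).trans (congrArg (· ∘ G.ops.tgt) (mul_eq_left_of_forall_tsupport hpq))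
  refine ⟨liftElt G hU htgt q hq, (comul_eq_tmul_iff G.isEtale.tgt_loc _ _ _).2
    (isDiagProdAt_sheafLift G.isEtale.tgt_loc hU htgt hp hq hpq),
    (comul_eq_tmul_iff G.isEtale.tgt_loc _ _ _).2 fun y => isDiagProdAt_antipode_iff.2 ?_⟩
  have hdiag := isDiagProdAt_extZero G.isEtale.src_loc hsrc (q.1 ∘ G.ops.tgt) (p.1 ∘ G.ops.tgt) y
  rwa [hmul] at hdiag

variable (𝕜) in
theorem exists_invariant_isIndicatorAt (g : G.Arr) :
    ∃ a ∈ invariantWeaklyGrouplike (hopf 𝕜 G), IsIndicatorAt G.ops.tgt a.1 g := by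
  obtain ⟨V, hV, hgV, htgt⟩ := exists_injOn G.isEtale.tgt_loc.isLocalHomeomorph g
  obtain ⟨V', hV', hgV', hsrc⟩ := exists_injOn G.isEtale.src_loc.isLocalHomeomorph g
  have hU : IsOpen (V ∩ V') := hV.inter hV'
  have hinj : InjOn G.ops.tgt (V ∩ V') := htgt _ inter_subset_left
  obtain ⟨p, hp1, hp⟩ := exists_baseAlg_bump (𝕜 := 𝕜) (B := B)
    ((G.isEtale.tgt_loc.isLocalHomeomorph.isOpenMap _ hU).mem_nhds
      (mem_image_of_mem G.ops.tgt ⟨hgV, hgV'⟩))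
  exact ⟨liftElt G hU hinj p hp,
    liftElt_mem_invariantWeaklyGrouplike hU hinj (hsrc _ inter_subset_right) hp,
    isIndicatorAt_extZero G.isEtale.tgt_loc.isLocalHomeomorph.continuous hinj ⟨hgV, hgV'⟩ hp1⟩

theorem pushforward_antipode (u : Cc 𝕜 B G.Arr) :
    pushforward G.isEtale.tgt_loc ((hopf 𝕜 G).antipode u) = pushforward G.isEtale.src_loc u := by
  refine Subtype.ext (funext fun x => ?_)
  let e : {g // G.ops.src g = x} → {k // G.ops.tgt k = x} :=
    fun g => ⟨G.ops.inv g.1, (G.isEtale.tgt_inv g.1).trans g.2⟩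
  have he : Function.Bijective e := by
    refine ⟨fun g g' h => Subtype.ext (G.isEtale.inv_injective (congrArg Subtype.val h)), ?_⟩
    exact fun k => ⟨⟨G.ops.inv k.1, (G.isEtale.src_inv k.1).trans k.2⟩,
      Subtype.ext (G.isEtale.inv_inv k.1)⟩
  exact (finsum_eq_of_bijective e he fun g => (germPush_antipode u g.2 _).symm).symm

theorem opT_hopf_apply (a : Cc 𝕜 B G.Arr) (p : BaseAlg 𝕜 B M) (x : M) :
    (opT (hopf 𝕜 G) a p).1 x =
      ((pushforward G.isEtale.src_loc (sheafAct G.isEtale.tgt_loc p a)).1 x).value :=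
  congrArg (fun w : Cc 𝕜 B M => (w.1 x).value) (pushforward_antipode _)

theorem opT_hopf_apply_src {a : Cc 𝕜 B G.Arr} {g : G.Arr} (hg : IsIndicatorAt G.ops.src a.1 g)
    (p : BaseAlg 𝕜 B M) : (opT (hopf 𝕜 G) a p).1 (G.ops.src g) = p.1 (G.ops.tgt g) := by
  have hsum : (pushforward G.isEtale.src_loc (sheafAct G.isEtale.tgt_loc p a)).1 (G.ops.src g) =
      germPush G.isEtale.src_loc.isLocalHomeomorph rfl ((sheafAct G.isEtale.tgt_loc p a).1 g) := by
    refine finsum_eq_single _ (⟨g, rfl⟩ : {k // G.ops.src k = G.ops.src g}) fun k hk => ?_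
    have hzero : (sheafAct G.isEtale.tgt_loc p a).1 k.1 = 0 := by
      rw [sheafAct_apply G.isEtale.tgt_loc, hg.2 _ k.2 fun h => hk (Subtype.ext h), mul_zero]
    rw [hzero, germPush_zero]
  rw [opT_hopf_apply, hsum, germPush_value, sheafAct_apply G.isEtale.tgt_loc, hg.1, mul_one]
  rfl

theorem opT_hopf_apply_eq_zero {a : Cc 𝕜 B G.Arr} {p : BaseAlg 𝕜 B M} {x : M}
    (h : ∀ g, G.ops.src g = x → G.ops.tgt g ∈ tsupport p.1 → a.1 g = 0) :
    (opT (hopf 𝕜 G) a p).1 x = 0 := by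
  have hzero (g : G.Arr) (hg : G.ops.src g = x) : (sheafAct G.isEtale.tgt_loc p a).1 g = 0 := by
    rw [sheafAct_apply G.isEtale.tgt_loc]
    by_cases hp : G.ops.tgt g ∈ tsupport p.1
    · rw [h g hg hp, mul_zero]
    · rw [germ_comp_eq_zero G.isEtale.tgt_loc.isLocalHomeomorph.continuous.continuousAt
        (notMem_tsupport_iff_eventuallyEq.1 hp), zero_mul]
  have hsum : (pushforward G.isEtale.src_loc (sheafAct G.isEtale.tgt_loc p a)).1 x = 0 :=
    finsum_eq_zero_of_forall_eq_zero fun g => by rw [hzero g.1 g.2, germPush_zero]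
  rw [opT_hopf_apply, hsum]
  rfl

end GroupoidAlgebra

section Transition

variable {𝕜 : Type*} [RCLike 𝕜] {B : Type*} [NormedAddCommGroup B] [NormedSpace ℝ B]
  {X M : Type*} [TopologicalSpace X] [ChartedSpace B X] [TopologicalSpace M] [ChartedSpace B M]

theorem exists_openPartialHomeomorph_of_injOn [Nonempty X] {s : X → M}
    (hs : IsLocalDiffeomorph 𝓘(ℝ, B) 𝓘(ℝ, B) ∞ s) {O : Set X} (hO : IsOpen O)
    (hinj : InjOn s O) :
    ∃ σ : OpenPartialHomeomorph X M, ⇑σ = s ∧ σ.source = O ∧ σ.target = s '' O ∧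
      ContMDiffOn 𝓘(ℝ, B) 𝓘(ℝ, B) ∞ σ.symm σ.target := by
  refine ⟨OpenPartialHomeomorph.ofContinuousOpen (hinj.toPartialEquiv s O)
    hs.isLocalHomeomorph.continuous.continuousOn hs.isLocalHomeomorph.isOpenMap hO,
    rfl, rfl, rfl, ?_⟩
  rintro _ ⟨x, hx, rfl⟩
  exact (contMDiffAt_leftInv hs hO (fun _ hy => hinj.leftInvOn_invFunOn hy) hx).contMDiffWithinAt

theorem exists_openPartialHomeomorph_comp_eqOn {s f : X → M}
    (hs : IsLocalDiffeomorph 𝓘(ℝ, B) 𝓘(ℝ, B) ∞ s) (hf : IsLocalDiffeomorph 𝓘(ℝ, B) 𝓘(ℝ, B) ∞ f)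
    {O : Set X} (hO : IsOpen O) (hsO : InjOn s O) (hfO : InjOn f O) :
    ∃ τ : OpenPartialHomeomorph M M, τ.source = s '' O ∧ τ.target = f '' O ∧ EqOn (τ ∘ s) f O ∧
      ContMDiffOn 𝓘(ℝ, B) 𝓘(ℝ, B) ∞ τ τ.source ∧
      ContMDiffOn 𝓘(ℝ, B) 𝓘(ℝ, B) ∞ τ.symm τ.target := by
  obtain hX | hX := isEmpty_or_nonempty X
  · refine ⟨OpenPartialHomeomorph.ofSet ∅ isOpen_empty, ?_, ?_, fun x => (hX.false x).elim,
      fun _ hx => hx.elim, fun _ hx => hx.elim⟩ <;>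
    exact (image_eq_empty.2 O.eq_empty_of_isEmpty).symm
  obtain ⟨σ, rfl, rfl, hσt, hσ⟩ := exists_openPartialHomeomorph_of_injOn hs hO hsO
  obtain ⟨ρ, rfl, hρs, hρt, hρ⟩ := exists_openPartialHomeomorph_of_injOn hf hO hfO
  refine ⟨σ.symm.trans' ρ hρs.symm, hσt, hρt, fun x hx => congrArg ρ (σ.left_inv hx), ?_, ?_⟩
  · exact hf.contMDiff.comp_contMDiffOn hσ
  · exact hs.contMDiff.comp_contMDiffOn hρ

theorem exists_baseAlg_of_contMDiffOn [T2Space M] {V K : Set M} {a : M → 𝕜} (hV : IsOpen V)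
    (hK : IsCompact K) (hKV : K ⊆ V) (ha : ContMDiffOn 𝓘(ℝ, B) 𝓘(ℝ, 𝕜) ∞ a V)
    (h0 : ∀ x ∈ V, x ∉ K → a x = 0) :
    ∃ p : BaseAlg 𝕜 B M, tsupport p.1 ⊆ K ∧ EqOn p.1 a V := by
  let u : Cc 𝕜 B M := ⟨extZero V a, extZero_mem hV inferInstance ⟨ha, K, hKV, hK, h0⟩⟩
  have hin {x : M} (hx : x ∈ V) : (toBase u).1 x = a x :=
    congrArg Germ.value (extZero_of_mem a hx)
  have hout {x : M} (hx : x ∉ V) : (toBase u).1 x = 0 :=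
    congrArg Germ.value (extZero_of_notMem a hx)
  refine ⟨toBase u, closure_minimal (fun x hx => ?_) hK.isClosed, fun x hx => hin hx⟩
  by_contra hxK
  by_cases hxV : x ∈ V
  · exact hx ((hin hxV).trans (h0 x hxV hxK))
  · exact hx (hout hxV)

variable [T2Space M] {τ : OpenPartialHomeomorph M M}

theorem exists_baseAlg_comp_openPartialHomeomorph
    (hτ : ContMDiffOn 𝓘(ℝ, B) 𝓘(ℝ, B) ∞ τ τ.source) {p : BaseAlg 𝕜 B M}
    (hp : tsupport p.1 ⊆ τ.target) :
    ∃ q : BaseAlg 𝕜 B M, tsupport q.1 ⊆ τ.source ∧ EqOn q.1 (p.1 ∘ τ) τ.source := by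
  have hK : τ.symm '' tsupport p.1 ⊆ τ.source := by
    rintro _ ⟨y, hy, rfl⟩
    exact τ.map_target (hp hy)
  have hcomp (x : M) (hx : x ∈ τ.source) (hxK : x ∉ τ.symm '' tsupport p.1) :
      (p.1 ∘ τ) x = 0 :=
    image_eq_zero_of_notMem_tsupport (f := p.1) fun h => hxK ⟨τ x, h, τ.left_inv hx⟩
  obtain ⟨q, hqK, hq⟩ := exists_baseAlg_of_contMDiffOn (𝕜 := 𝕜) (B := B) τ.open_source
    (p.2.2.isCompact.image_of_continuousOn (τ.continuousOn_symm.mono hp)) hK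
    (p.2.1.comp_contMDiffOn hτ) hcomp
  exact ⟨q, hqK.trans hK, hq⟩

theorem image_tsupport_subset_eq (hτ : ContMDiffOn 𝓘(ℝ, B) 𝓘(ℝ, B) ∞ τ τ.source)
    (hτs : ContMDiffOn 𝓘(ℝ, B) 𝓘(ℝ, B) ∞ τ.symm τ.target) {T : BaseAlg 𝕜 B M → BaseAlg 𝕜 B M}
    (hin : ∀ p : BaseAlg 𝕜 B M, tsupport p.1 ⊆ τ.target → EqOn (T p).1 (p.1 ∘ τ) τ.source)
    (hout : ∀ p : BaseAlg 𝕜 B M, tsupport p.1 ⊆ τ.target → ∀ x ∉ τ.source, (T p).1 x = 0) :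
    T '' {p | tsupport p.1 ⊆ τ.target} = {q | tsupport q.1 ⊆ τ.source} := by
  have hext {p q : BaseAlg 𝕜 B M} (hp : tsupport p.1 ⊆ τ.target) (hq : tsupport q.1 ⊆ τ.source)
      (hpq : EqOn (p.1 ∘ τ) q.1 τ.source) : T p = q := by
    refine Subtype.ext (funext fun x => ?_)
    by_cases hx : x ∈ τ.source
    · exact (hin p hp hx).trans (hpq hx)
    · rw [hout p hp x hx, image_eq_zero_of_notMem_tsupport fun h => hx (hq h)]
  refine Subset.antisymm ?_ fun q hq => ?_
  · rintro _ ⟨p, hp, rfl⟩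
    obtain ⟨q, hq, hpq⟩ := exists_baseAlg_comp_openPartialHomeomorph hτ hp
    rw [hext hp hq hpq.symm]
    exact hq
  · obtain ⟨p, hp, hpq⟩ := exists_baseAlg_comp_openPartialHomeomorph (τ := τ.symm) hτs hq
    refine ⟨p, hp, hext hp hq fun x hx => ?_⟩
    rw [Function.comp_apply, hpq (τ.map_source hx), Function.comp_apply, τ.left_inv hx]

end Transition

section Tau

variable {𝕜 : Type*} [RCLike 𝕜] {B : Type*} [NormedAddCommGroup B] [NormedSpace ℝ B]
  [FiniteDimensional ℝ B] {M : Type*} [TopologicalSpace M] [ChartedSpace B M]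
  [IsManifold 𝓘(ℝ, B) ∞ M] [T2Space M] {G : EtaleLieGroupoid B M} {a : Cc 𝕜 B G.Arr}
  (ha : a ∈ invariantWeaklyGrouplike (hopf 𝕜 G)) {W : Set M}

include ha

theorem exists_isTau (hWo : IsOpen W)
    (hW : ∀ y ∈ W, NormalizedAt (hopf 𝕜 G).toCoalgebraOps a y) : ∃ τ, IsTau (hopf 𝕜 G) a W τ := by
  let O : Set G.Arr := G.ops.tgt ⁻¹' W ∩ {g | IsIndicatorAt G.ops.tgt a.1 g}
  have hO : IsOpen O := (hWo.preimage G.isEtale.tgt_loc.isLocalHomeomorph.continuous).inter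
    (isOpen_isIndicatorAt G.isEtale.tgt_loc a)
  have htgt : InjOn G.ops.tgt O := fun _ hg _ hh e => hg.2.unique hh.2 e
  have hsrc : InjOn G.ops.src O := fun _ hg _ hh e =>
    (isIndicatorAt_src ha hg.2).unique (isIndicatorAt_src ha hh.2) e
  obtain ⟨τ, hτs, hτt, hτ, hsmooth, hsmooth'⟩ :=
    exists_openPartialHomeomorph_comp_eqOn G.isEtale.src_loc G.isEtale.tgt_loc hO hsrc htgt
  obtain rfl : τ.target = W := by
    refine hτt.trans (Subset.antisymm (image_subset_iff.2 fun g hg => hg.1) fun y hy => ?_)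
    obtain ⟨g, rfl, hg, -⟩ := exists_isIndicatorAt_of_invariant ha (hW y hy)
    exact ⟨g, ⟨hy, hg⟩, rfl⟩
  have hin (p : BaseAlg 𝕜 B M) : EqOn (opT (hopf 𝕜 G) a p).1 (p.1 ∘ τ) τ.source := by
    rw [hτs]
    rintro _ ⟨g, hg, rfl⟩
    exact (opT_hopf_apply_src (isIndicatorAt_src ha hg.2) p).trans (congrArg p.1 (hτ hg).symm)
  refine ⟨τ, rfl, hsmooth, hsmooth', ?_, fun p _ => hin p⟩
  refine image_tsupport_subset_eq hsmooth hsmooth' (fun p _ => hin p) fun p hp x hx => ?_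
  refine opT_hopf_apply_eq_zero fun k hk hkp => ?_
  obtain ⟨g, hgk, hg, -⟩ := exists_isIndicatorAt_of_invariant ha (hW _ (hp hkp))
  refine hg.2 k hgk.symm ?_
  rintro rfl
  exact hx (hτs ▸ ⟨k, ⟨hp hkp, hg⟩, hk⟩)

theorem isTau_symm_apply {τ : OpenPartialHomeomorph M M} (hτ : IsTau (hopf 𝕜 G) a W τ) {g : G.Arr}
    (hgW : G.ops.tgt g ∈ W) (hg : IsIndicatorAt G.ops.tgt a.1 g) :
    τ.symm (G.ops.tgt g) = G.ops.src g := by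
  have hy : G.ops.tgt g ∈ τ.target := hτ.target_eq.symm ▸ hgW
  by_contra hne
  obtain ⟨q, hq1, hq⟩ := exists_baseAlg_bump (𝕜 := 𝕜) (B := B)
    ((τ.open_source.inter isOpen_compl_singleton).mem_nhds ⟨τ.map_target hy, hne⟩)
  obtain ⟨p, hp, rfl⟩ : q ∈ opT (hopf 𝕜 G) a '' {p | tsupport p.1 ⊆ W} :=
    hτ.image_eq.symm ▸ hq.trans inter_subset_left
  have hp1 : p.1 (G.ops.tgt g) = 1 := by
    rw [← hq1.self_of_nhds, hτ.apply_eq p hp _ (τ.map_target hy), τ.right_inv hy]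
  rw [← opT_hopf_apply_src (isIndicatorAt_src ha hg) p,
    image_eq_zero_of_notMem_tsupport fun h => (hq h).2 rfl] at hp1
  exact zero_ne_one hp1

end Tau

section Transport

/-- The groupoid structure on `Y` obtained from one on `X` along a bijection `X ≃ Y` of arrows. -/
def GroupoidOps.transport {M X Y : Type*} (Γ : GroupoidOps M X) (e : X ≃ Y) : GroupoidOps M Y where
  src := Γ.src ∘ e.symm
  tgt := Γ.tgt ∘ e.symm
  unit := e ∘ Γ.unit
  inv := e ∘ Γ.inv ∘ e.symm
  mul g h c := e (Γ.mul (e.symm g) (e.symm h) c)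

variable {B : Type*} [NormedAddCommGroup B] [NormedSpace ℝ B]
variable {M X Y : Type*} [TopologicalSpace M] [ChartedSpace B M] [TopologicalSpace X]
  [ChartedSpace B X] [TopologicalSpace Y] [ChartedSpace B Y]
variable {Γ : GroupoidOps M X} (D : X ≃ₘ^∞⟮𝓘(ℝ, B), 𝓘(ℝ, B)⟯ Y)

theorem isLocalDiffeomorph_transport_mul (hΓ : IsEtaleLieGroupoid B Γ)
    (hs : IsLocalDiffeomorph 𝓘(ℝ, B) 𝓘(ℝ, B) ∞ (Γ.transport D.toEquiv).src)
    (ht : IsLocalDiffeomorph 𝓘(ℝ, B) 𝓘(ℝ, B) ∞ (Γ.transport D.toEquiv).tgt) :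
    IsLocalDiffeomorph 𝓘(ℝ, B) 𝓘(ℝ, B) ∞
      (fun p : FibreProd hs ht => (Γ.transport D.toEquiv).mul p.fst p.snd p.comm) := by
  have htgt : (Γ.transport D.toEquiv).tgt ∘
      (fun p : FibreProd hs ht => (Γ.transport D.toEquiv).mul p.fst p.snd p.comm) =
        (Γ.transport D.toEquiv).tgt ∘ FibreProd.fst :=
    funext fun p => (congrArg Γ.tgt (D.symm_apply_apply _)).trans (hΓ.tgt_mul _ _ p.comm)
  have hpair : Continuous fun p : FibreProd hs ht =>
      (⟨D.symm p.fst, D.symm p.snd, p.comm⟩ : FibreProd hΓ.src_loc hΓ.tgt_loc) :=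
    FibreProd.isInducing_toProd.continuous_iff.2
      ((D.symm.continuous.comp FibreProd.continuous_fst).prodMk
        (D.symm.continuous.comp FibreProd.continuous_snd))
  refine isLocalDiffeomorph_of_comp ht ?_
    (D.continuous.comp (hΓ.mul_loc.isLocalHomeomorph.continuous.comp hpair))
  rw [htgt]
  exact fun p => (FibreProd.isLocalDiffeomorph_fst p).comp 𝓘(ℝ, B) M (ht _)

theorem isEtaleLieGroupoid_transport [IsManifold 𝓘(ℝ, B) ∞ Y] (hΓ : IsEtaleLieGroupoid B Γ) :
    IsEtaleLieGroupoid B (Γ.transport D.toEquiv) where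
  isManifold := inferInstance
  src_loc g := (D.symm.isLocalDiffeomorph g).comp 𝓘(ℝ, B) M (hΓ.src_loc _)
  tgt_loc g := (D.symm.isLocalDiffeomorph g).comp 𝓘(ℝ, B) M (hΓ.tgt_loc _)
  unit_loc y := (hΓ.unit_loc y).comp 𝓘(ℝ, B) Y (D.isLocalDiffeomorph _)
  inv_loc g := ((D.symm.isLocalDiffeomorph g).comp 𝓘(ℝ, B) X (hΓ.inv_loc _)).comp 𝓘(ℝ, B) Y
    (D.isLocalDiffeomorph _)
  mul_loc := isLocalDiffeomorph_transport_mul D hΓ _ _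
  src_unit y := (congrArg Γ.src (D.symm_apply_apply _)).trans (hΓ.src_unit y)
  tgt_unit y := (congrArg Γ.tgt (D.symm_apply_apply _)).trans (hΓ.tgt_unit y)
  src_inv _ := (congrArg Γ.src (D.symm_apply_apply _)).trans (hΓ.src_inv _)
  tgt_inv _ := (congrArg Γ.tgt (D.symm_apply_apply _)).trans (hΓ.tgt_inv _)
  src_mul _ _ c := (congrArg Γ.src (D.symm_apply_apply _)).trans (hΓ.src_mul _ _ c)
  tgt_mul _ _ c := (congrArg Γ.tgt (D.symm_apply_apply _)).trans (hΓ.tgt_mul _ _ c)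
  mul_assoc _ _ _ c c' := congrArg D <|
    ((GroupoidOps.mul_congr _ _ (D.symm_apply_apply _) rfl).trans
      (hΓ.mul_assoc _ _ _ c c')).trans
        (GroupoidOps.mul_congr _ _ rfl (D.symm_apply_apply _).symm)
  unit_mul g := (congrArg D ((GroupoidOps.mul_congr _ _ (D.symm_apply_apply _) rfl).trans
    (hΓ.unit_mul _))).trans (D.apply_symm_apply g)
  mul_unit g := (congrArg D ((GroupoidOps.mul_congr _ _ rfl (D.symm_apply_apply _)).trans
    (hΓ.mul_unit _))).trans (D.apply_symm_apply g)
  inv_mul _ := congrArg D ((GroupoidOps.mul_congr _ _ (D.symm_apply_apply _) rfl).trans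
    (hΓ.inv_mul _))
  mul_inv _ := congrArg D ((GroupoidOps.mul_congr _ _ rfl (D.symm_apply_apply _)).trans
    (hΓ.mul_inv _))

omit [TopologicalSpace M] [ChartedSpace B M] in
theorem isGroupoidMorphism_transport :
    IsGroupoidMorphism B Γ (Γ.transport D.toEquiv) D where
  smooth := D.contMDiff
  src_eq g := congrArg Γ.src (D.symm_apply_apply g)
  tgt_eq g := congrArg Γ.tgt (D.symm_apply_apply g)
  unit_eq _ := rfl
  mul_eq g h _ := congrArg D
    (GroupoidOps.mul_congr _ _ (D.symm_apply_apply g).symm (D.symm_apply_apply h).symm)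

end Transport

section Uniqueness

variable {𝕜 : Type*} [RCLike 𝕜]
variable {B : Type*} [NormedAddCommGroup B] [NormedSpace ℝ B] [FiniteDimensional ℝ B]
variable {M : Type*} [TopologicalSpace M] [ChartedSpace B M] [IsManifold 𝓘(ℝ, B) ∞ M] [T2Space M]
variable {A : Type*} [AddCommGroup A] [Module 𝕜 A] {𝒜 : HopfAlgebroidOps 𝕜 B M A}

theorem IsSpectralGroupoid.unique {Γ Γ' : GroupoidOps M (Gsp 𝒜)} (h : IsSpectralGroupoid 𝒜 Γ)
    (h' : IsSpectralGroupoid 𝒜 Γ') : Γ = Γ' := by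
  have htgt : Γ.tgt = Γ'.tgt := funext fun ζ => (h.tgt_eq ζ).trans (h'.tgt_eq ζ).symm
  have hsrc : Γ.src = Γ'.src := by
    funext ζ
    obtain ⟨a, ha, hn, hζ⟩ := ζ.2
    obtain ⟨W, hW, hWo, hyW⟩ := eventually_nhds_iff.1 (eventually_eventually_nhds.2 hn)
    obtain ⟨⟨τ, hτ⟩, hs⟩ := h.src_eq a ha W hWo hW
    rw [hs τ hτ ζ _ hyW hζ, (h'.src_eq a ha W hWo hW).2 τ hτ ζ _ hyW hζ]
  have hunit : Γ.unit = Γ'.unit := by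
    funext y
    obtain ⟨f, hf⟩ := exists_baseAlg_eq_one (𝕜 := 𝕜) (B := B) y
    exact Subtype.ext (Subtype.ext ((h.unit_eq y f hf).trans (h'.unit_eq y f hf).symm))
  have hinv : Γ.inv = Γ'.inv := by
    funext ζ
    obtain ⟨a, ha, hn, hζ⟩ := ζ.2
    refine Subtype.ext (Subtype.ext ?_)
    rw [h.inv_eq ζ a ha _ hn hζ, h'.inv_eq ζ a ha _ hn hζ, hsrc]
  have hmul (ζ ξ : Gsp 𝒜) (e : Γ.src ζ = Γ.tgt ξ) (e' : Γ'.src ζ = Γ'.tgt ξ) :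
      Γ.mul ζ ξ e = Γ'.mul ζ ξ e' := by
    obtain ⟨b, hb, hbn, hζ⟩ := ζ.2
    obtain ⟨a, ha, han, hξ⟩ := ξ.2
    refine Subtype.ext (Subtype.ext ?_)
    rw [h.mul_eq ζ ξ e b hb _ hbn hζ a ha _ han hξ, h'.mul_eq ζ ξ e' b hb _ hbn hζ a ha _ han hξ]
  obtain ⟨src, tgt, unit, inv, mul⟩ := Γ
  obtain ⟨src', tgt', unit', inv', mul'⟩ := Γ'
  subst htgt hsrc hunit hinv
  congr 1
  funext ζ ξ e
  exact hmul ζ ξ e e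

end Uniqueness

section SpectralGroupoidOfGroupoid

variable (𝕜 : Type*) [RCLike 𝕜]
variable {B : Type*} [NormedAddCommGroup B] [NormedSpace ℝ B] [FiniteDimensional ℝ B]
variable {M : Type*} [TopologicalSpace M] [ChartedSpace B M] [IsManifold 𝓘(ℝ, B) ∞ M] [T2Space M]
variable (G : EtaleLieGroupoid B M)

theorem espPoint_mem_arrows (g : G.Arr) : espPoint 𝕜 G.isEtale.tgt_loc g ∈ arrows (hopf 𝕜 G) := by
  obtain ⟨a, ha, hag⟩ := exists_invariant_isIndicatorAt 𝕜 g
  exact ⟨a, ha, hag.normalizedAt G.isEtale.tgt_loc,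
    (espPoint_eq_classAt_iff G.isEtale.tgt_loc).2 ⟨rfl, hag⟩⟩

theorem arrows_hopf_eq_univ : arrows (hopf 𝕜 G) = univ := by
  refine eq_univ_of_forall fun ζ => ?_
  obtain ⟨g, rfl⟩ := espPoint_surjective (𝕜 := 𝕜) G.isEtale.tgt_loc ζ
  exact espPoint_mem_arrows 𝕜 G g

/-- The homeomorphism `Φ_G : G → G_sp(C_c^∞(G))`, which is `espHomeomorph` for the target map with
its values regarded as arrows of `G_sp(C_c^∞(G))`. -/
noncomputable def gspHomeomorph : G.Arr ≃ₜ Gsp (hopf 𝕜 G) where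
  toFun g := ⟨espPoint 𝕜 G.isEtale.tgt_loc g, espPoint_mem_arrows 𝕜 G g⟩
  invFun ζ := (espHomeomorph 𝕜 G.isEtale.tgt_loc).symm ζ.1
  left_inv g := (espHomeomorph 𝕜 G.isEtale.tgt_loc).symm_apply_apply g
  right_inv ζ := Subtype.ext ((espHomeomorph 𝕜 G.isEtale.tgt_loc).apply_symm_apply ζ.1)
  continuous_toFun := (continuous_espPoint G.isEtale.tgt_loc).subtype_mk _
  continuous_invFun := (espHomeomorph 𝕜 G.isEtale.tgt_loc).symm.continuous.comp
    continuous_subtype_val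

variable {G}

theorem gspHomeomorph_eq_classAt_iff {g : G.Arr} {c : Cc 𝕜 B G.Arr} {y : M} :
    (gspHomeomorph 𝕜 G g).1.1 = classAt (hopf 𝕜 G).toCoalgebraOps c y ↔
      G.ops.tgt g = y ∧ IsIndicatorAt G.ops.tgt c.1 g :=
  espPoint_eq_classAt_iff G.isEtale.tgt_loc

theorem eq_classAt_hopf_iff {ζ : Gsp (hopf 𝕜 G)} {c : Cc 𝕜 B G.Arr} {y : M} :
    ζ.1.1 = classAt (hopf 𝕜 G).toCoalgebraOps c y ↔
      G.ops.tgt ((gspHomeomorph 𝕜 G).symm ζ) = y ∧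
        IsIndicatorAt G.ops.tgt c.1 ((gspHomeomorph 𝕜 G).symm ζ) := by
  rw [← gspHomeomorph_eq_classAt_iff, Homeomorph.apply_symm_apply]

theorem gspHomeomorph_natural {H : EtaleLieGroupoid B M} {φ : G.Arr → H.Arr}
    (hφ : IsGroupoidMorphism B G.ops H.ops φ) (g : G.Arr) :
    (gspHomeomorph 𝕜 H (φ g)).1.1 = spectralMap 𝕜 hφ (gspHomeomorph 𝕜 G g).1.1 := by
  obtain ⟨a, -, ha⟩ := exists_invariant_isIndicatorAt 𝕜 g
  rw [(gspHomeomorph_eq_classAt_iff 𝕜).2 ⟨rfl, ha⟩]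
  exact (gspHomeomorph_eq_classAt_iff 𝕜).2 ⟨hφ.tgt_eq g, isIndicatorAt_pushforward hφ ha⟩

variable (G)

theorem tgt_comp_gspHomeomorph_symm :
    G.ops.tgt ∘ (gspHomeomorph 𝕜 G).symm = Gsp.proj (hopf 𝕜 G) := by
  funext ζ
  obtain ⟨g, rfl⟩ := (gspHomeomorph 𝕜 G).surjective ζ
  exact congrArg G.ops.tgt ((gspHomeomorph 𝕜 G).symm_apply_apply g)

/-- The groupoid structure of `G_sp(C_c^∞(G))`, transported from `G` along `gspHomeomorph`. -/
noncomputable def spectralOps : GroupoidOps M (Gsp (hopf 𝕜 G)) :=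
  G.ops.transport (gspHomeomorph 𝕜 G).toEquiv

theorem isSpectralGroupoid_spectralOps :
    IsSpectralGroupoid (hopf 𝕜 G) (spectralOps 𝕜 G) where
  tgt_eq := congrFun (tgt_comp_gspHomeomorph_symm 𝕜 G)
  src_eq a ha W hWo hW := by
    refine ⟨exists_isTau ha hWo hW, fun τ hτ ζ y hy hζ => ?_⟩
    obtain ⟨rfl, hg⟩ := (eq_classAt_hopf_iff 𝕜).1 hζ
    exact (isTau_symm_apply ha hτ hy hg).symm
  unit_eq y _ hf := (gspHomeomorph_eq_classAt_iff 𝕜).2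
    ⟨G.isEtale.tgt_unit y, isIndicatorAt_hopf_incl hf⟩
  inv_eq _ _ ha _ _ hζ := (gspHomeomorph_eq_classAt_iff 𝕜).2
    ⟨G.isEtale.tgt_inv _, isIndicatorAt_antipode ha ((eq_classAt_hopf_iff 𝕜).1 hζ).2⟩
  mul_eq _ _ h _ _ _ _ hζ _ _ _ _ hξ := by
    obtain ⟨hz, hb⟩ := (eq_classAt_hopf_iff 𝕜).1 hζ
    obtain ⟨-, ha⟩ := (eq_classAt_hopf_iff 𝕜).1 hξ
    exact (gspHomeomorph_eq_classAt_iff 𝕜).2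
      ⟨(G.isEtale.tgt_mul _ _ h).trans hz, isIndicatorAt_hopf_mul h hb ha⟩

theorem isLocalHomeomorph_gspProj : IsLocalHomeomorph (Gsp.proj (hopf 𝕜 G)) := by
  rw [← tgt_comp_gspHomeomorph_symm]
  exact G.isEtale.tgt_loc.isLocalHomeomorph.comp (gspHomeomorph 𝕜 G).symm.isLocalHomeomorph

noncomputable local instance : ChartedSpace B (Gsp (hopf 𝕜 G)) :=
  pullbackCharts (isLocalHomeomorph_gspProj 𝕜 G)

theorem isLocalDiffeomorph_gspProj :
    IsLocalDiffeomorph 𝓘(ℝ, B) 𝓘(ℝ, B) ∞ (Gsp.proj (hopf 𝕜 G)) :=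
  pullbackCharts_isLocalDiffeomorph (isLocalHomeomorph_gspProj 𝕜 G)

theorem isLocalDiffeomorph_gspHomeomorph :
    IsLocalDiffeomorph 𝓘(ℝ, B) 𝓘(ℝ, B) ∞ (gspHomeomorph 𝕜 G) :=
  isLocalDiffeomorph_of_comp (isLocalDiffeomorph_gspProj 𝕜 G) G.isEtale.tgt_loc
    (gspHomeomorph 𝕜 G).continuous

theorem isLocalDiffeomorph_gspHomeomorph_symm :
    IsLocalDiffeomorph 𝓘(ℝ, B) 𝓘(ℝ, B) ∞ (gspHomeomorph 𝕜 G).symm :=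
  isLocalDiffeomorph_of_comp G.isEtale.tgt_loc
    ((tgt_comp_gspHomeomorph_symm 𝕜 G).symm ▸ isLocalDiffeomorph_gspProj 𝕜 G)
    (gspHomeomorph 𝕜 G).symm.continuous

/-- `gspHomeomorph` as a diffeomorphism, for the smooth structure on `G_sp(C_c^∞(G))` which makes
the projection to `M` a local diffeomorphism. -/
noncomputable def gspDiffeomorph : G.Arr ≃ₘ^∞⟮𝓘(ℝ, B), 𝓘(ℝ, B)⟯ Gsp (hopf 𝕜 G) where
  toEquiv := (gspHomeomorph 𝕜 G).toEquiv
  contMDiff_toFun := (isLocalDiffeomorph_gspHomeomorph 𝕜 G).contMDiff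
  contMDiff_invFun := (isLocalDiffeomorph_gspHomeomorph_symm 𝕜 G).contMDiff

theorem isEtaleLieGroupoid_spectralOps : IsEtaleLieGroupoid B (spectralOps 𝕜 G) :=
  haveI : IsManifold 𝓘(ℝ, B) ∞ (Gsp (hopf 𝕜 G)) :=
    pullbackCharts_isManifold (isLocalHomeomorph_gspProj 𝕜 G)
  isEtaleLieGroupoid_transport (gspDiffeomorph 𝕜 G) G.isEtale

theorem isGroupoidMorphism_gspHomeomorph :
    IsGroupoidMorphism B G.ops (spectralOps 𝕜 G) (gspHomeomorph 𝕜 G) :=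
  isGroupoidMorphism_transport (gspDiffeomorph 𝕜 G)

end SpectralGroupoidOfGroupoid

end SpectralGroupoid

theorem theorem25 {𝕜 : Type u} [RCLike 𝕜]
    {B : Type v} [NormedAddCommGroup B] [NormedSpace ℝ B] [FiniteDimensional ℝ B]
    {M : Type w} [TopologicalSpace M] [ChartedSpace B M] [IsManifold 𝓘(ℝ, B) ∞ M] [T2Space M] :
    -- the formulas of the spectral étale groupoid are well defined
    (∀ G : EtaleLieGroupoid.{v, w, x} B M,
      ∃! Γ : GroupoidOps M (Gsp (hopf 𝕜 G)), IsSpectralGroupoid (hopf 𝕜 G) Γ) ∧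
    ∃ Φ : ∀ G : EtaleLieGroupoid.{v, w, x} B M, G.Arr → Gsp (hopf 𝕜 G),
      -- the formula for the maps `Φ G`
      (∀ (G : EtaleLieGroupoid.{v, w, x} B M) (g : G.Arr) (U : Set G.Arr) (hU : IsOpen U)
        (hinj : InjOn G.ops.tgt U) (f : BaseAlg 𝕜 B M) (hf : tsupport f.1 ⊆ G.ops.tgt '' U),
        g ∈ U → (∀ᶠ y in 𝓝 (G.ops.tgt g), f.1 y = 1) →
        (Φ G g).1.1 = classAt (hopf 𝕜 G).toCoalgebraOps (liftElt G hU hinj f hf) (G.ops.tgt g)) ∧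
      -- `Φ G` is an isomorphism of étale Lie groupoids over `M`
      (∀ (G : EtaleLieGroupoid.{v, w, x} B M) (Γ : GroupoidOps M (Gsp (hopf 𝕜 G))),
        IsSpectralGroupoid (hopf 𝕜 G) Γ →
        ∃ h : IsLocalHomeomorph (Gsp.proj (hopf 𝕜 G)),
          letI : ChartedSpace B (Gsp (hopf 𝕜 G)) := pullbackCharts h
          IsEtaleLieGroupoid B Γ ∧ IsGroupoidMorphism B G.ops Γ (Φ G) ∧
            ∃ D : G.Arr ≃ₘ^∞⟮𝓘(ℝ, B), 𝓘(ℝ, B)⟯ Gsp (hopf 𝕜 G), ⇑D = Φ G) ∧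
      -- `Φ G` is natural in `G`
      (∀ (G H : EtaleLieGroupoid.{v, w, x} B M) (φ : G.Arr → H.Arr)
        (hφ : IsGroupoidMorphism B G.ops H.ops φ) (g : G.Arr),
        (Φ H (φ g)).1.1 = spectralMap 𝕜 hφ (Φ G g).1.1) ∧
      -- `G_sp(C_c^∞(G)) = E_sp(C_c^∞(G))`
      (∀ G : EtaleLieGroupoid.{v, w, x} B M, arrows (hopf 𝕜 G) = univ) := by
  refine ⟨fun G => ⟨spectralOps 𝕜 G, isSpectralGroupoid_spectralOps 𝕜 G,
    fun Γ hΓ => hΓ.unique (isSpectralGroupoid_spectralOps 𝕜 G)⟩,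
    fun G => gspHomeomorph 𝕜 G, ?_, ?_, ?_, arrows_hopf_eq_univ 𝕜⟩
  · intro G g U hU hinj f hf hg hf1
    exact (gspHomeomorph_eq_classAt_iff 𝕜).2 ⟨rfl, isIndicatorAt_extZero
      G.isEtale.tgt_loc.isLocalHomeomorph.continuous hinj hg hf1⟩
  · intro G Γ hΓ
    obtain rfl : Γ = spectralOps 𝕜 G := hΓ.unique (isSpectralGroupoid_spectralOps 𝕜 G)
    exact ⟨isLocalHomeomorph_gspProj 𝕜 G, isEtaleLieGroupoid_spectralOps 𝕜 G,
      isGroupoidMorphism_gspHomeomorph 𝕜 G, gspDiffeomorph 𝕜 G, rfl⟩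
  · intro G H φ hφ g
    exact gspHomeomorph_natural 𝕜 hφ g
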